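/- Let $K$ be a field of characteristic $0$. All shuffle operads are $K$-linear shuffle operads concentrated in arities $\ge 1$, with elementary compositions $u\circ_{i,\tau}v$ ($i$ an input of $u$, $\tau$ a shuffle permutation) and unit $1$. A bimodule over a shuffle operad $P$ is a family of $K$-vector spaces $A(k)$, $k\ge1$, with elementary left actions $u\circ_{i,\tau}a$ and right actions $a\circ_{i,\tau}u$ ($u\in P$, $a\in A$), bilinear and satisfying the unit, sequential and parallel laws of operadic composition whenever exactly one argument is in $A$. Write $P\langle Y\rangle$ for the free $P$-bimodule on a family of sets $Y=(Y(k))_{k\ge1}$, with generators $[y]$. A shuffle $\omega$-polygraph $X$ consists of a family of sets $X_0=(X_0(k))_{k\ge 1}$ and, for each $n\ge0$, a cellular extension $X_{n+1}$ of the free shuffle $n$-operad on $X_0,\dots,X_n$: a family of sets $X_{n+1}(k)$ whose elements have a source and a target that are parallel $n$-cells of arity $k$ (for $n\ge1$, parallel means having the same source and the same target; any two $0$-cells of the same arity are parallel). Here the $0$-cells $F=X_0^*$ form the free shuffle operad on $X_0$, and the $(n+1)$-cells $X_{n+1}^*$ form the quotient of the $F$-bimodule $F\langle X_{n+1}\rangle\oplus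 X_n^*$ (the second summand consisting of the identities $1_c$ of $n$-cells $c$) by the sub-bimodule generated by the linear exchange relations $$a\circ_{i,\tau}s_0(b)+t_0(a)\circ_{i,\tau}b-1_{t_0(a)\circ_{i,\tau}s_0(b)}=s_0(a)\circ_{i,\tau}b+a\circ_{i,\tau}t_0(b)-1_{s_0(a)\circ_{i,\tau}t_0(b)},$$ where $s_0,t_0$ are the $0$-dimensional source and target and $1_u$ is the iterated identity of a $0$-cell $u$; source and target of $(n+1)$-cells are the bimodule morphisms to $X_n^*$ extending those of the generators and equal to $c$ on $1_c$. The polygraph is acyclic if for every $n\ge 1$ and all parallel $n$-cells $f,g$ there is an $(n+1)$-cell with source $f$ and target $g$. The shuffle operad presented by $X$ is the coequalizer $P$ of $s_0,t_0:X_1^*\rightrightarrows F$, that is, the quotient of $F$ by the ideal generated by the elements $s_0(f)-t_0(f)$; write $\bar u\in P$ for the class of $u\in F$. Let $\mathbf 1$ be the family of sets with a single element $\varepsilon$, in arity $1$, and put $X_{-1}=\mathbf 1$. The trivial $P$-bimodule $\Omega_P$ is the quotient of $P\langle\mathbf 1\rangle$ by the relations $(\varepsilon\mid u)=\sum_{i=1}^k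 u\circ_i\varepsilon$ for all $k\ge1$ and $u\in P(k)$, where $(\varepsilon\mid u)$ is the right action of $u$ at the unique input of $\varepsilon$. Define morphisms of $P$-bimodules $\delta_n:P\langle X_{n+1}\rangle\to P\langle X_n\rangle$, $n\ge-1$, by: 1. $\delta_{-1}[x]=(\varepsilon\mid\bar x)-\sum_{i=1}^k\bar x\circ_i\varepsilon$ for $x\in X_0(k)$; 2. $\delta_0[\alpha]=[s_0(\alpha)]-[t_0(\alpha)]$ for $\alpha\in X_1$, where $[\;]:F\to P\langle X_0\rangle$ is the derivation (the linear map with $[1]=0$ and $[u\circ_{i,\tau}v]=[u]\circ_{i,\tau}\bar v+\bar u\circ_{i,\tau}[v]$) sending each $x\in X_0$ to the generator $[x]$; 3. for $n\ge1$, $\delta_n[A]=[s(A)]-[t(A)]$ for $A\in X_{n+1}$, where $s(A),t(A)\in X_n^*$ are the source and target of $A$, and where the linear map $[\;]:X_n^*\to P\langle X_n\rangle$ sends $\sum_j\lambda_j\Gamma_j[\alpha_j]+1_c$, with $\alpha_j\in X_n$ and $\Gamma_j$ one-hole contexts of $F$, to $\sum_j\lambda_j\overline{\Gamma_j}[\alpha_j]$,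 $\overline{\Gamma_j}$ being the context of $P$ induced by $\Gamma_j$. If $X$ is acyclic, then $$\cdots\longrightarrow P\langle X_{n+1}\rangle\xrightarrow{\ \delta_n\ }P\langle X_n\rangle\longrightarrow\cdots\longrightarrow P\langle X_0\rangle\xrightarrow{\ \delta_{-1}\ }P\langle\mathbf 1\rangle\longrightarrow\Omega_P\longrightarrow0,$$ the last map being the canonical projection, is an exact sequence of $P$-bimodules; that is, $P\langle X\rangle$ is a resolution of $\Omega_P$ by free $P$-bimodules. -/

import Mathlib

universe u

namespace Shuffle

/-! ### Elementary compositions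

Arities are positive, and an object of arity `n + 1` is stored at the index `n`.  Leaves of an
operation of arity `n + 1` are labelled by `Fin (n + 1)`. -/

/-- The data `(i, τ)` of an elementary composition `x ∘_{i,τ} y`, with `x` of arity `k + 1`, `y` of
arity `l + 1` and result of arity `n + 1`.  `inner` lists, in increasing order, the labels of the
leaves of `y`, and `outer` lists, in increasing order, the labels of the leaves of `x`, the leaf at
which `y` is grafted being labelled by the smallest label of `y`. -/
structure Insertion (k l n : ℕ) where
  outer : Fin (k + 1) ↪o Fin (n + 1)
  inner : Fin (l + 1) ↪o Fin (n + 1)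
  graft : ∃ i, outer i = inner 0
  meet : ∀ p q, outer p = inner q → q = 0
  cover : ∀ j, j ∈ Set.range outer ∨ j ∈ Set.range inner

/-- Composition with an operation of arity `k + 1` below, along its root. -/
def Insertion.root (k : ℕ) : Insertion 0 k k where
  outer := OrderEmbedding.ofStrictMono (fun _ => 0) (fun i j h => by omega)
  inner := RelEmbedding.refl _
  graft := ⟨0, rfl⟩
  meet := fun _ _ h => h.symm
  cover := fun j => Or.inr ⟨j, rfl⟩

/-- Composition with an operation of arity one at the leaf `i`. -/
def Insertion.leaf {k : ℕ} (i : Fin (k + 1)) : Insertion k 0 k where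
  outer := RelEmbedding.refl _
  inner := OrderEmbedding.ofStrictMono (fun _ => i) (fun i j h => by omega)
  graft := ⟨i, rfl⟩
  meet := fun _ q _ => by omega
  cover := fun j => Or.inl ⟨j, rfl⟩

/-- The trees `(a ∘_α b) ∘_β c` and `a ∘_γ (b ∘_δ c)` agree (`c` is grafted on a leaf of `b`). -/
structure IsSequential {k l p r n q : ℕ} (α : Insertion k l p) (β : Insertion p r n)
    (γ : Insertion k q n) (δ : Insertion l r q) : Prop where
  left : ∀ x, β.outer (α.outer x) = γ.outer x
  middle : ∀ x, β.outer (α.inner x) = γ.inner (δ.outer x)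
  right : ∀ x, β.inner x = γ.inner (δ.inner x)

/-- The trees `(a ∘_α b) ∘_β c` and `(a ∘_γ c) ∘_δ b` agree (`b` and `c` are grafted on two
distinct leaves of `a`). -/
structure IsParallel {k l p r n q : ℕ} (α : Insertion k l p) (β : Insertion p r n)
    (γ : Insertion k r q) (δ : Insertion q l n) : Prop where
  left : ∀ x, β.outer (α.outer x) = δ.outer (γ.outer x)
  middle : ∀ x, β.outer (α.inner x) = δ.inner x
  right : ∀ x, β.inner x = δ.outer (γ.inner x)
  ne : β.inner 0 ≠ δ.inner 0

/-! ### Shuffle operads -/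

/-- A shuffle operad over `K`, presented by its unit and its elementary compositions. -/
structure Operad (K : Type u) [Field K] where
  Op : ℕ → Type u
  [acg : ∀ n, AddCommGroup (Op n)]
  [mod : ∀ n, Module K (Op n)]
  one : Op 0
  comp : ∀ {k l n : ℕ}, Insertion k l n → Op k →ₗ[K] Op l →ₗ[K] Op n
  one_comp : ∀ {n : ℕ} (ι : Insertion 0 n n) (a : Op n), comp ι one a = a
  comp_one : ∀ {n : ℕ} (ι : Insertion n 0 n) (a : Op n), comp ι a one = a
  comp_seq : ∀ {k l p r n q : ℕ} {α : Insertion k l p} {β : Insertion p r n}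
    {γ : Insertion k q n} {δ : Insertion l r q}, IsSequential α β γ δ →
    ∀ a b c, comp β (comp α a b) c = comp γ a (comp δ b c)
  comp_par : ∀ {k l p r n q : ℕ} {α : Insertion k l p} {β : Insertion p r n}
    {γ : Insertion k r q} {δ : Insertion q l n}, IsParallel α β γ δ →
    ∀ a b c, comp β (comp α a b) c = comp δ (comp γ a c) b

attribute [instance] Operad.acg Operad.mod

/-- Morphisms of shuffle operads. -/
structure Operad.Hom {K : Type u} [Field K] (P Q : Operad K) where
  map : ∀ n, P.Op n →ₗ[K] Q.Op n
  map_one : map 0 P.one = Q.one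
  map_comp : ∀ {k l n : ℕ} (ι : Insertion k l n) (a : P.Op k) (b : P.Op l),
    map n (P.comp ι a b) = Q.comp ι (map k a) (map l b)

/-! ### Bimodules over a shuffle operad -/

/-- A bimodule over a shuffle operad, presented by its elementary left and right actions
`u ∘_{i,τ} a` and `a ∘_{i,τ} v`. -/
structure Bimodule {K : Type u} [Field K] (P : Operad K) where
  Car : ℕ → Type u
  [acg : ∀ n, AddCommGroup (Car n)]
  [mod : ∀ n, Module K (Car n)]
  left : ∀ {k l n : ℕ}, Insertion k l n → P.Op k →ₗ[K] Car l →ₗ[K] Car n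
  right : ∀ {k l n : ℕ}, Insertion k l n → Car k →ₗ[K] P.Op l →ₗ[K] Car n
  one_left : ∀ {n : ℕ} (ι : Insertion 0 n n) (a : Car n), left ι P.one a = a
  right_one : ∀ {n : ℕ} (ι : Insertion n 0 n) (a : Car n), right ι a P.one = a
  seq_left_left : ∀ {k l p r n q : ℕ} {α : Insertion k l p} {β : Insertion p r n}
    {γ : Insertion k q n} {δ : Insertion l r q}, IsSequential α β γ δ →
    ∀ u v a, left β (P.comp α u v) a = left γ u (left δ v a)
  seq_left_right : ∀ {k l p r n q : ℕ} {α : Insertion k l p} {β : Insertion p r n}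
    {γ : Insertion k q n} {δ : Insertion l r q}, IsSequential α β γ δ →
    ∀ u a v, right β (left α u a) v = left γ u (right δ a v)
  seq_right_right : ∀ {k l p r n q : ℕ} {α : Insertion k l p} {β : Insertion p r n}
    {γ : Insertion k q n} {δ : Insertion l r q}, IsSequential α β γ δ →
    ∀ a u v, right β (right α a u) v = right γ a (P.comp δ u v)
  par_left_right : ∀ {k l p r n q : ℕ} {α : Insertion k l p} {β : Insertion p r n}
    {γ : Insertion k r q} {δ : Insertion q l n}, IsParallel α β γ δ →
    ∀ u a v, right β (left α u a) v = left δ (P.comp γ u v) a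
  par_right_right : ∀ {k l p r n q : ℕ} {α : Insertion k l p} {β : Insertion p r n}
    {γ : Insertion k r q} {δ : Insertion q l n}, IsParallel α β γ δ →
    ∀ a u v, right β (right α a u) v = right δ (right γ a v) u

attribute [instance] Bimodule.acg Bimodule.mod

namespace Bimodule

/-- Morphisms of bimodules. -/
@[ext] structure Hom {K : Type u} [Field K] {P : Operad K} (A B : Bimodule P) where
  map : ∀ n, A.Car n →ₗ[K] B.Car n
  map_left : ∀ {k l n : ℕ} (ι : Insertion k l n) (v : P.Op k) (a : A.Car l),
    map n (A.left ι v a) = B.left ι v (map l a)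
  map_right : ∀ {k l n : ℕ} (ι : Insertion k l n) (a : A.Car k) (v : P.Op l),
    map n (A.right ι a v) = B.right ι (map k a) v

section

variable {K : Type u} [Field K] {P : Operad K}

/-- The identity morphism. -/
def Hom.id (A : Bimodule P) : Hom A A where
  map := fun _ => LinearMap.id
  map_left := fun _ _ _ => rfl
  map_right := fun _ _ _ => rfl

/-- Composition of morphisms, `f` first. -/
def Hom.comp {A B C : Bimodule P} (g : Hom B C) (f : Hom A B) : Hom A C where
  map := fun n => (g.map n).comp (f.map n)
  map_left := fun ι v a => by simp [f.map_left, g.map_left]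
  map_right := fun ι a v => by simp [f.map_right, g.map_right]

/-- The operad as a bimodule over itself. -/
abbrev self (P : Operad K) : Bimodule P where
  Car := P.Op
  left := P.comp
  right := P.comp
  one_left := P.one_comp
  right_one := P.comp_one
  seq_left_left := P.comp_seq
  seq_left_right := P.comp_seq
  seq_right_right := P.comp_seq
  par_left_right := P.comp_par
  par_right_right := P.comp_par

/-- Restriction of scalars along a morphism of operads. -/
def restrict {Q : Operad K} (f : P.Hom Q) (A : Bimodule Q) : Bimodule P where
  Car := A.Car
  left := fun ι => (A.left ι).comp (f.map _)
  right := fun ι => (A.right ι).compl₂ (f.map _)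
  one_left := fun ι a => by simp [f.map_one, A.one_left]
  right_one := fun ι a => by simp [f.map_one, A.right_one]
  seq_left_left := fun h u v a => by simp [f.map_comp, A.seq_left_left h]
  seq_left_right := fun h u a v => by simp [A.seq_left_right h]
  seq_right_right := fun h a u v => by simp [f.map_comp, A.seq_right_right h]
  par_left_right := fun h u a v => by simp [f.map_comp, A.par_left_right h]
  par_right_right := fun h a u v => by simp [A.par_right_right h]

/-- The direct sum of two bimodules. -/
def prod (A B : Bimodule P) : Bimodule P where
  Car := fun n => A.Car n × B.Car n
  left := fun ι => LinearMap.mk₂ K (fun v x => (A.left ι v x.1, B.left ι v x.2))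
    (by intros; simp) (by intros; simp) (by intros; simp) (by intros; simp)
  right := fun ι => LinearMap.mk₂ K (fun x v => (A.right ι x.1 v, B.right ι x.2 v))
    (by intros; simp) (by intros; simp) (by intros; simp) (by intros; simp)
  one_left := fun ι a => by simp [A.one_left, B.one_left]
  right_one := fun ι a => by simp [A.right_one, B.right_one]
  seq_left_left := fun h u v a => by simp [A.seq_left_left h, B.seq_left_left h]
  seq_left_right := fun h u a v => by simp [A.seq_left_right h, B.seq_left_right h]
  seq_right_right := fun h a u v => by simp [A.seq_right_right h, B.seq_right_right h]
  par_left_right := fun h u a v => by simp [A.par_left_right h, B.par_left_right h]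
  par_right_right := fun h a u v => by
    simp [A.par_right_right h, B.par_right_right h]

/-- First projection. -/
def prodFst (A B : Bimodule P) : Hom (A.prod B) A where
  map := fun _ => LinearMap.fst K _ _
  map_left := fun _ _ _ => rfl
  map_right := fun _ _ _ => rfl

/-- Second inclusion. -/
def prodInr (A B : Bimodule P) : Hom B (A.prod B) where
  map := fun _ => LinearMap.inr K _ _
  map_left := fun ι v _ => Prod.ext (map_zero (A.left ι v)).symm rfl
  map_right := fun ι _ v => Prod.ext (LinearMap.map_zero₂ (A.right ι) v).symm rfl

/-- The morphism out of a direct sum given by two morphisms. -/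
def prodLift {A B C : Bimodule P} (f : Hom A C) (g : Hom B C) : Hom (A.prod B) C where
  map := fun n => (f.map n).coprod (g.map n)
  map_left := fun {k l n} ι v a => by
    change f.map n (A.left ι v a.1) + g.map n (B.left ι v a.2) =
      C.left ι v (f.map l a.1 + g.map l a.2)
    rw [f.map_left, g.map_left, map_add]
  map_right := fun {k l n} ι a v => by
    change f.map n (A.right ι a.1 v) + g.map n (B.right ι a.2 v) =
      C.right ι (f.map k a.1 + g.map k a.2) v
    rw [f.map_right, g.map_right, LinearMap.map_add₂]

/-- The sub-bimodule of `A` generated by a family of elements. -/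
inductive Gen (A : Bimodule P) (R : ∀ n, A.Car n → Prop) : ∀ n, A.Car n → Prop
  | of {n : ℕ} {a : A.Car n} : R n a → Gen A R n a
  | zero (n : ℕ) : Gen A R n 0
  | add {n : ℕ} {a b : A.Car n} : Gen A R n a → Gen A R n b → Gen A R n (a + b)
  | smul {n : ℕ} (c : K) {a : A.Car n} : Gen A R n a → Gen A R n (c • a)
  | left {k l n : ℕ} (ι : Insertion k l n) (v : P.Op k) {a : A.Car l} :
      Gen A R l a → Gen A R n (A.left ι v a)
  | right {k l n : ℕ} (ι : Insertion k l n) {a : A.Car k} (v : P.Op l) :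
      Gen A R k a → Gen A R n (A.right ι a v)

/-- The sub-bimodule generated by `R`, as a family of subspaces. -/
def gen (A : Bimodule P) (R : ∀ n, A.Car n → Prop) (n : ℕ) : Submodule K (A.Car n) where
  carrier := {a | Gen A R n a}
  add_mem' := Gen.add
  zero_mem' := Gen.zero n
  smul_mem' := fun c _ h => Gen.smul c h

/-- The quotient of `A` by the sub-bimodule generated by `R`. -/
def quot (A : Bimodule P) (R : ∀ n, A.Car n → Prop) : Bimodule P where
  Car := fun n => A.Car n ⧸ A.gen R n
  left := fun {k l n} ι =>
    ((A.gen R l).liftQ ((A.left ι).compr₂ (A.gen R n).mkQ).flip (fun a ha => by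
      ext v
      simpa using (Submodule.Quotient.mk_eq_zero (A.gen R n)).2 (Gen.left ι v ha))).flip
  right := fun {k l n} ι =>
    (A.gen R k).liftQ ((A.right ι).compr₂ (A.gen R n).mkQ) (fun a ha => by
      ext v
      simpa using (Submodule.Quotient.mk_eq_zero (A.gen R n)).2 (Gen.right ι v ha))
  one_left := fun ι a => by
    induction a using Submodule.Quotient.induction_on with
    | H a => exact congrArg (Submodule.Quotient.mk) (A.one_left ι a)
  right_one := fun ι a => by
    induction a using Submodule.Quotient.induction_on with
    | H a => exact congrArg (Submodule.Quotient.mk) (A.right_one ι a)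
  seq_left_left := fun h u v a => by
    induction a using Submodule.Quotient.induction_on with
    | H a => exact congrArg (Submodule.Quotient.mk) (A.seq_left_left h u v a)
  seq_left_right := fun h u a v => by
    induction a using Submodule.Quotient.induction_on with
    | H a => exact congrArg (Submodule.Quotient.mk) (A.seq_left_right h u a v)
  seq_right_right := fun h a u v => by
    induction a using Submodule.Quotient.induction_on with
    | H a => exact congrArg (Submodule.Quotient.mk) (A.seq_right_right h a u v)
  par_left_right := fun h u a v => by
    induction a using Submodule.Quotient.induction_on with
    | H a => exact congrArg (Submodule.Quotient.mk) (A.par_left_right h u a v)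
  par_right_right := fun h a u v => by
    induction a using Submodule.Quotient.induction_on with
    | H a => exact congrArg (Submodule.Quotient.mk) (A.par_right_right h a u v)

/-- The canonical projection onto a quotient. -/
def quotMk (A : Bimodule P) (R : ∀ n, A.Car n → Prop) : Hom A (A.quot R) where
  map := fun n => (A.gen R n).mkQ
  map_left := fun _ _ _ => rfl
  map_right := fun _ _ _ => rfl

theorem gen_le_ker {A B : Bimodule P} {R : ∀ n, A.Car n → Prop} (f : Hom A B)
    (hf : ∀ n a, R n a → f.map n a = 0) (n : ℕ) : A.gen R n ≤ LinearMap.ker (f.map n) := by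
  intro a ha
  replace ha : Gen A R n a := ha
  rw [LinearMap.mem_ker]
  induction ha with
  | of h => exact hf _ _ h
  | zero => simp
  | add _ _ h1 h2 => simp [h1, h2]
  | smul c _ h => simp [h]
  | left ι v _ h => simp [f.map_left, h]
  | right ι v _ h => simp [f.map_right, h]

/-- The morphism out of a quotient induced by a morphism that kills the relations. -/
def quotLift {A B : Bimodule P} {R : ∀ n, A.Car n → Prop} (f : Hom A B)
    (hf : ∀ n a, R n a → f.map n a = 0) : Hom (A.quot R) B where
  map := fun n => (A.gen R n).liftQ (f.map n) (gen_le_ker f hf n)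
  map_left := fun ι v a => by
    induction a using Submodule.Quotient.induction_on with
    | H a => exact f.map_left ι v a
  map_right := fun ι a v => by
    induction a using Submodule.Quotient.induction_on with
    | H a => exact f.map_right ι a v

/-! ### Free bimodules -/

/-- Formal composites built from one generator in `X` by left and right actions of `P`. -/
inductive Mon (P : Operad K) (X : ℕ → Type u) : ℕ → Type u
  | gen {n : ℕ} (x : X n) : Mon P X n
  | left {k l n : ℕ} (ι : Insertion k l n) (v : P.Op k) (a : Mon P X l) : Mon P X n
  | right {k l n : ℕ} (ι : Insertion k l n) (a : Mon P X k) (v : P.Op l) : Mon P X n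

/-- The left action on formal linear combinations of composites. -/
noncomputable def preLeft {X : ℕ → Type u} {k l n : ℕ} (ι : Insertion k l n) (v : P.Op k) :
    (Mon P X l →₀ K) →ₗ[K] (Mon P X n →₀ K) := Finsupp.lmapDomain K K (Mon.left ι v)

/-- The right action on formal linear combinations of composites. -/
noncomputable def preRight {X : ℕ → Type u} {k l n : ℕ} (ι : Insertion k l n) (v : P.Op l) :
    (Mon P X k →₀ K) →ₗ[K] (Mon P X n →₀ K) := Finsupp.lmapDomain K K (fun a => Mon.right ι a v)

/-- The relations that hold in every bimodule: the smallest family of subspaces, stable under both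
actions, that makes the actions linear in `P` and forces the bimodule axioms. -/
inductive FreeRel (P : Operad K) (X : ℕ → Type u) : ∀ n, (Mon P X n →₀ K) → Prop
  | zero (n : ℕ) : FreeRel P X n 0
  | add {n : ℕ} {a b : Mon P X n →₀ K} :
      FreeRel P X n a → FreeRel P X n b → FreeRel P X n (a + b)
  | smul {n : ℕ} (c : K) {a : Mon P X n →₀ K} : FreeRel P X n a → FreeRel P X n (c • a)
  | left {k l n : ℕ} (ι : Insertion k l n) (v : P.Op k) {a : Mon P X l →₀ K} :
      FreeRel P X l a → FreeRel P X n (preLeft ι v a)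
  | right {k l n : ℕ} (ι : Insertion k l n) {a : Mon P X k →₀ K} (v : P.Op l) :
      FreeRel P X k a → FreeRel P X n (preRight ι v a)
  | left_add {k l n : ℕ} (ι : Insertion k l n) (v w : P.Op k) (a : Mon P X l →₀ K) :
      FreeRel P X n (preLeft ι (v + w) a - (preLeft ι v a + preLeft ι w a))
  | left_smul {k l n : ℕ} (ι : Insertion k l n) (c : K) (v : P.Op k) (a : Mon P X l →₀ K) :
      FreeRel P X n (preLeft ι (c • v) a - c • preLeft ι v a)
  | right_add {k l n : ℕ} (ι : Insertion k l n) (v w : P.Op l) (a : Mon P X k →₀ K) :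
      FreeRel P X n (preRight ι (v + w) a - (preRight ι v a + preRight ι w a))
  | right_smul {k l n : ℕ} (ι : Insertion k l n) (c : K) (v : P.Op l) (a : Mon P X k →₀ K) :
      FreeRel P X n (preRight ι (c • v) a - c • preRight ι v a)
  | one_left {n : ℕ} (ι : Insertion 0 n n) (a : Mon P X n →₀ K) :
      FreeRel P X n (preLeft ι P.one a - a)
  | right_one {n : ℕ} (ι : Insertion n 0 n) (a : Mon P X n →₀ K) :
      FreeRel P X n (preRight ι P.one a - a)
  | seq_left_left {k l p r n q : ℕ} {α : Insertion k l p} {β : Insertion p r n}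
      {γ : Insertion k q n} {δ : Insertion l r q} (h : IsSequential α β γ δ)
      (u : P.Op k) (v : P.Op l) (a : Mon P X r →₀ K) :
      FreeRel P X n (preLeft β (P.comp α u v) a - preLeft γ u (preLeft δ v a))
  | seq_left_right {k l p r n q : ℕ} {α : Insertion k l p} {β : Insertion p r n}
      {γ : Insertion k q n} {δ : Insertion l r q} (h : IsSequential α β γ δ)
      (u : P.Op k) (a : Mon P X l →₀ K) (v : P.Op r) :
      FreeRel P X n (preRight β v (preLeft α u a) - preLeft γ u (preRight δ v a))
  | seq_right_right {k l p r n q : ℕ} {α : Insertion k l p} {β : Insertion p r n}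
      {γ : Insertion k q n} {δ : Insertion l r q} (h : IsSequential α β γ δ)
      (a : Mon P X k →₀ K) (u : P.Op l) (v : P.Op r) :
      FreeRel P X n (preRight β v (preRight α u a) - preRight γ (P.comp δ u v) a)
  | par_left_right {k l p r n q : ℕ} {α : Insertion k l p} {β : Insertion p r n}
      {γ : Insertion k r q} {δ : Insertion q l n} (h : IsParallel α β γ δ)
      (u : P.Op k) (a : Mon P X l →₀ K) (v : P.Op r) :
      FreeRel P X n (preRight β v (preLeft α u a) - preLeft δ (P.comp γ u v) a)
  | par_right_right {k l p r n q : ℕ} {α : Insertion k l p} {β : Insertion p r n}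
      {γ : Insertion k r q} {δ : Insertion q l n} (h : IsParallel α β γ δ)
      (a : Mon P X k →₀ K) (u : P.Op l) (v : P.Op r) :
      FreeRel P X n (preRight β v (preRight α u a) - preRight δ u (preRight γ v a))

/-- `FreeRel` as a family of subspaces. -/
def freeKer (P : Operad K) (X : ℕ → Type u) (n : ℕ) : Submodule K (Mon P X n →₀ K) where
  carrier := {a | FreeRel P X n a}
  add_mem' := FreeRel.add
  zero_mem' := FreeRel.zero n
  smul_mem' := fun c _ h => FreeRel.smul c h

theorem freeKer_eq {X : ℕ → Type u} {n : ℕ} {a b : Mon P X n →₀ K}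
    (h : FreeRel P X n (a - b)) :
    (Submodule.Quotient.mk a : (Mon P X n →₀ K) ⧸ freeKer P X n) = Submodule.Quotient.mk b :=
  (Submodule.Quotient.eq _).2 h

/-- The free `P`-bimodule on the indexed set `X`. -/
noncomputable def free (P : Operad K) (X : ℕ → Type u) : Bimodule P where
  Car := fun n => (Mon P X n →₀ K) ⧸ freeKer P X n
  left := fun {k l n} ι => LinearMap.mk₂ K
    (fun v => (freeKer P X l).mapQ (freeKer P X n) (preLeft ι v)
      (fun _ h => FreeRel.left ι v h))
    (fun v w a => by
      induction a using Submodule.Quotient.induction_on with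
      | H a => exact freeKer_eq (.left_add ι v w a))
    (fun c v a => by
      induction a using Submodule.Quotient.induction_on with
      | H a => exact freeKer_eq (.left_smul ι c v a))
    (fun v a b => map_add _ a b) (fun c v a => map_smul _ c a)
  right := fun {k l n} ι => LinearMap.mk₂ K
    (fun a v => (freeKer P X k).mapQ (freeKer P X n) (preRight ι v)
      (fun _ h => FreeRel.right ι v h) a)
    (fun a b v => map_add _ a b) (fun c a v => map_smul _ c a)
    (fun a v w => by
      induction a using Submodule.Quotient.induction_on with
      | H a => exact freeKer_eq (.right_add ι v w a))
    (fun c a v => by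
      induction a using Submodule.Quotient.induction_on with
      | H a => exact freeKer_eq (.right_smul ι c v a))
  one_left := fun ι a => by
    induction a using Submodule.Quotient.induction_on with
    | H a => exact freeKer_eq (.one_left ι a)
  right_one := fun ι a => by
    induction a using Submodule.Quotient.induction_on with
    | H a => exact freeKer_eq (.right_one ι a)
  seq_left_left := fun h u v a => by
    induction a using Submodule.Quotient.induction_on with
    | H a => exact freeKer_eq (.seq_left_left h u v a)
  seq_left_right := fun h u a v => by
    induction a using Submodule.Quotient.induction_on with
    | H a => exact freeKer_eq (.seq_left_right h u a v)
  seq_right_right := fun h a u v => by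
    induction a using Submodule.Quotient.induction_on with
    | H a => exact freeKer_eq (.seq_right_right h a u v)
  par_left_right := fun h u a v => by
    induction a using Submodule.Quotient.induction_on with
    | H a => exact freeKer_eq (.par_left_right h u a v)
  par_right_right := fun h a u v => by
    induction a using Submodule.Quotient.induction_on with
    | H a => exact freeKer_eq (.par_right_right h a u v)

/-- The generator `[x]` of a free bimodule. -/
noncomputable def free.of (P : Operad K) {X : ℕ → Type u} {n : ℕ} (x : X n) :
    (free P X).Car n := Submodule.Quotient.mk (Finsupp.single (Mon.gen x) 1)

/-- Evaluation of a composite in a bimodule. -/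
def Mon.eval {X : ℕ → Type u} (A : Bimodule P) (φ : ∀ n, X n → A.Car n) :
    ∀ {n : ℕ}, Mon P X n → A.Car n
  | _, .gen x => φ _ x
  | _, .left ι v a => A.left ι v (a.eval A φ)
  | _, .right ι a v => A.right ι (a.eval A φ) v

/-- Linear extension of `Mon.eval`. -/
noncomputable def evalLin {X : ℕ → Type u} (A : Bimodule P) (φ : ∀ n, X n → A.Car n) (n : ℕ) :
    (Mon P X n →₀ K) →ₗ[K] A.Car n := Finsupp.linearCombination K (Mon.eval A φ)

theorem evalLin_left {X : ℕ → Type u} (A : Bimodule P) (φ : ∀ n, X n → A.Car n) {k l n : ℕ}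
    (ι : Insertion k l n) (v : P.Op k) (a : Mon P X l →₀ K) :
    evalLin A φ n (preLeft ι v a) = A.left ι v (evalLin A φ l a) := by
  induction a using Finsupp.induction_linear with
  | zero => simp
  | add a b ha hb => simp [ha, hb]
  | single m c => simp [preLeft, evalLin, Mon.eval, Finsupp.mapDomain_single]

theorem evalLin_right {X : ℕ → Type u} (A : Bimodule P) (φ : ∀ n, X n → A.Car n) {k l n : ℕ}
    (ι : Insertion k l n) (v : P.Op l) (a : Mon P X k →₀ K) :
    evalLin A φ n (preRight ι v a) = A.right ι (evalLin A φ k a) v := by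
  induction a using Finsupp.induction_linear with
  | zero => simp
  | add a b ha hb => simp [ha, hb]
  | single m c => simp [preRight, evalLin, Mon.eval, Finsupp.mapDomain_single]

theorem freeKer_le {X : ℕ → Type u} (A : Bimodule P) (φ : ∀ n, X n → A.Car n) (n : ℕ) :
    freeKer P X n ≤ LinearMap.ker (evalLin A φ n) := by
  intro a ha
  replace ha : FreeRel P X n a := ha
  rw [LinearMap.mem_ker]
  induction ha with
  | zero => simp
  | add _ _ h1 h2 => simp [h1, h2]
  | smul c _ h => simp [h]
  | left ι v _ h => simp [evalLin_left, h]
  | right ι v _ h => simp [evalLin_right, h]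
  | left_add => simp [evalLin_left]
  | left_smul => simp [evalLin_left]
  | right_add => simp [evalLin_right]
  | right_smul => simp [evalLin_right]
  | one_left => simp [evalLin_left, A.one_left]
  | right_one => simp [evalLin_right, A.right_one]
  | seq_left_left h => simp [evalLin_left, A.seq_left_left h]
  | seq_left_right h => simp [evalLin_left, evalLin_right, A.seq_left_right h]
  | seq_right_right h => simp [evalLin_right, A.seq_right_right h]
  | par_left_right h => simp [evalLin_left, evalLin_right, A.par_left_right h]
  | par_right_right h => rw [map_sub]; simp only [evalLin_right, A.par_right_right h, sub_self]

/-- The morphism out of a free bimodule given by the images of the generators. -/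
noncomputable def freeLift {X : ℕ → Type u} (A : Bimodule P) (φ : ∀ n, X n → A.Car n) :
    Hom (free P X) A where
  map := fun n => (freeKer P X n).liftQ (evalLin A φ n) (freeKer_le A φ n)
  map_left := fun ι v a => by
    induction a using Submodule.Quotient.induction_on with
    | H a => exact evalLin_left A φ ι v a
  map_right := fun ι a v => by
    induction a using Submodule.Quotient.induction_on with
    | H a => exact evalLin_right A φ ι v a

theorem freeLift_of {X : ℕ → Type u} (A : Bimodule P) (φ : ∀ n, X n → A.Car n) {n : ℕ} (x : X n) :
    (freeLift A φ).map n (free.of P x) = φ n x := by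
  change evalLin A φ n (Finsupp.single (Mon.gen x) 1) = φ n x
  simp [evalLin, Mon.eval]

theorem free_hom_ext {X : ℕ → Type u} {A : Bimodule P} {f g : Hom (free P X) A}
    (h : ∀ n (x : X n), f.map n (free.of P x) = g.map n (free.of P x)) : f = g := by
  have key : ∀ n (m : Mon P X n), f.map n (Submodule.Quotient.mk (Finsupp.single m 1)) =
      g.map n (Submodule.Quotient.mk (Finsupp.single m 1)) := by
    intro n m
    induction m with
    | gen x => exact h _ x
    | @left k l n ι v a ih =>
      have e : (Submodule.Quotient.mk (Finsupp.single (Mon.left ι v a) 1) : (free P X).Car n) =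
          (free P X).left ι v (Submodule.Quotient.mk (Finsupp.single a 1)) := by
        change _ = Submodule.Quotient.mk (preLeft ι v (Finsupp.single a 1))
        simp [preLeft, Finsupp.mapDomain_single]
      have ih' := congrArg (A.left ι v) ih
      exact (congrArg (f.map n) e).trans ((f.map_left ι v _).trans (ih'.trans
        ((g.map_left ι v _).symm.trans (congrArg (g.map n) e.symm))))
    | @right k l n ι a v ih =>
      have e : (Submodule.Quotient.mk (Finsupp.single (Mon.right ι a v) 1) : (free P X).Car n) =
          (free P X).right ι (Submodule.Quotient.mk (Finsupp.single a 1)) v := by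
        change _ = Submodule.Quotient.mk (preRight ι v (Finsupp.single a 1))
        simp [preRight, Finsupp.mapDomain_single]
      have ih' := congrArg (fun z => A.right ι z v) ih
      exact (congrArg (f.map n) e).trans ((f.map_right ι _ v).trans (ih'.trans
        ((g.map_right ι _ v).symm.trans (congrArg (g.map n) e.symm))))
  ext n a
  induction a using Submodule.Quotient.induction_on with
  | H a =>
    have := LinearMap.congr_fun (Finsupp.lhom_ext' (φ := (f.map n).comp (freeKer P X n).mkQ)
      (ψ := (g.map n).comp (freeKer P X n).mkQ) (fun m => by
        ext; exact key n m)) a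
    exact this

/-- `A` is free on the family of elements `φ`. -/
def IsFreeOn (A : Bimodule P) {X : ℕ → Type u} (φ : ∀ n, X n → A.Car n) : Prop :=
  ∀ (B : Bimodule P) (ψ : ∀ n, X n → B.Car n),
    ∃! f : Hom A B, ∀ n (x : X n), f.map n (φ n x) = ψ n x

end

end Bimodule

/-! ### Free shuffle operads -/

section

variable {K : Type u} [Field K]

/-- Formal composites of elements of the indexed set `X`. -/
inductive Word (X : ℕ → Type u) : ℕ → Type u
  | gen {n : ℕ} (x : X n) : Word X n
  | one : Word X 0
  | comp {k l n : ℕ} (ι : Insertion k l n) (a : Word X k) (b : Word X l) : Word X n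

/-- The congruence on formal composites generated by the unit and associativity laws. -/
inductive Word.Rel (X : ℕ → Type u) : ∀ {n : ℕ}, Word X n → Word X n → Prop
  | refl {n : ℕ} (a : Word X n) : Rel X a a
  | symm {n : ℕ} {a b : Word X n} : Rel X a b → Rel X b a
  | trans {n : ℕ} {a b c : Word X n} : Rel X a b → Rel X b c → Rel X a c
  | comp {k l n : ℕ} (ι : Insertion k l n) {a a' : Word X k} {b b' : Word X l} :
      Rel X a a' → Rel X b b' → Rel X (.comp ι a b) (.comp ι a' b')
  | one_comp {n : ℕ} (ι : Insertion 0 n n) (a : Word X n) : Rel X (.comp ι .one a) a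
  | comp_one {n : ℕ} (ι : Insertion n 0 n) (a : Word X n) : Rel X (.comp ι a .one) a
  | comp_seq {k l p r n q : ℕ} {α : Insertion k l p} {β : Insertion p r n}
      {γ : Insertion k q n} {δ : Insertion l r q} (h : IsSequential α β γ δ)
      (a : Word X k) (b : Word X l) (c : Word X r) :
      Rel X (.comp β (.comp α a b) c) (.comp γ a (.comp δ b c))
  | comp_par {k l p r n q : ℕ} {α : Insertion k l p} {β : Insertion p r n}
      {γ : Insertion k r q} {δ : Insertion q l n} (h : IsParallel α β γ δ)
      (a : Word X k) (b : Word X l) (c : Word X r) :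
      Rel X (.comp β (.comp α a b) c) (.comp δ (.comp γ a c) b)

/-- Tree monomials on `X`: the free monoid on `X` for the shuffle composition of indexed sets. -/
def Tree (X : ℕ → Type u) (n : ℕ) : Type u := Quot (Word.Rel X (n := n))

/-- The tree monomial of a formal composite. -/
def Tree.mk {X : ℕ → Type u} {n : ℕ} (w : Word X n) : Tree X n := Quot.mk _ w

/-- Elementary composition of tree monomials. -/
def Tree.comp {X : ℕ → Type u} {k l n : ℕ} (ι : Insertion k l n) :
    Tree X k → Tree X l → Tree X n :=
  Quot.map₂ (Word.comp ι) (fun a _ _ h => .comp ι (.refl a) h)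
    (fun _ _ b h => .comp ι h (.refl b))

theorem Tree.one_comp {X : ℕ → Type u} {n : ℕ} (ι : Insertion 0 n n) (a : Tree X n) :
    Tree.comp ι (Tree.mk .one) a = a := by
  induction a using Quot.ind with
  | mk a => exact Quot.sound (.one_comp ι a)

theorem Tree.comp_one {X : ℕ → Type u} {n : ℕ} (ι : Insertion n 0 n) (a : Tree X n) :
    Tree.comp ι a (Tree.mk .one) = a := by
  induction a using Quot.ind with
  | mk a => exact Quot.sound (.comp_one ι a)

theorem Tree.comp_seq {X : ℕ → Type u} {k l p r n q : ℕ} {α : Insertion k l p}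
    {β : Insertion p r n} {γ : Insertion k q n} {δ : Insertion l r q}
    (h : IsSequential α β γ δ) (a : Tree X k) (b : Tree X l) (c : Tree X r) :
    Tree.comp β (Tree.comp α a b) c = Tree.comp γ a (Tree.comp δ b c) := by
  induction a using Quot.ind with
  | mk a =>
  induction b using Quot.ind with
  | mk b =>
  induction c using Quot.ind with
  | mk c => exact Quot.sound (.comp_seq h a b c)

theorem Tree.comp_par {X : ℕ → Type u} {k l p r n q : ℕ} {α : Insertion k l p}
    {β : Insertion p r n} {γ : Insertion k r q} {δ : Insertion q l n}
    (h : IsParallel α β γ δ) (a : Tree X k) (b : Tree X l) (c : Tree X r) :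
    Tree.comp β (Tree.comp α a b) c = Tree.comp δ (Tree.comp γ a c) b := by
  induction a using Quot.ind with
  | mk a =>
  induction b using Quot.ind with
  | mk b =>
  induction c using Quot.ind with
  | mk c => exact Quot.sound (.comp_par h a b c)

/-- Bilinear extension of the elementary composition of tree monomials. -/
noncomputable def treeComp (K : Type u) [Field K] {X : ℕ → Type u} {k l n : ℕ}
    (ι : Insertion k l n) : (Tree X k →₀ K) →ₗ[K] (Tree X l →₀ K) →ₗ[K] (Tree X n →₀ K) :=
  Finsupp.linearCombination K (fun a => Finsupp.lmapDomain K K (Tree.comp ι a))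

theorem treeComp_single {X : ℕ → Type u} {k l n : ℕ} (ι : Insertion k l n) (a : Tree X k)
    (b : Tree X l) (c d : K) :
    treeComp K ι (Finsupp.single a c) (Finsupp.single b d) =
      Finsupp.single (Tree.comp ι a b) (c * d) := by
  simp [treeComp, Finsupp.mapDomain_single]

/-- The free shuffle operad on the indexed set `X`, with basis the tree monomials on `X`. -/
noncomputable def freeOperad (K : Type u) [Field K] (X : ℕ → Type u) : Operad K where
  Op := fun n => Tree X n →₀ K
  one := Finsupp.single (Tree.mk .one) 1
  comp := treeComp K
  one_comp := fun ι a => by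
    induction a using Finsupp.induction_linear with
    | zero => simp
    | add a b ha hb => rw [map_add, ha, hb]
    | single m c => rw [treeComp_single, one_mul, Tree.one_comp]
  comp_one := fun ι a => by
    induction a using Finsupp.induction_linear with
    | zero => simp
    | add a b ha hb => rw [map_add, LinearMap.add_apply, ha, hb]
    | single m c => rw [treeComp_single, mul_one, Tree.comp_one]
  comp_seq := fun h a b c => by
    induction a using Finsupp.induction_linear with
    | zero => simp
    | add a a' ha ha' => simp only [map_add, LinearMap.add_apply, ha, ha']
    | single a x =>
    induction b using Finsupp.induction_linear with
    | zero => simp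
    | add a a' ha ha' => simp only [map_add, LinearMap.add_apply, ha, ha']
    | single b y =>
    induction c using Finsupp.induction_linear with
    | zero => simp
    | add a a' ha ha' => simp only [map_add, ha, ha']
    | single c z => simp only [treeComp_single, mul_assoc, Tree.comp_seq h]
  comp_par := fun h a b c => by
    induction a using Finsupp.induction_linear with
    | zero => simp
    | add a a' ha ha' => simp only [map_add, LinearMap.add_apply, ha, ha']
    | single a x =>
    induction b using Finsupp.induction_linear with
    | zero => simp
    | add a a' ha ha' => simp only [map_add, LinearMap.add_apply, ha, ha']
    | single b y =>
    induction c using Finsupp.induction_linear with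
    | zero => simp
    | add a a' ha ha' => simp only [map_add, LinearMap.add_apply, ha, ha']
    | single c z => simp only [treeComp_single, mul_right_comm x y z, Tree.comp_par h]

/-- The element of the free operad given by a formal composite. -/
noncomputable def mono (K : Type u) [Field K] {X : ℕ → Type u} {n : ℕ} (w : Word X n) :
    (freeOperad K X).Op n := Finsupp.single (Tree.mk w) 1

/-- A generator, seen in the free operad. -/
noncomputable def freeOperad.of (K : Type u) [Field K] {X : ℕ → Type u} {n : ℕ} (x : X n) :
    (freeOperad K X).Op n := mono K (.gen x)

theorem mono_comp {X : ℕ → Type u} {k l n : ℕ} (ι : Insertion k l n) (a : Word X k)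
    (b : Word X l) : mono K (.comp ι a b) = (freeOperad K X).comp ι (mono K a) (mono K b) := by
  change _ = treeComp K ι (Finsupp.single (Tree.mk a) 1) (Finsupp.single (Tree.mk b) 1)
  rw [treeComp_single, one_mul]
  rfl

theorem mono_eq {X : ℕ → Type u} {n : ℕ} {a b : Word X n} (h : Word.Rel X a b) :
    mono K a = mono K b :=
  congrArg (fun t : Tree X n => Finsupp.single t (1 : K)) (Quot.sound h)

/-! ### Quotients of shuffle operads -/

/-- The quotient of an operad by the ideal (sub-bimodule) generated by `R`. -/
def Operad.quot (P : Operad K) (R : ∀ n, P.Op n → Prop) : Operad K where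
  Op := fun n => P.Op n ⧸ (Bimodule.self P).gen R n
  one := Submodule.Quotient.mk P.one
  comp := fun {k l n} ι =>
    ((Bimodule.self P).gen R k).liftQ
      ((((Bimodule.self P).gen R l).liftQ
        ((P.comp ι).compr₂ ((Bimodule.self P).gen R n).mkQ).flip (fun a ha => by
          ext v
          exact (Submodule.Quotient.mk_eq_zero _).2 (Bimodule.Gen.left ι v ha))).flip)
      (fun a ha => by
        ext v
        exact (Submodule.Quotient.mk_eq_zero _).2 (Bimodule.Gen.right ι v ha))
  one_comp := fun ι a => by
    induction a using Submodule.Quotient.induction_on with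
    | H a => exact congrArg (Submodule.Quotient.mk) (P.one_comp ι a)
  comp_one := fun ι a => by
    induction a using Submodule.Quotient.induction_on with
    | H a => exact congrArg (Submodule.Quotient.mk) (P.comp_one ι a)
  comp_seq := fun h a b c => by
    induction a using Submodule.Quotient.induction_on with
    | H a =>
    induction b using Submodule.Quotient.induction_on with
    | H b =>
    induction c using Submodule.Quotient.induction_on with
    | H c => exact congrArg (Submodule.Quotient.mk) (P.comp_seq h a b c)
  comp_par := fun h a b c => by
    induction a using Submodule.Quotient.induction_on with
    | H a =>
    induction b using Submodule.Quotient.induction_on with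
    | H b =>
    induction c using Submodule.Quotient.induction_on with
    | H c => exact congrArg (Submodule.Quotient.mk) (P.comp_par h a b c)

/-- The canonical projection onto a quotient operad. -/
def Operad.quotMk (P : Operad K) (R : ∀ n, P.Op n → Prop) : P.Hom (P.quot R) where
  map := fun n => ((Bimodule.self P).gen R n).mkQ
  map_one := rfl
  map_comp := fun _ _ _ => rfl

/-- The derivation of the free operad with values in a bimodule over an operad `P` under it,
`d(u ∘ v) = d(u) ∘ π(v) + π(u) ∘ d(v)`, given by its values on generators; on composites. -/
noncomputable def Word.der {X : ℕ → Type u} {P : Operad K} (π : (freeOperad K X).Hom P)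
    (A : Bimodule P) (φ : ∀ n, X n → A.Car n) : ∀ {n : ℕ}, Word X n → A.Car n
  | _, .gen x => φ _ x
  | _, .one => 0
  | _, .comp ι a b =>
      A.right ι (a.der π A φ) (π.map _ (mono K b)) +
        A.left ι (π.map _ (mono K a)) (b.der π A φ)

theorem Word.der_rel {X : ℕ → Type u} {P : Operad K} (π : (freeOperad K X).Hom P)
    (A : Bimodule P) (φ : ∀ n, X n → A.Car n) {n : ℕ} {a b : Word X n} (h : Word.Rel X a b) :
    a.der π A φ = b.der π A φ := by
  induction h with
  | refl => rfl
  | symm _ h => exact h.symm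
  | trans _ _ h h' => exact h.trans h'
  | comp ι ha hb iha ihb => simp only [Word.der, iha, ihb, mono_eq ha, mono_eq hb]
  | one_comp ι a =>
    have e : π.map 0 (mono K .one) = P.one := π.map_one
    simp [Word.der, e, A.one_left]
  | comp_one ι a =>
    have e : π.map 0 (mono K .one) = P.one := π.map_one
    simp [Word.der, e, A.right_one]
  | comp_seq h a b c =>
    simp only [Word.der, mono_comp, π.map_comp, map_add, LinearMap.add_apply, A.seq_left_left h,
      A.seq_left_right h, A.seq_right_right h, add_assoc]
  | comp_par h a b c =>
    have h' : IsParallel _ _ _ _ := ⟨fun x => (h.left x).symm, fun x => (h.right x).symm,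
      fun x => (h.middle x).symm, h.ne.symm⟩
    simp only [Word.der, mono_comp, π.map_comp, map_add, LinearMap.add_apply, A.par_right_right h,
      A.par_left_right h, A.par_left_right h']
    abel

/-- The derivation of the free operad given by its values on generators. -/
noncomputable def der {X : ℕ → Type u} {P : Operad K} (π : (freeOperad K X).Hom P)
    (A : Bimodule P) (φ : ∀ n, X n → A.Car n) (n : ℕ) : (freeOperad K X).Op n →ₗ[K] A.Car n :=
  Finsupp.linearCombination K
    (Quot.lift (fun w : Word X n => w.der π A φ) (fun _ _ h => Word.der_rel π A φ h))

end

/-! ### Higher-dimensional cells and cellular extensions -/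

section

variable {K : Type u} [Field K] {F : Operad K}

/-- `μ↑(a, b) = a ∘ s₀(b) + t₀(a) ∘ b - i(t₀(a) ∘ s₀(b))`. -/
def up {A : Bimodule F} (s t : A.Hom (.self F)) (i : (Bimodule.self F).Hom A) {k l n : ℕ}
    (ι : Insertion k l n) (a : A.Car k) (b : A.Car l) : A.Car n :=
  A.right ι a (s.map l b) + A.left ι (t.map k a) b - i.map n (F.comp ι (t.map k a) (s.map l b))

/-- `μ↓(a, b) = s₀(a) ∘ b + a ∘ t₀(b) - i(s₀(a) ∘ t₀(b))`. -/
def down {A : Bimodule F} (s t : A.Hom (.self F)) (i : (Bimodule.self F).Hom A) {k l n : ℕ}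
    (ι : Insertion k l n) (a : A.Car k) (b : A.Car l) : A.Car n :=
  A.left ι (s.map k a) b + A.right ι a (t.map l b) - i.map n (F.comp ι (s.map k a) (t.map l b))

/-- The `n`-cells `C` of a shuffle `m`-operad (`m ≥ n`) with shuffle operad of `0`-cells `F`, as a
bimodule over `F`, together with their sources and targets `src`, `tgt` in dimension `n - 1`, their
`0`-dimensional sources and targets `src₀`, `tgt₀`, and the iterated identities `idn` of `0`-cells.
For `n = 0`, the cells are the `0`-cells themselves, and `Bd`, `src`, `tgt` carry no information. -/
structure Cells (F : Operad K) (n : ℕ) where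
  C : Bimodule F
  Bd : Bimodule F
  src : C.Hom Bd
  tgt : C.Hom Bd
  src₀ : C.Hom (.self F)
  tgt₀ : C.Hom (.self F)
  idn : (Bimodule.self F).Hom C
  src₀_idn : ∀ m u, src₀.map m (idn.map m u) = u
  tgt₀_idn : ∀ m u, tgt₀.map m (idn.map m u) = u
  idn_src₀ : n = 0 → ∀ m a, idn.map m (src₀.map m a) = a
  glob : n ≠ 0 → ∀ m a b, src.map m a = src.map m b → tgt.map m a = tgt.map m b →
    src₀.map m a = src₀.map m b ∧ tgt₀.map m a = tgt₀.map m b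
  exchange : ∀ {k l m : ℕ} (ι : Insertion k l m) (a : C.Car k) (b : C.Car l),
    up src₀ tgt₀ idn ι a b = down src₀ tgt₀ idn ι a b

/-- Two `n`-cells are parallel if they have the same source and the same target; any two `0`-cells
are parallel. -/
def Cells.Parallel {n : ℕ} (S : Cells F n) {m : ℕ} (a b : S.C.Car m) : Prop :=
  n ≠ 0 → S.src.map m a = S.src.map m b ∧ S.tgt.map m a = S.tgt.map m b

/-- The `0`-cells. -/
def Cells.zero (F : Operad K) : Cells F 0 where
  C := .self F
  Bd := .self F
  src := .id _
  tgt := .id _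
  src₀ := .id _
  tgt₀ := .id _
  idn := .id _
  src₀_idn := fun _ _ => rfl
  tgt₀_idn := fun _ _ => rfl
  idn_src₀ := fun _ _ _ => rfl
  glob := fun h => absurd rfl h
  exchange := fun {k l m} ι a b => by
    change F.comp ι a b + F.comp ι a b - F.comp ι a b = F.comp ι a b + F.comp ι a b - F.comp ι a b
    rfl

/-- A cellular extension: an indexed set `X` of `(n + 1)`-generators, each with a source and a
target that are parallel `n`-cells. -/
structure CellExt {n : ℕ} (S : Cells F n) where
  X : ℕ → Type u
  src : ∀ m, X m → S.C.Car m
  tgt : ∀ m, X m → S.C.Car m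
  par : ∀ m (x : X m), S.Parallel (src m x) (tgt m x)

namespace CellExt

variable {n : ℕ} {S : Cells F n} (E : CellExt S)

/-- `F⟨X⟩ ⊕ C`. -/
noncomputable def pre : Bimodule F := (Bimodule.free F E.X).prod S.C

/-- The source map `F⟨X⟩ ⊕ C → C`. -/
noncomputable def preSrc : E.pre.Hom S.C :=
  Bimodule.prodLift (Bimodule.freeLift S.C E.src) (.id _)

/-- The target map `F⟨X⟩ ⊕ C → C`. -/
noncomputable def preTgt : E.pre.Hom S.C :=
  Bimodule.prodLift (Bimodule.freeLift S.C E.tgt) (.id _)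

/-- The `0`-dimensional source map `F⟨X⟩ ⊕ C → F`. -/
noncomputable def preSrc₀ : E.pre.Hom (.self F) := S.src₀.comp E.preSrc

/-- The `0`-dimensional target map `F⟨X⟩ ⊕ C → F`. -/
noncomputable def preTgt₀ : E.pre.Hom (.self F) := S.tgt₀.comp E.preTgt

/-- The iterated identity `F → C → F⟨X⟩ ⊕ C`. -/
noncomputable def preIdn : (Bimodule.self F).Hom E.pre := (Bimodule.prodInr _ _).comp S.idn

/-- The elements `μ↑(a, b) - μ↓(a, b)`. -/
def Exchange (m : ℕ) (z : E.pre.Car m) : Prop :=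
  ∃ (k l : ℕ) (ι : Insertion k l m) (a : E.pre.Car k) (b : E.pre.Car l),
    z = up E.preSrc₀ E.preTgt₀ E.preIdn ι a b - down E.preSrc₀ E.preTgt₀ E.preIdn ι a b

/-- The `(n + 1)`-cells of the free `(n + 1)`-operad on the cellular extension: the coequalizer of
`μ↑` and `μ↓` on `F⟨X⟩ ⊕ C`, in bimodules. -/
noncomputable def cells : Bimodule F := E.pre.quot E.Exchange

theorem parallel_pre (m : ℕ) (a : E.pre.Car m) :
    S.Parallel (E.preSrc.map m a) (E.preTgt.map m a) := by
  intro hn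
  have h1 : S.src.comp (Bimodule.freeLift S.C E.src) = S.src.comp (Bimodule.freeLift S.C E.tgt) :=
    Bimodule.free_hom_ext (fun m x => by
      change S.src.map m ((Bimodule.freeLift S.C E.src).map m _) =
        S.src.map m ((Bimodule.freeLift S.C E.tgt).map m _)
      rw [Bimodule.freeLift_of, Bimodule.freeLift_of]
      exact (E.par m x hn).1)
  have h2 : S.tgt.comp (Bimodule.freeLift S.C E.src) = S.tgt.comp (Bimodule.freeLift S.C E.tgt) :=
    Bimodule.free_hom_ext (fun m x => by
      change S.tgt.map m ((Bimodule.freeLift S.C E.src).map m _) =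
        S.tgt.map m ((Bimodule.freeLift S.C E.tgt).map m _)
      rw [Bimodule.freeLift_of, Bimodule.freeLift_of]
      exact (E.par m x hn).2)
  have h1' := LinearMap.congr_fun (congrArg (fun f => Bimodule.Hom.map f m) h1) a.1
  have h2' := LinearMap.congr_fun (congrArg (fun f => Bimodule.Hom.map f m) h2) a.1
  constructor
  · change S.src.map m (_ + a.2) = S.src.map m (_ + a.2)
    rw [map_add, map_add]
    exact congrArg (· + _) h1'
  · change S.tgt.map m (_ + a.2) = S.tgt.map m (_ + a.2)
    rw [map_add, map_add]
    exact congrArg (· + _) h2'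

theorem preSrc_inr (m : ℕ) (c : S.C.Car m) :
    E.preSrc.map m ((Bimodule.prodInr _ _).map m c) = c := by
  change (Bimodule.freeLift S.C E.src).map m 0 + c = c
  rw [map_zero, zero_add]

theorem preTgt_inr (m : ℕ) (c : S.C.Car m) :
    E.preTgt.map m ((Bimodule.prodInr _ _).map m c) = c := by
  change (Bimodule.freeLift S.C E.tgt).map m 0 + c = c
  rw [map_zero, zero_add]

theorem map_up (f : E.pre.Hom S.C)
    (hf : ∀ m c, f.map m ((Bimodule.prodInr _ _).map m c) = c) {k l m : ℕ} (ι : Insertion k l m)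
    (a : E.pre.Car k) (b : E.pre.Car l) :
    f.map m (up E.preSrc₀ E.preTgt₀ E.preIdn ι a b) =
      S.C.right ι (f.map k a) (S.src₀.map l (E.preSrc.map l b)) +
        S.C.left ι (S.tgt₀.map k (E.preTgt.map k a)) (f.map l b) -
        S.idn.map m (F.comp ι (S.tgt₀.map k (E.preTgt.map k a))
          (S.src₀.map l (E.preSrc.map l b))) := by
  unfold up
  rw [map_sub, map_add, f.map_left, f.map_right]
  exact congrArg (_ - ·) (hf m _)

theorem map_down (f : E.pre.Hom S.C)
    (hf : ∀ m c, f.map m ((Bimodule.prodInr _ _).map m c) = c) {k l m : ℕ} (ι : Insertion k l m)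
    (a : E.pre.Car k) (b : E.pre.Car l) :
    f.map m (down E.preSrc₀ E.preTgt₀ E.preIdn ι a b) =
      S.C.left ι (S.src₀.map k (E.preSrc.map k a)) (f.map l b) +
        S.C.right ι (f.map k a) (S.tgt₀.map l (E.preTgt.map l b)) -
        S.idn.map m (F.comp ι (S.src₀.map k (E.preSrc.map k a))
          (S.tgt₀.map l (E.preTgt.map l b))) := by
  unfold down
  rw [map_sub, map_add, f.map_left, f.map_right]
  exact congrArg (_ - ·) (hf m _)

theorem up_down_idn {k l m : ℕ} (ι : Insertion k l m) (u u' : F.Op k) (v v' : F.Op l) :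
    S.C.right ι (S.idn.map k u) v + S.C.left ι u' (S.idn.map l v) - S.idn.map m (F.comp ι u' v) =
      S.C.left ι u (S.idn.map l v) + S.C.right ι (S.idn.map k u) v' -
        S.idn.map m (F.comp ι u v') := by
  have h1 := S.idn.map_right ι u v
  have h2 := S.idn.map_left ι u' v
  have h3 := S.idn.map_left ι u v
  have h4 := S.idn.map_right ι u v'
  rw [← h1, ← h2, ← h3, ← h4]
  exact (add_sub_cancel_right _ _).trans (add_sub_cancel_right _ _).symm

theorem up_down_idn' {k l m : ℕ} (ι : Insertion k l m) (u u' : F.Op k) (v v' : F.Op l) :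
    S.C.right ι (S.idn.map k u') v + S.C.left ι u' (S.idn.map l v') -
        S.idn.map m (F.comp ι u' v) =
      S.C.left ι u (S.idn.map l v') + S.C.right ι (S.idn.map k u') v' -
        S.idn.map m (F.comp ι u v') := by
  have h1 := S.idn.map_right ι u' v
  have h2 := S.idn.map_left ι u' v'
  have h3 := S.idn.map_left ι u v'
  have h4 := S.idn.map_right ι u' v'
  rw [← h1, ← h2, ← h3, ← h4]
  exact (add_sub_cancel_left _ _).trans (add_sub_cancel_left _ _).symm

theorem preSrc_exchange (m : ℕ) (z : E.pre.Car m) (hz : E.Exchange m z) :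
    E.preSrc.map m z = 0 := by
  obtain ⟨k, l, ι, a, b, rfl⟩ := hz
  rw [map_sub, E.map_up _ E.preSrc_inr, E.map_down _ E.preSrc_inr, sub_eq_zero]
  by_cases hn : n = 0
  · have ha := S.idn_src₀ hn k (E.preSrc.map k a)
    have hb := S.idn_src₀ hn l (E.preSrc.map l b)
    have h := up_down_idn (S := S) ι (S.src₀.map k (E.preSrc.map k a))
      (S.tgt₀.map k (E.preTgt.map k a)) (S.src₀.map l (E.preSrc.map l b))
      (S.tgt₀.map l (E.preTgt.map l b))
    rw [ha, hb] at h
    exact h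
  · have ha := E.parallel_pre k a hn
    have hb := E.parallel_pre l b hn
    rw [← (S.glob hn k _ _ ha.1 ha.2).2, ← (S.glob hn l _ _ hb.1 hb.2).2]
    exact S.exchange ι _ _

theorem preTgt_exchange (m : ℕ) (z : E.pre.Car m) (hz : E.Exchange m z) :
    E.preTgt.map m z = 0 := by
  obtain ⟨k, l, ι, a, b, rfl⟩ := hz
  rw [map_sub, E.map_up _ E.preTgt_inr, E.map_down _ E.preTgt_inr, sub_eq_zero]
  by_cases hn : n = 0
  · have key : ∀ j (c : S.C.Car j), S.idn.map j (S.tgt₀.map j c) = c := fun j c => by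
      have h := S.idn_src₀ hn j c
      rw [← h, S.tgt₀_idn]
    have ha := key k (E.preTgt.map k a)
    have hb := key l (E.preTgt.map l b)
    have h := up_down_idn' (S := S) ι (S.src₀.map k (E.preSrc.map k a))
      (S.tgt₀.map k (E.preTgt.map k a)) (S.src₀.map l (E.preSrc.map l b))
      (S.tgt₀.map l (E.preTgt.map l b))
    rw [ha, hb] at h
    exact h
  · have ha := E.parallel_pre k a hn
    have hb := E.parallel_pre l b hn
    rw [(S.glob hn k _ _ ha.1 ha.2).1, (S.glob hn l _ _ hb.1 hb.2).1]
    exact S.exchange ι _ _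

/-- The source map from `(n + 1)`-cells to `n`-cells. -/
noncomputable def src' : E.cells.Hom S.C := Bimodule.quotLift E.preSrc E.preSrc_exchange

/-- The target map from `(n + 1)`-cells to `n`-cells. -/
noncomputable def tgt' : E.cells.Hom S.C := Bimodule.quotLift E.preTgt E.preTgt_exchange

/-- The `(n + 1)`-cells of the free `(n + 1)`-operad on a cellular extension of an `n`-operad. -/
noncomputable def freeCells : Cells F (n + 1) where
  C := E.cells
  Bd := S.C
  src := E.src'
  tgt := E.tgt'
  src₀ := S.src₀.comp E.src'
  tgt₀ := S.tgt₀.comp E.tgt'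
  idn := (Bimodule.quotMk _ _).comp E.preIdn
  src₀_idn := fun m u => by
    change S.src₀.map m (E.preSrc.map m ((Bimodule.prodInr _ _).map m (S.idn.map m u))) = u
    rw [E.preSrc_inr, S.src₀_idn]
  tgt₀_idn := fun m u => by
    change S.tgt₀.map m (E.preTgt.map m ((Bimodule.prodInr _ _).map m (S.idn.map m u))) = u
    rw [E.preTgt_inr, S.tgt₀_idn]
  idn_src₀ := fun h => absurd h (Nat.succ_ne_zero n)
  glob := fun _ m a b h h' => ⟨congrArg (S.src₀.map m) h, congrArg (S.tgt₀.map m) h'⟩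
  exchange := fun {k l m} ι a b => by
    induction a using Submodule.Quotient.induction_on with
    | H a =>
    induction b using Submodule.Quotient.induction_on with
    | H b =>
    exact (Submodule.Quotient.eq _).2 (Bimodule.Gen.of ⟨k, l, ι, a, b, rfl⟩)

/-- A cellular extension of an `n`-operad is acyclic if any two parallel `n`-cells are the source
and the target of an `(n + 1)`-cell of the free `(n + 1)`-operad on it. -/
def Acyclic : Prop :=
  ∀ (m : ℕ) (f g : S.C.Car m), S.Parallel f g →
    ∃ A : E.freeCells.C.Car m, E.src'.map m A = f ∧ E.tgt'.map m A = g

theorem parallel_cells (m : ℕ) (a : E.cells.Car m) :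
    S.Parallel (E.src'.map m a) (E.tgt'.map m a) := by
  induction a using Submodule.Quotient.induction_on with
  | H a => exact E.parallel_pre m a

theorem bracket_exchange {P : Operad K} (π : F.Hom P)
    (h : ∀ j (c : E.pre.Car j), π.map j (E.preSrc₀.map j c) = π.map j (E.preTgt₀.map j c))
    {M : Bimodule P} (f : E.pre.Hom (M.restrict π))
    (hi : ∀ j u, f.map j (E.preIdn.map j u) = 0) (m : ℕ) (z : E.pre.Car m)
    (hz : E.Exchange m z) : f.map m z = 0 := by
  obtain ⟨k, l, ι, a, b, rfl⟩ := hz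
  have hl : ∀ a b, f.map m (E.pre.left ι a b) = M.left ι (π.map k a) (f.map l b) :=
    fun a b => f.map_left ι a b
  have hr : ∀ a b, f.map m (E.pre.right ι a b) = M.right ι (f.map k a) (π.map l b) :=
    fun a b => f.map_right ι a b
  have hu := congrArg₂ (· + ·) (hr a (E.preSrc₀.map l b)) (hl (E.preTgt₀.map k a) b)
  have hd := congrArg₂ (· + ·) (hl (E.preSrc₀.map k a) b) (hr a (E.preTgt₀.map l b))
  have hu' := congrArg₂ (· - ·) hu (hi m (F.comp ι (E.preTgt₀.map k a) (E.preSrc₀.map l b)))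
  have hd' := congrArg₂ (· - ·) hd (hi m (F.comp ι (E.preSrc₀.map k a) (E.preTgt₀.map l b)))
  have e1 : ∀ x y w : E.pre.Car m, f.map m (x + y - w) = f.map m x + f.map m y - f.map m w :=
    fun x y w => by rw [map_sub, map_add]
  refine (map_sub (f.map m) _ _).trans (sub_eq_zero.2 ?_)
  refine (e1 _ _ _).trans (hu'.trans (Eq.trans ?_ ((e1 _ _ _).trans hd').symm))
  refine congrArg₂ (· - ·) ?_ rfl
  change M.right ι _ _ + M.left ι _ _ = M.left ι _ _ + M.right ι _ _
  rw [h k a, h l b, add_comm]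

/-- For an operad `P` under `F` that identifies the `0`-dimensional source and target of every cell,
the map from `(n + 1)`-cells to `P⟨X⟩` which sends `∑ λᵢ Γᵢ[αᵢ] + 1_c` to `∑ λᵢ π(Γᵢ)[αᵢ]`. -/
noncomputable def bracket {P : Operad K} (π : F.Hom P)
    (hπ : ∀ m a, π.map m (E.freeCells.src₀.map m a) = π.map m (E.freeCells.tgt₀.map m a)) :
    E.freeCells.C.Hom ((Bimodule.free P E.X).restrict π) :=
  Bimodule.quotLift
    ((Bimodule.freeLift ((Bimodule.free P E.X).restrict π) (fun _ x => Bimodule.free.of P x)).comp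
      (Bimodule.prodFst _ _))
    (E.bracket_exchange π (fun j c => hπ j ((Bimodule.quotMk _ _).map j c)) _
      (fun j _ => map_zero ((Bimodule.freeLift ((Bimodule.free P E.X).restrict π)
        (fun _ x => Bimodule.free.of P x)).map j)))

end CellExt

/-! ### Polygraphs -/

/-- A shuffle `ω`-polygraph: an indexed set `X₀` of `0`-generators and, for each `n`, a cellular
extension `ext n` (the `(n + 1)`-generators) of the free `n`-operad generated by the previous ones,
whose `n`-cells are `cells n`. -/
structure Polygraph (K : Type u) [Field K] where
  X₀ : ℕ → Type u
  cells : ∀ n, Cells (freeOperad K X₀) n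
  ext : ∀ n, CellExt (cells n)
  cells_zero : cells 0 = Cells.zero _
  cells_succ : ∀ n, cells (n + 1) = (ext n).freeCells

namespace Polygraph

variable (X : Polygraph K)

/-- The `n`-generators. -/
def gens : ℕ → ℕ → Type u
  | 0 => X.X₀
  | n + 1 => (X.ext n).X

/-- `X` is acyclic if its cellular extensions are acyclic in dimensions at least two. -/
def Acyclic : Prop := ∀ n, 1 ≤ n → (X.ext n).Acyclic

/-- The differences `s₀(f) - t₀(f)` for `f` a `1`-cell. -/
def Difference (m : ℕ) (z : (freeOperad K X.X₀).Op m) : Prop :=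
  ∃ f : (X.cells 1).C.Car m, z = (X.cells 1).src₀.map m f - (X.cells 1).tgt₀.map m f

/-- The operad presented by `X`: the coequalizer of `s₀` and `t₀` from `1`-cells to `0`-cells. -/
noncomputable def operad : Operad K := (freeOperad K X.X₀).quot X.Difference

/-- The canonical projection. -/
noncomputable def proj : (freeOperad K X.X₀).Hom X.operad := (freeOperad K X.X₀).quotMk X.Difference

theorem proj_src_tgt (n m : ℕ) (a : (X.ext n).freeCells.C.Car m) :
    X.proj.map m ((X.ext n).freeCells.src₀.map m a) =
      X.proj.map m ((X.ext n).freeCells.tgt₀.map m a) := by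
  have one : ∀ b : (X.cells 1).C.Car m,
      X.proj.map m ((X.cells 1).src₀.map m b) = X.proj.map m ((X.cells 1).tgt₀.map m b) :=
    fun b => (Submodule.Quotient.eq _).2 (Bimodule.Gen.of ⟨b, rfl⟩)
  have all : ∀ j (b : (X.cells (j + 1)).C.Car m),
      X.proj.map m ((X.cells (j + 1)).src₀.map m b) =
        X.proj.map m ((X.cells (j + 1)).tgt₀.map m b) := by
    intro j
    induction j with
    | zero => exact one
    | succ j ih =>
      rw [X.cells_succ (j + 1)]
      intro b
      have hp := (X.ext (j + 1)).parallel_cells m b (Nat.succ_ne_zero j)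
      have hg := (X.cells (j + 1)).glob (Nat.succ_ne_zero j) m _ _ hp.1 hp.2
      change X.proj.map m ((X.cells (j + 1)).src₀.map m ((X.ext (j + 1)).src'.map m b)) =
        X.proj.map m ((X.cells (j + 1)).tgt₀.map m ((X.ext (j + 1)).tgt'.map m b))
      rw [hg.1]
      exact ih _
  have h := all n
  rw [X.cells_succ n] at h
  exact h a

end Polygraph

/-- The identification of equal objects. -/
def Cells.homOfEq {n : ℕ} {S S' : Cells F n} (h : S = S') : S.C.Hom S'.C := h ▸ .id _

/-! ### The chain complex -/

/-- The unit indexed set, with one element `ε` in arity one. -/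
inductive UnitSet : ℕ → Type u
  | ε : UnitSet 0

/-- The generator `ε` of the free bimodule on the unit indexed set. -/
noncomputable def eps (P : Operad K) : (Bimodule.free P UnitSet).Car 0 := Bimodule.free.of P .ε

/-- `(ε | u) - ∑ᵢ u ∘ᵢ ε`, in the free bimodule on the unit indexed set. -/
noncomputable def commutator (P : Operad K) {n : ℕ} (u : P.Op n) :
    (Bimodule.free P UnitSet).Car n :=
  (Bimodule.free P UnitSet).right (Insertion.root n) (eps P) u -
    ∑ i : Fin (n + 1), (Bimodule.free P UnitSet).left (Insertion.leaf i) u (eps P)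

/-- The trivial bimodule `Ω_P`: the free bimodule on the unit indexed set modulo the relations
`(ε | u) = ∑ᵢ u ∘ᵢ ε`. -/
noncomputable def trivialBimodule (P : Operad K) : Bimodule P :=
  (Bimodule.free P UnitSet).quot (fun _ z => ∃ u, z = commutator P u)

/-- The projection of the free bimodule on the unit indexed set onto the trivial bimodule. -/
noncomputable def augmentation (P : Operad K) :
    (Bimodule.free P UnitSet).Hom (trivialBimodule P) := Bimodule.quotMk _ _

namespace Polygraph

variable (X : Polygraph K)

/-- The `(n - 1)`-generators, with the unit indexed set in dimension `-1`. -/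
def gens' : ℕ → ℕ → Type u
  | 0 => UnitSet
  | n + 1 => X.gens n

/-- The bimodule in degree `n - 1` of the chain complex `P⟨X⟩`. -/
noncomputable def chain (n : ℕ) : Bimodule X.operad := Bimodule.free X.operad (X.gens' n)

/-- The derivation `[ ]` from `0`-cells to `P⟨X₀⟩`. -/
noncomputable def bracketZero (m : ℕ) :
    (freeOperad K X.X₀).Op m →ₗ[K] (Bimodule.free X.operad X.X₀).Car m :=
  der X.proj (Bimodule.free X.operad X.X₀) (fun _ x => Bimodule.free.of X.operad x) m

/-- The map `[ ]` from `(n + 1)`-cells to `P⟨X_{n+1}⟩`. -/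
noncomputable def bracketSucc (n : ℕ) :
    (X.cells (n + 1)).C.Hom ((Bimodule.free X.operad (X.ext n).X).restrict X.proj) :=
  ((X.ext n).bracket X.proj (X.proj_src_tgt n)).comp (Cells.homOfEq (X.cells_succ n))

/-- The boundary map from degree `n` to degree `n - 1` of the chain complex `P⟨X⟩`. -/
noncomputable def boundary : ∀ n, (X.chain (n + 1)).Hom (X.chain n)
  | 0 => Bimodule.freeLift _ (fun _ x => commutator X.operad (X.proj.map _ (freeOperad.of K x)))
  | 1 => Bimodule.freeLift _ (fun m α =>
      X.bracketZero m ((X.cells 0).src₀.map m ((X.ext 0).src m α)) -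
        X.bracketZero m ((X.cells 0).src₀.map m ((X.ext 0).tgt m α)))
  | n + 2 => Bimodule.freeLift _ (fun m A =>
      (X.bracketSucc n).map m ((X.ext (n + 1)).src m A) -
        (X.bracketSucc n).map m ((X.ext (n + 1)).tgt m A))

end Polygraph

/-- A sequence of bimodule morphisms `⋯ → A₂ → A₁ → A₀ → M` is a resolution of `M` by free bimodules
on the families of generators `g n`: it is exact, ends with a surjection, and each `Aₙ` is free. -/
structure IsFreeResolution {P : Operad K} (A : ℕ → Bimodule P) (d : ∀ n, (A (n + 1)).Hom (A n))
    {M : Bimodule P} (e : (A 0).Hom M) {G : ℕ → ℕ → Type u} (g : ∀ n m, G n m → (A n).Car m) :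
    Prop where
  free : ∀ n, (A n).IsFreeOn (g n)
  exact : ∀ n m, Function.Exact ((d (n + 1)).map m) ((d n).map m)
  exact_zero : ∀ m, Function.Exact ((d 0).map m) (e.map m)
  surjective : ∀ m, Function.Surjective (e.map m)

end

end Shuffle

/-! Write I for the kernel of F → P. Every chain in P⟨X_n⟩ with n ≥ 1 is the bracket of an n-cell,
and for n ≥ 2 the boundary of [f] is [s f] - [t f]. Suppose that a cycle is the bracket of a cell f
with equal source and target. Then f and the identity on its source are parallel, acyclicity gives a
cell between them, and the bracket of that cell bounds [f], because brackets of identities vanish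
(`exact_of_acyclic`). Exactness in degrees n ≥ 1 is thus a lifting problem: a cycle must be
represented by a cell with equal source and target. The two ends on the right need no acyclicity.

At P⟨ε⟩ and at P⟨X₀⟩ the commutator with ε is a derivation. Modulo the image of δ₀ the derivation [
] kills I, hence descends to a derivation d of P. The bimodule of operations with one marked leaf
has an extension twisted by d, and the morphism from P⟨ε⟩ that sends ε to the marked unit sends the
commutator of u to d u (`toTwisted_commutator`). Applied after δ₋₁, it recovers a chain modulo
boundaries.

At P⟨X₁⟩, if [f] is a cycle then r = s₀ f - t₀ f lies in I and [r] = 0. The key is `mem_kernelSq`,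
the analogue for operads of the embedding of I/I² by Fox derivatives: such an r is a combination of
composites r' ∘ r'' of elements of I. If r'' = s₀ b - t₀ b, then r' ∘ b has 0-boundary r' ∘ r'' and
zero bracket, so f can be corrected. To prove the key, send u ∘ (ε | v) to u ∘ (v - nf v), with nf a
linear normal form modulo I, and evaluate this map on (ε | r) - ∑ r ∘ᵢ ε. The first term gives r and
the others give composites of two elements of I. On the other hand this commutator is the image of
the universal derivation of r, which lies in the span of the actions of I, and from it only
composites of two elements of I arise.

In higher degrees no correction is needed: s f - t f has zero source, target and bracket, and such a
cell vanishes (`CellExt.eq_zero_of_bracket_eq_zero`). The kernel of the bracket is generated by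
identities and by the actions of I. In dimension at least two the exchange relation turns everything
into identities. In dimension one terms r ∘ a with r in I remain. There a linear map T is built that
sends u to a 1-cell from u to nf u and satisfies T(u ∘ c) = u ∘ T(c) for c in I. The map a ↦ a -
1_{t a} - T(s a - t a) kills identities and all r ∘ a, but fixes cells with zero source and target
(`Cells.eq_zero_of_idn_add`).

Both T and the map on u ∘ (ε | v) are defined by recursion on trees from the root, whereas tree
monomials are classes of formal composites. Leaves labelled by natural numbers make this recursion
possible without tracking shuffles. -/

namespace Shuffle

/-! ### Leaves of an elementary composition -/

namespace Insertion

variable {k l n : ℕ}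

/-- The leaf of `x` on which `y` is grafted in `x ∘_ι y`. -/
noncomputable def slot (ι : Insertion k l n) : Fin (k + 1) := ι.graft.choose

theorem outer_slot (ι : Insertion k l n) : ι.outer ι.slot = ι.inner 0 := ι.graft.choose_spec

theorem slot_eq (ι : Insertion k l n) {p : Fin (k + 1)} (h : ι.outer p = ι.inner 0) :
    ι.slot = p := ι.outer.injective (ι.outer_slot.trans h.symm)

open Classical in
/-- The leaf of `x` below a given leaf of `x ∘_ι y`. -/
noncomputable def own (ι : Insertion k l n) (j : Fin (n + 1)) : Fin (k + 1) :=
  -- A label of `y` other than its smallest is not an outer label, so it falls to the default, the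
  -- leaf that carries `y`. The smallest label is the outer label of that same leaf, so the branches
  -- agree.
  if h : ∃ p, ι.outer p = j then h.choose else ι.slot

@[simp] theorem own_outer (ι : Insertion k l n) (p : Fin (k + 1)) : ι.own (ι.outer p) = p := by
  have h : ∃ q, ι.outer q = ι.outer p := ⟨p, rfl⟩
  rw [own, dif_pos h]
  exact ι.outer.injective h.choose_spec

@[simp] theorem own_inner (ι : Insertion k l n) (q : Fin (l + 1)) :
    ι.own (ι.inner q) = ι.slot := by
  unfold own
  split_ifs with h
  · have h0 := ι.meet _ _ h.choose_spec
    exact (ι.slot_eq (h.choose_spec.trans (by rw [h0]))).symm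
  · rfl

theorem cases (ι : Insertion k l n) (j : Fin (n + 1)) :
    (∃ q, ι.inner q = j) ∨ ((∀ q, ι.inner q ≠ j) ∧ ∃ p, ι.outer p = j) := by
  by_cases h : ∃ q, ι.inner q = j
  · exact Or.inl h
  · refine Or.inr ⟨fun q hq => h ⟨q, hq⟩, ?_⟩
    rcases ι.cover j with ⟨p, hp⟩ | ⟨q, hq⟩
    · exact ⟨p, hp⟩
    · exact absurd ⟨q, hq⟩ h

/-- An injective self-map of a finite type is onto, and order embeddings of `Fin n` with the same
range coincide. Hence compositions with an operation of arity one involve no relabelling on the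
other factor. -/
theorem orderEmbedding_eq_self {n : ℕ} (f : Fin n ↪o Fin n) (x : Fin n) : f x = x := by
  have h := (OrderEmbedding.range_eq_iff (f := f) (g := RelEmbedding.refl _)).1 (by
    have hf : Function.Surjective f := Finite.surjective_of_injective f.injective
    rw [hf.range_eq]
    exact (Function.surjective_id.range_eq).symm)
  exact DFunLike.congr_fun h x

theorem outer_self (ι : Insertion k l k) (x : Fin (k + 1)) : ι.outer x = x :=
  orderEmbedding_eq_self _ x

theorem inner_self (ι : Insertion k n n) (x : Fin (n + 1)) : ι.inner x = x :=
  orderEmbedding_eq_self _ x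

theorem leaf_inner {k : ℕ} (i : Fin (k + 1)) (x : Fin 1) : (Insertion.leaf i).inner x = i := rfl

end Insertion

theorem IsParallel.symm {k l p r n q : ℕ} {α : Insertion k l p} {β : Insertion p r n}
    {γ : Insertion k r q} {δ : Insertion q l n} (h : IsParallel α β γ δ) :
    IsParallel γ δ α β :=
  ⟨fun x => (h.left x).symm, fun x => (h.right x).symm, fun x => (h.middle x).symm, h.ne.symm⟩

namespace IsSequential

variable {k l p r n q : ℕ} {α : Insertion k l p} {β : Insertion p r n}
  {γ : Insertion k q n} {δ : Insertion l r q}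

theorem slot_right (h : IsSequential α β γ δ) : β.slot = α.inner δ.slot := by
  refine β.slot_eq ?_
  rw [h.middle, δ.outer_slot, h.right]

theorem own_inner (h : IsSequential α β γ δ) (y : Fin (q + 1)) :
    β.own (γ.inner y) = α.inner (δ.own y) := by
  rcases δ.cover y with ⟨x, rfl⟩ | ⟨x, rfl⟩
  · rw [← h.middle, Insertion.own_outer, Insertion.own_outer]
  · rw [← h.right, Insertion.own_inner, Insertion.own_inner, h.slot_right]

/-- The smallest label of `b ∘ c` is the smallest label of `b`, because `c` is grafted on a leaf
that bears the smallest label of `c`. So the composite hangs from the leaf that carried `b`. -/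
theorem slot_left (h : IsSequential α β γ δ) : γ.slot = α.slot := by
  refine γ.slot_eq ?_
  rw [← h.left, α.outer_slot, h.middle]
  refine le_antisymm ?_ (γ.inner.monotone (Fin.zero_le _))
  rcases δ.cover 0 with ⟨x, hx⟩ | ⟨x, hx⟩
  · rw [← hx]
    exact γ.inner.monotone (δ.outer.monotone (Fin.zero_le _))
  · rw [← hx, ← h.right, ← h.middle]
    have h0 : δ.inner 0 = 0 := le_antisymm (by rw [← hx]; exact δ.inner.monotone (Fin.zero_le _))
      (Fin.zero_le _)
    obtain ⟨y, hy⟩ := δ.graft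
    have hy' : y = 0 := by
      have := δ.outer.monotone (Fin.zero_le y)
      rw [hy, h0] at this
      have h2 : δ.outer 0 = δ.outer y := by rw [hy, h0]; exact le_antisymm this (Fin.zero_le _)
      exact (δ.outer.injective h2).symm
    have : δ.outer 0 = δ.inner 0 := by rw [← hy, hy']
    rw [h.middle, this, ← h.right]
    exact β.inner.monotone (Fin.zero_le _)

theorem own_own (h : IsSequential α β γ δ) (j : Fin (n + 1)) :
    α.own (β.own j) = γ.own j := by
  rcases γ.cover j with ⟨x, rfl⟩ | ⟨y, rfl⟩
  · rw [← h.left, Insertion.own_outer, Insertion.own_outer, h.left, Insertion.own_outer]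
  · rw [h.own_inner, Insertion.own_inner, Insertion.own_inner, h.slot_left]

theorem own_notMem (h : IsSequential α β γ δ) {j : Fin (n + 1)} (hj : ∀ y, γ.inner y ≠ j)
    (x : Fin (l + 1)) : α.inner x ≠ β.own j := by
  intro hx
  rcases β.cover j with ⟨y, rfl⟩ | ⟨y, rfl⟩
  · rw [Insertion.own_outer] at hx
    exact hj (δ.outer x) (by rw [← h.middle, hx])
  · exact hj (δ.inner y) (h.right y).symm

end IsSequential

namespace IsParallel

variable {k l p r n q : ℕ} {α : Insertion k l p} {β : Insertion p r n}
  {γ : Insertion k r q} {δ : Insertion q l n}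

theorem slot_left (h : IsParallel α β γ δ) : β.slot = α.outer γ.slot := by
  refine β.slot_eq ?_
  rw [h.left, γ.outer_slot, h.right]

theorem own_slot (h : IsParallel α β γ δ) : α.own β.slot = γ.slot := by
  rw [h.slot_left, Insertion.own_outer]

theorem own_own (h : IsParallel α β γ δ) (j : Fin (n + 1)) :
    α.own (β.own j) = γ.own (δ.own j) := by
  rcases β.cover j with ⟨x, rfl⟩ | ⟨y, rfl⟩
  · rw [Insertion.own_outer]
    rcases α.cover x with ⟨x, rfl⟩ | ⟨x, rfl⟩
    · rw [h.left, Insertion.own_outer, Insertion.own_outer, Insertion.own_outer]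
    · rw [h.middle, Insertion.own_inner, Insertion.own_inner, h.symm.own_slot]
  · rw [Insertion.own_inner, h.own_slot, h.right, Insertion.own_outer, Insertion.own_inner]

theorem own_notMem (h : IsParallel α β γ δ) {j : Fin (n + 1)} (hj : ∀ y, δ.inner y ≠ j)
    (x : Fin (l + 1)) : α.inner x ≠ β.own j := by
  intro hx
  rcases β.cover j with ⟨y, rfl⟩ | ⟨y, rfl⟩
  · rw [Insertion.own_outer] at hx
    exact hj x (by rw [← h.middle, hx])
  -- Here `j` belongs to `c`, so the leaf below it is the graft point of `c`. If that leaf were in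
  -- `b`, it would bear the smallest label of both `b` and `c`, which `ne` forbids.
  · rw [Insertion.own_inner] at hx
    have h1 : β.inner 0 = δ.inner x := by rw [← β.outer_slot, ← hx, h.middle]
    have h2 : x = 0 := δ.meet _ _ ((h.right 0).symm.trans h1)
    exact h.ne (by rw [h1, h2])

end IsParallel

/-! ### Derivations and twisted bimodules -/

section

variable {K : Type u} [Field K] {Q : Operad K}

/-- Derivations of an operad with values in a bimodule. -/
structure Derivation (M : Bimodule Q) where
  map : ∀ n, Q.Op n →ₗ[K] M.Car n
  map_comp : ∀ {k l n : ℕ} (ι : Insertion k l n) (a : Q.Op k) (b : Q.Op l),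
    map n (Q.comp ι a b) = M.right ι (map k a) b + M.left ι a (map l b)

theorem Derivation.map_one {M : Bimodule Q} (d : Derivation M) : d.map 0 Q.one = 0 := by
  have h := d.map_comp (Insertion.root 0) Q.one Q.one
  rw [Q.one_comp, M.one_left, M.right_one] at h
  exact left_eq_add.1 h

open Classical in
/-- Grafting a family of operations with one marked leaf on an operation. -/
noncomputable def markLeft (Q : Operad K) {k l n : ℕ} (ι : Insertion k l n) :
    Q.Op k →ₗ[K] (Fin (l + 1) → Q.Op l) →ₗ[K] (Fin (n + 1) → Q.Op n) :=
  LinearMap.mk₂ K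
    -- After grafting, the marked leaf is a leaf of the upper factor. Labels outside it carry no
    -- mark, hence the value zero.
    (fun u f j => if h : ∃ q, ι.inner q = j then Q.comp ι u (f h.choose) else 0)
    (fun u v f => by
      ext j
      by_cases h : ∃ q, ι.inner q = j <;> simp [h])
    (fun c u f => by
      ext j
      by_cases h : ∃ q, ι.inner q = j <;> simp [h])
    (fun u f g => by
      ext j
      by_cases h : ∃ q, ι.inner q = j <;> simp [h])
    (fun c u f => by
      ext j
      by_cases h : ∃ q, ι.inner q = j <;> simp [h])

/-- Grafting an operation on a family of operations with one marked leaf. -/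
noncomputable def markRight (Q : Operad K) {k l n : ℕ} (ι : Insertion k l n) :
    (Fin (k + 1) → Q.Op k) →ₗ[K] Q.Op l →ₗ[K] (Fin (n + 1) → Q.Op n) :=
  -- If `v` is grafted on the marked leaf, the mark passes to every leaf of `v`: this is the
  -- relation `(ε | v) = ∑ᵢ v ∘ᵢ ε` read on marks.
  LinearMap.mk₂ K (fun f v j => Q.comp ι (f (ι.own j)) v)
    (fun f g v => by ext; simp) (fun c f v => by ext; simp)
    (fun f v w => by ext; simp) (fun c f v => by ext; simp)

theorem markRight_apply {k l n : ℕ} (ι : Insertion k l n) (f : Fin (k + 1) → Q.Op k)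
    (v : Q.Op l) (j : Fin (n + 1)) : markRight Q ι f v j = Q.comp ι (f (ι.own j)) v := rfl

theorem markLeft_inner {k l n : ℕ} (ι : Insertion k l n) (u : Q.Op k) (f : Fin (l + 1) → Q.Op l)
    (q : Fin (l + 1)) : markLeft Q ι u f (ι.inner q) = Q.comp ι u (f q) := by
  have h : ∃ q', ι.inner q' = ι.inner q := ⟨q, rfl⟩
  have e : h.choose = q := ι.inner.injective h.choose_spec
  simp only [markLeft, LinearMap.mk₂_apply]
  rw [dif_pos h, e]

theorem markLeft_of_notMem {k l n : ℕ} (ι : Insertion k l n) (u : Q.Op k)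
    (f : Fin (l + 1) → Q.Op l) {j : Fin (n + 1)} (h : ∀ q, ι.inner q ≠ j) :
    markLeft Q ι u f j = 0 := by
  simp only [markLeft, LinearMap.mk₂_apply]
  rw [dif_neg (fun ⟨q, hq⟩ => h q hq)]

section

variable {k l p r n q : ℕ} {α : Insertion k l p} {β : Insertion p r n}

theorem markLeft_left {γ : Insertion k q n} {δ : Insertion l r q} (h : IsSequential α β γ δ)
    (u : Q.Op k) (v : Q.Op l) (f : Fin (r + 1) → Q.Op r) :
    markLeft Q β (Q.comp α u v) f = markLeft Q γ u (markLeft Q δ v f) := by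
  ext j
  rcases γ.cases j with ⟨y, rfl⟩ | ⟨hj, -⟩
  · rw [markLeft_inner]
    rcases δ.cases y with ⟨x, rfl⟩ | ⟨hy, -⟩
    · rw [markLeft_inner, ← h.right, markLeft_inner, Q.comp_seq h]
    · rw [markLeft_of_notMem _ _ _ hy, map_zero, markLeft_of_notMem]
      intro x hx
      rw [h.right] at hx
      exact hy x (γ.inner.injective hx)
  · rw [markLeft_of_notMem _ _ _ hj, markLeft_of_notMem]
    intro x hx
    exact hj (δ.inner x) (by rw [← h.right, hx])

theorem markRight_left {γ : Insertion k q n} {δ : Insertion l r q} (h : IsSequential α β γ δ)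
    (u : Q.Op k) (f : Fin (l + 1) → Q.Op l) (v : Q.Op r) :
    markRight Q β (markLeft Q α u f) v = markLeft Q γ u (markRight Q δ f v) := by
  ext j
  rcases γ.cases j with ⟨y, rfl⟩ | ⟨hj, -⟩
  · rw [markLeft_inner, markRight_apply, markRight_apply, h.own_inner, markLeft_inner,
      Q.comp_seq h]
  · rw [markLeft_of_notMem _ _ _ hj, markRight_apply, markLeft_of_notMem _ _ _ (h.own_notMem hj),
      LinearMap.map_zero₂]

theorem markRight_right {γ : Insertion k q n} {δ : Insertion l r q} (h : IsSequential α β γ δ)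
    (f : Fin (k + 1) → Q.Op k) (u : Q.Op l) (v : Q.Op r) :
    markRight Q β (markRight Q α f u) v = markRight Q γ f (Q.comp δ u v) := by
  ext j
  rw [markRight_apply, markRight_apply, markRight_apply, h.own_own, Q.comp_seq h]

theorem markRight_left_parallel {γ : Insertion k r q} {δ : Insertion q l n}
    (h : IsParallel α β γ δ) (u : Q.Op k) (f : Fin (l + 1) → Q.Op l) (v : Q.Op r) :
    markRight Q β (markLeft Q α u f) v = markLeft Q δ (Q.comp γ u v) f := by
  ext j
  rcases δ.cases j with ⟨y, rfl⟩ | ⟨hj, -⟩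
  · rw [markLeft_inner, markRight_apply, ← h.middle, Insertion.own_outer, markLeft_inner,
      Q.comp_par h]
  · rw [markLeft_of_notMem _ _ _ hj, markRight_apply, markLeft_of_notMem _ _ _ (h.own_notMem hj),
      LinearMap.map_zero₂]

theorem markRight_right_parallel {γ : Insertion k r q} {δ : Insertion q l n}
    (h : IsParallel α β γ δ) (f : Fin (k + 1) → Q.Op k) (u : Q.Op l) (v : Q.Op r) :
    markRight Q β (markRight Q α f u) v = markRight Q δ (markRight Q γ f v) u := by
  ext j
  rw [markRight_apply, markRight_apply, markRight_apply, markRight_apply, h.own_own,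
    Q.comp_par h]

end

/-- The extension, twisted by a derivation `d` with values in `M`, of the bimodule of operations
with one marked leaf by `M`. -/
noncomputable def twisted {M : Bimodule Q} (d : Derivation M) : Bimodule Q where
  Car := fun n => M.Car n × (Fin (n + 1) → Q.Op n)
  left := fun ι => LinearMap.mk₂ K (fun u x => (M.left ι u x.1, markLeft Q ι u x.2))
    (by intros; simp) (by intros; simp) (by intros; simp) (by intros; simp)
  right := fun ι => LinearMap.mk₂ K
    -- The second term of the first component is the twist: when `v` meets the mark, `(ε | v)` and
    -- `∑ᵢ v ∘ᵢ ε` have the same marks but differ by `d v` in `M`. The Leibniz rule is what makes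
    -- this an associative right action.
    (fun x v => (M.right ι x.1 v + M.left ι (x.2 ι.slot) (d.map _ v), markRight Q ι x.2 v))
    (by intros; ext <;> (simp; try abel)) (by intros; simp)
    (by intros; ext <;> (simp; try abel)) (by intros; simp)
  one_left := fun ι a => by
    refine Prod.ext (M.one_left ι a.1) (funext fun j => ?_)
    obtain ⟨q, rfl⟩ : ∃ q, ι.inner q = j := ⟨j, ι.inner_self j⟩
    change markLeft Q ι Q.one a.2 _ = _
    rw [markLeft_inner, Q.one_comp, ι.inner_self]
  right_one := fun ι a => by
    refine Prod.ext ?_ (funext fun j => ?_)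
    · change M.right ι a.1 Q.one + M.left ι _ (d.map _ Q.one) = _
      rw [M.right_one, d.map_one, map_zero, add_zero]
    · change Q.comp ι (a.2 (ι.own j)) Q.one = a.2 j
      obtain ⟨p, rfl⟩ : ∃ p, ι.outer p = j := ⟨j, ι.outer_self j⟩
      rw [Q.comp_one, ι.own_outer, ι.outer_self]
  seq_left_left := fun h u v a => Prod.ext (M.seq_left_left h u v a.1) (markLeft_left h u v a.2)
  seq_left_right := fun {k l p r n q α β γ δ} h u a v => by
    refine Prod.ext ?_ (markRight_left h u a.2 v)
    change M.right β (M.left α u a.1) v + M.left β (markLeft Q α u a.2 β.slot) (d.map _ v) =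
      M.left γ u (M.right δ a.1 v + M.left δ (a.2 δ.slot) (d.map _ v))
    rw [h.slot_right, markLeft_inner, M.seq_left_right h, M.seq_left_left h, map_add]
  seq_right_right := fun {k l p r n q α β γ δ} h a u v => by
    refine Prod.ext ?_ (markRight_right h a.2 u v)
    change M.right β (M.right α a.1 u + M.left α (a.2 α.slot) (d.map _ u)) v +
        M.left β (Q.comp α (a.2 (α.own β.slot)) u) (d.map _ v) =
      M.right γ a.1 (Q.comp δ u v) + M.left γ (a.2 γ.slot) (d.map _ (Q.comp δ u v))
    rw [d.map_comp, h.slot_right, Insertion.own_inner, h.slot_left, LinearMap.map_add₂, map_add,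
      M.seq_right_right h, M.seq_left_right h, M.seq_left_left h, add_assoc]
  par_left_right := fun {k l p r n q α β γ δ} h u a v => by
    refine Prod.ext ?_ (markRight_left_parallel h u a.2 v)
    change M.right β (M.left α u a.1) v + M.left β (markLeft Q α u a.2 β.slot) (d.map _ v) =
      M.left δ (Q.comp γ u v) a.1
    -- In the parallel case `v` is not grafted on the factor bearing the mark, so the twist does not
    -- contribute.
    have hs : ∀ x, α.inner x ≠ β.slot := fun x hx => by
      rw [h.slot_left] at hx
      have h0 := α.meet _ _ hx.symm
      subst h0
      exact h.ne (by rw [← h.middle, hx, h.left, γ.outer_slot, h.right])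
    rw [markLeft_of_notMem _ _ _ hs, LinearMap.map_zero₂, add_zero, M.par_left_right h]
  par_right_right := fun {k l p r n q α β γ δ} h a u v => by
    refine Prod.ext ?_ (markRight_right_parallel h a.2 u v)
    change M.right β (M.right α a.1 u + M.left α (a.2 α.slot) (d.map _ u)) v +
        M.left β (Q.comp α (a.2 (α.own β.slot)) u) (d.map _ v) =
      M.right δ (M.right γ a.1 v + M.left γ (a.2 γ.slot) (d.map _ v)) u +
        M.left δ (Q.comp γ (a.2 (γ.own δ.slot)) v) (d.map _ u)
    rw [h.own_slot, h.symm.own_slot, LinearMap.map_add₂, LinearMap.map_add₂,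
      M.par_right_right h, M.par_left_right h, M.par_left_right h.symm]
    abel

/-- The morphism from the free bimodule on one generator `ε` to a twisted bimodule which sends `ε`
to the marked unit. -/
noncomputable def toTwisted {M : Bimodule Q} (d : Derivation M) :
    (Bimodule.free Q UnitSet).Hom (twisted d) :=
  Bimodule.freeLift _ (fun _ x => match x with | .ε => (0, fun _ => Q.one))

theorem toTwisted_eps {M : Bimodule Q} (d : Derivation M) :
    (toTwisted d).map 0 (eps Q) = ((0, fun _ => Q.one) : M.Car 0 × (Fin 1 → Q.Op 0)) :=
  Bimodule.freeLift_of _ _ _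

theorem toTwisted_root {M : Bimodule Q} (d : Derivation M) {n : ℕ} (u : Q.Op n) :
    (toTwisted d).map n ((Bimodule.free Q UnitSet).right (Insertion.root n) (eps Q) u) =
      ((d.map n u, fun _ => u) : M.Car n × (Fin (n + 1) → Q.Op n)) := by
  rw [(toTwisted d).map_right, toTwisted_eps]
  refine Prod.ext ?_ (funext fun j => Q.one_comp _ u)
  change M.right _ 0 u + M.left _ Q.one (d.map n u) = d.map n u
  rw [LinearMap.map_zero₂, zero_add, M.one_left]

theorem toTwisted_leaf {M : Bimodule Q} (d : Derivation M) {n : ℕ} (u : Q.Op n) (i : Fin (n + 1)) :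
    (toTwisted d).map n ((Bimodule.free Q UnitSet).left (Insertion.leaf i) u (eps Q)) =
      ((0, Pi.single i u) : M.Car n × (Fin (n + 1) → Q.Op n)) := by
  rw [(toTwisted d).map_left, toTwisted_eps]
  refine Prod.ext (map_zero (M.left _ u)) (funext fun j => ?_)
  change markLeft Q (Insertion.leaf i) u (fun _ => Q.one) j = Pi.single (M := fun _ => Q.Op n) i u j
  by_cases h : j = i
  · subst h
    have := markLeft_inner (Insertion.leaf j) u (fun _ => Q.one) 0
    rw [Insertion.leaf_inner] at this
    rw [this, Q.comp_one, Pi.single_eq_same]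
  · rw [markLeft_of_notMem _ _ _ (fun q hq => h hq.symm), Pi.single_eq_of_ne h]

/-- The marks cancel: `(ε | u)` marks all leaves of `u`, and the sum over the leaves removes these
marks one at a time. What survives is the twist. Thus a derivation of the operad can be read off
from commutators in the free bimodule on `ε`. -/
theorem toTwisted_commutator {M : Bimodule Q} (d : Derivation M) {n : ℕ} (u : Q.Op n) :
    (toTwisted d).map n (commutator Q u) =
      ((d.map n u, 0) : M.Car n × (Fin (n + 1) → Q.Op n)) := by
  unfold commutator
  rw [map_sub, map_sum, toTwisted_root]
  simp_rw [toTwisted_leaf]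
  have h : ∀ s : Finset (Fin (n + 1)),
      (∑ i ∈ s, ((0, Pi.single i u) : M.Car n × (Fin (n + 1) → Q.Op n))) =
        (0, ∑ i ∈ s, Pi.single i u) := fun s => by
    refine Prod.ext ?_ ?_
    · rw [Prod.fst_sum]; exact Finset.sum_const_zero
    · rw [Prod.snd_sum]
  refine (congrArg (_ - ·) (h Finset.univ)).trans (Prod.ext (sub_zero _) ?_)
  have h2 : (∑ i : Fin (n + 1), Pi.single i u : Fin (n + 1) → Q.Op n) = fun _ => u :=
    Finset.univ_sum_single (fun _ => u)
  exact sub_eq_zero.2 h2.symm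

/-- The inclusion of `M` in a twisted bimodule. -/
noncomputable def twistedInl {M : Bimodule Q} (d : Derivation M) : M.Hom (twisted d) where
  map := fun _ => LinearMap.inl K _ _
  map_left := fun ι v _ => Prod.ext rfl (map_zero (markLeft Q ι v)).symm
  map_right := fun {k l n} ι a v => Prod.ext (by
    change M.right ι a v = M.right ι a v + M.left ι (0 : Q.Op k) (d.map _ v)
    rw [LinearMap.map_zero₂, add_zero]) (LinearMap.map_zero₂ (markRight Q ι) v).symm

end

end Shuffle

namespace Shuffle

/-! ### The commutator is a derivation -/

/-- Inclusion and exclusion: the two lists of labels cover everything and have only the label of the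
graft point in common. -/
theorem Insertion.sum_leaves {k l n : ℕ} (ι : Insertion k l n) {V : Type*} [AddCommGroup V]
    (f : Fin (n + 1) → V) :
    ∑ j, f j = ∑ p, f (ι.outer p) + ∑ q, f (ι.inner q) - f (ι.inner 0) := by
  classical
  rw [eq_sub_iff_add_eq]
  have h := Finset.sum_union_inter (s₁ := Finset.univ.map ι.outer.toEmbedding)
    (s₂ := Finset.univ.map ι.inner.toEmbedding) (f := f)
  rw [Finset.sum_map, Finset.sum_map] at h
  refine Eq.trans ?_ h
  congr 1
  · congr 1
    ext j
    rcases ι.cover j with ⟨p, rfl⟩ | ⟨q, rfl⟩ <;> simp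
  · rw [Finset.sum_eq_single (ι.inner 0)]
    · intro b hb hne
      simp only [Finset.mem_inter, Finset.mem_map, Finset.mem_univ, true_and] at hb
      obtain ⟨⟨p, hp⟩, ⟨q, rfl⟩⟩ := hb
      exact absurd (congrArg ι.inner (ι.meet p q hp)) hne
    · intro h
      refine absurd ?_ h
      simp only [Finset.mem_inter, Finset.mem_map, Finset.mem_univ, true_and]
      exact ⟨ι.graft, 0, rfl⟩

section

variable {K : Type u} [Field K] {Q : Operad K}

/-- The leaves of `u ∘ v` are those of `v` together with those of `u` other than the graft point. In
the first commutator on the right, the term of the graft point becomes `u ∘ (e | v)`, which cancels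
the leading term of the second commutator. -/
theorem Bimodule.sum_leaf_comp (A : Bimodule Q) (e : A.Car 0) {k l n : ℕ} (ι : Insertion k l n)
    (u : Q.Op k) (v : Q.Op l) :
    A.right (Insertion.root n) e (Q.comp ι u v) -
        ∑ j, A.left (Insertion.leaf j) (Q.comp ι u v) e =
      A.right ι (A.right (Insertion.root k) e u - ∑ p, A.left (Insertion.leaf p) u e) v +
        A.left ι u (A.right (Insertion.root l) e v - ∑ q, A.left (Insertion.leaf q) v e) := by
  have h_root : A.right ι (A.right (Insertion.root k) e u) v =
      A.right (Insertion.root n) e (Q.comp ι u v) :=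
    A.seq_right_right ⟨fun x => by
      obtain rfl : x = 0 := Subsingleton.elim (α := Fin 1) _ _
      change ι.outer 0 = 0
      refine le_antisymm ?_ (Fin.zero_le _)
      rcases ι.cover 0 with ⟨p, hp⟩ | ⟨q, hq⟩
      · rw [← hp]; exact ι.outer.monotone (Fin.zero_le _)
      · rw [← hq]
        obtain ⟨i, hi⟩ := ι.graft
        calc ι.outer 0 ≤ ι.outer i := ι.outer.monotone (Fin.zero_le _)
          _ = ι.inner 0 := hi
          _ ≤ ι.inner q := ι.inner.monotone (Fin.zero_le _),
      fun _ => rfl, fun _ => rfl⟩ _ _ _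
  have h_inner : ∀ q, A.left (Insertion.leaf (ι.inner q)) (Q.comp ι u v) e =
      A.left ι u (A.left (Insertion.leaf q) v e) := fun q =>
    A.seq_left_left ⟨fun _ => rfl, fun _ => rfl, fun _ => rfl⟩ _ _ _
  have h_outer : ∀ p, p ≠ ι.slot → A.left (Insertion.leaf (ι.outer p)) (Q.comp ι u v) e =
      A.right ι (A.left (Insertion.leaf p) u e) v := fun p hp => by
    have h : IsParallel (Insertion.leaf p) ι ι (Insertion.leaf (ι.outer p)) :=
      ⟨fun _ => rfl, fun _ => rfl, fun _ => rfl, fun h => hp (ι.slot_eq h.symm).symm⟩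
    exact (A.par_left_right h u e v).symm
  have h_slot : A.right ι (A.left (Insertion.leaf ι.slot) u e) v =
      A.left ι u (A.right (Insertion.root l) e v) :=
    A.seq_left_right ⟨fun _ => rfl, fun _ => ι.outer_slot, fun _ => rfl⟩ _ _ _
  rw [map_sub, map_sub, LinearMap.sub_apply, map_sum, map_sum, LinearMap.sum_apply, h_root,
    ι.sum_leaves, ← ι.outer_slot]
  simp_rw [h_inner]
  rw [← Finset.add_sum_erase _ _ (Finset.mem_univ ι.slot),
    ← Finset.add_sum_erase Finset.univ (fun p => A.right ι (A.left (Insertion.leaf p) u e) v)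
      (Finset.mem_univ ι.slot), h_slot,
    Finset.sum_congr rfl (fun p hp => h_outer p (Finset.ne_of_mem_erase hp))]
  abel

theorem commutator_comp {k l n : ℕ} (ι : Insertion k l n) (u : Q.Op k) (v : Q.Op l) :
    commutator Q (Q.comp ι u v) = (Bimodule.free Q UnitSet).right ι (commutator Q u) v +
      (Bimodule.free Q UnitSet).left ι u (commutator Q v) :=
  Bimodule.sum_leaf_comp _ (eps Q) ι u v

/-- The commutator with `ε`, as a derivation. -/
noncomputable def commutatorDerivation (Q : Operad K) :
    Derivation (Bimodule.free Q (UnitSet.{u})) where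
  map := fun n => (Bimodule.free Q UnitSet).right (Insertion.root n) (eps Q) -
    ∑ i : Fin (n + 1), ((Bimodule.free Q UnitSet).left (Insertion.leaf i)).flip (eps Q)
  map_comp := fun ι a b => by
    have h : ∀ n (u : Q.Op n), ((Bimodule.free Q UnitSet).right (Insertion.root n) (eps Q) -
        ∑ i : Fin (n + 1), ((Bimodule.free Q UnitSet).left (Insertion.leaf i)).flip (eps Q)) u =
          commutator Q u := fun n u => by
      simp [commutator]
    rw [h, h, h, commutator_comp]

theorem commutatorDerivation_map {n : ℕ} (u : Q.Op n) :
    (commutatorDerivation Q).map n u = commutator Q u := by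
  simp [commutatorDerivation, commutator]

/-- The image of a derivation under a morphism of bimodules. -/
def Derivation.push {M N : Bimodule Q} (d : Derivation M) (f : M.Hom N) : Derivation N where
  map := fun n => (f.map n).comp (d.map n)
  map_comp := fun ι a b => by
    simp [d.map_comp, f.map_left, f.map_right]

/-- Restriction of a derivation along a morphism of operads. -/
def Derivation.pull {P : Operad K} (π : Q.Hom P) {M : Bimodule P} (d : Derivation M) :
    Derivation (M.restrict π) where
  map := fun n => (d.map n).comp (π.map n)
  map_comp := fun ι a b => by
    refine (congrArg (d.map _) (π.map_comp ι a b)).trans ?_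
    exact d.map_comp ι _ _

/-- Restriction of a morphism of bimodules along a morphism of operads. -/
def Bimodule.Hom.restrict {P : Operad K} (π : Q.Hom P) {M N : Bimodule P} (f : M.Hom N) :
    (M.restrict π).Hom (N.restrict π) where
  map := f.map
  map_left := fun ι v a => f.map_left ι (π.map _ v) a
  map_right := fun ι a v => f.map_right ι a (π.map _ v)

end

/-! ### Free operads -/

section

variable {K : Type u} [Field K] {X : ℕ → Type u}

theorem freeOperad.linearMap_ext {n : ℕ} {V : Type*} [AddCommGroup V] [Module K V]
    {f g : (freeOperad K X).Op n →ₗ[K] V} (h : ∀ w : Word X n, f (mono K w) = g (mono K w)) :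
    f = g := by
  refine Finsupp.lhom_ext' (fun t => LinearMap.ext_ring ?_)
  induction t using Quot.ind with
  | mk w => exact h w

theorem Derivation.ext_free {M : Bimodule (freeOperad K X)} {d e : Derivation M}
    (h : ∀ n (x : X n), d.map n (freeOperad.of K x) = e.map n (freeOperad.of K x)) (n : ℕ) :
    d.map n = e.map n := by
  refine freeOperad.linearMap_ext (fun w => ?_)
  induction w with
  | gen x => exact h _ x
  | one => exact d.map_one.trans e.map_one.symm
  | comp ι a b iha ihb => rw [mono_comp, d.map_comp, e.map_comp, iha, ihb]

theorem der_mono {P : Operad K} (π : (freeOperad K X).Hom P) (A : Bimodule P)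
    (φ : ∀ n, X n → A.Car n) {n : ℕ} (w : Word X n) :
    der π A φ n (mono K w) = w.der π A φ := by
  simp only [der, mono]
  refine (Finsupp.linearCombination_single K _ _).trans ?_
  exact one_smul K _

/-- The derivation of a free operad given by its values on generators. -/
noncomputable def freeDerivation {P : Operad K} (π : (freeOperad K X).Hom P) (A : Bimodule P)
    (φ : ∀ n, X n → A.Car n) : Derivation (A.restrict π) where
  map := der π A φ
  map_comp := fun {k l n} ι a b => by
    have h : ((freeOperad K X).comp ι).compr₂ (der π A φ n) =
        ((A.right ι).compl₂ (π.map l)).comp (der π A φ k) +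
          (((A.left ι).comp (π.map k)).compl₂ (der π A φ l)) := by
      refine freeOperad.linearMap_ext (fun v => freeOperad.linearMap_ext (fun w => ?_))
      have e : der π A φ n ((freeOperad K X).comp ι (mono K v) (mono K w)) =
          (Word.comp ι v w).der π A φ := by
        rw [← mono_comp]
        exact der_mono π A φ _
      refine e.trans ?_
      simp only [Word.der, LinearMap.add_apply, LinearMap.comp_apply, LinearMap.compl₂_apply,
        der_mono]
    exact LinearMap.congr_fun₂ h a b

theorem freeDerivation_of {P : Operad K} (π : (freeOperad K X).Hom P) (A : Bimodule P)
    (φ : ∀ n, X n → A.Car n) {n : ℕ} (x : X n) :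
    (freeDerivation π A φ).map n (freeOperad.of K x) = φ n x :=
  der_mono π A φ (.gen x)

end

/-! ### Cells -/

section

variable {K : Type u} [Field K] {F P : Operad K}

namespace Bimodule

/-- The image of a morphism is already closed under sums, scalars and both actions, so generation
adds nothing. -/
theorem gen_range {A B : Bimodule F} (f : A.Hom B) {n : ℕ} {z : B.Car n}
    (hz : z ∈ B.gen (fun m z => ∃ y, z = f.map m y) n) : ∃ y, z = f.map n y := by
  induction hz with
  | of h => exact h
  | zero n => exact ⟨0, (map_zero _).symm⟩
  | add _ _ h1 h2 =>
    obtain ⟨y, rfl⟩ := h1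
    obtain ⟨z, rfl⟩ := h2
    exact ⟨y + z, (map_add _ _ _).symm⟩
  | smul c _ h =>
    obtain ⟨y, rfl⟩ := h
    exact ⟨c • y, (map_smul _ _ _).symm⟩
  | left ι v _ h =>
    obtain ⟨y, rfl⟩ := h
    exact ⟨_, (f.map_left ι v y).symm⟩
  | right ι v _ h =>
    obtain ⟨y, rfl⟩ := h
    exact ⟨_, (f.map_right ι y v).symm⟩

theorem quotMk_eq_zero {A : Bimodule F} {R : ∀ n, A.Car n → Prop} {n : ℕ} {a : A.Car n} :
    (A.quotMk R).map n a = 0 ↔ a ∈ A.gen R n := Submodule.Quotient.mk_eq_zero _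

theorem quotMk_surjective (A : Bimodule F) (R : ∀ n, A.Car n → Prop) (n : ℕ) :
    Function.Surjective ((A.quotMk R).map n) := Submodule.Quotient.mk_surjective _

theorem Hom.congr_map {A B : Bimodule F} {f g : A.Hom B} (h : f = g) {n : ℕ} (a : A.Car n) :
    f.map n a = g.map n a := by rw [h]

/-- First inclusion. -/
def prodInl (A B : Bimodule F) : Hom A (A.prod B) where
  map := fun _ => LinearMap.inl K _ _
  map_left := fun ι v _ => Prod.ext rfl (map_zero (B.left ι v)).symm
  map_right := fun ι _ v => Prod.ext rfl (LinearMap.map_zero₂ (B.right ι) v).symm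

end Bimodule

namespace CellExt

variable {n : ℕ} {S : Cells F n} (E : CellExt S)

/-- The projection of `F⟨X⟩ ⊕ C` onto the `(n + 1)`-cells. -/
noncomputable def toCells : E.pre.Hom E.freeCells.C := Bimodule.quotMk _ E.Exchange

theorem toCells_surjective (m : ℕ) : Function.Surjective (E.toCells.map m) :=
  E.pre.quotMk_surjective E.Exchange m

/-- The `(n + 1)`-cell given by a generator. -/
noncomputable def ofGen {m : ℕ} (x : E.X m) : E.freeCells.C.Car m :=
  E.toCells.map m ((Bimodule.prodInl _ _).map m (Bimodule.free.of F x))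

/-- The identities of `n`-cells. -/
noncomputable def idc : S.C.Hom E.freeCells.C :=
  E.toCells.comp (Bimodule.prodInr _ _)

theorem src_ofGen {m : ℕ} (x : E.X m) : E.src'.map m (E.ofGen x) = E.src m x := by
  change (Bimodule.freeLift S.C E.src).map m (Bimodule.free.of F x) + 0 = _
  rw [Bimodule.freeLift_of, add_zero]

theorem tgt_ofGen {m : ℕ} (x : E.X m) : E.tgt'.map m (E.ofGen x) = E.tgt m x := by
  change (Bimodule.freeLift S.C E.tgt).map m (Bimodule.free.of F x) + 0 = _
  rw [Bimodule.freeLift_of, add_zero]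

theorem src_idc {m : ℕ} (c : S.C.Car m) : E.src'.map m (E.idc.map m c) = c := E.preSrc_inr m c

theorem tgt_idc {m : ℕ} (c : S.C.Car m) : E.tgt'.map m (E.idc.map m c) = c := E.preTgt_inr m c

theorem hom_ext {A : Bimodule F} {f g : E.freeCells.C.Hom A}
    (h : ∀ m (x : E.X m), f.map m (E.ofGen x) = g.map m (E.ofGen x))
    (h' : ∀ m (c : S.C.Car m), f.map m (E.idc.map m c) = g.map m (E.idc.map m c)) : f = g := by
  have h1 : (f.comp E.toCells).comp (Bimodule.prodInl _ _) =
      (g.comp E.toCells).comp (Bimodule.prodInl _ _) :=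
    Bimodule.free_hom_ext (fun m x => h m x)
  ext m a
  obtain ⟨b, rfl⟩ := E.toCells_surjective m a
  have e : E.toCells.map m b = E.toCells.map m
      ((Bimodule.prodInl (Bimodule.free F E.X) S.C).map m b.1) + E.idc.map m b.2 := by
    refine Eq.trans ?_ (map_add (E.toCells.map m) _ _)
    exact congrArg _ (Prod.ext (add_zero _).symm (zero_add _).symm)
  rw [e, map_add, map_add]
  exact congrArg₂ (· + ·) (Bimodule.Hom.congr_map h1 b.1) (h' m b.2)

variable (π : F.Hom P)
  (hπ : ∀ m a, π.map m (E.freeCells.src₀.map m a) = π.map m (E.freeCells.tgt₀.map m a))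

theorem bracket_ofGen {m : ℕ} (x : E.X m) :
    (E.bracket π hπ).map m (E.ofGen x) = Bimodule.free.of P x :=
  Bimodule.freeLift_of _ _ _

theorem bracket_idc {m : ℕ} (c : S.C.Car m) : (E.bracket π hπ).map m (E.idc.map m c) = 0 :=
  map_zero ((Bimodule.freeLift ((Bimodule.free P E.X).restrict π)
    (fun _ x => Bimodule.free.of P x)).map m)

/-- Coefficients in `P` lift to `F`, one action at a time along a formal composite. Statements about
chains become statements about cells. -/
theorem bracket_surjective (hs : ∀ m, Function.Surjective (π.map m)) (m : ℕ)
    (a : (Bimodule.free P E.X).Car m) : ∃ f, (E.bracket π hπ).map m f = a := by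
  have key : ∀ m (w : Bimodule.Mon P E.X m), ∃ f, (E.bracket π hπ).map m f =
      Submodule.Quotient.mk (Finsupp.single w 1) := by
    intro m w
    induction w with
    | gen x => exact ⟨_, E.bracket_ofGen π hπ x⟩
    | left ι v a ih =>
      obtain ⟨f, hf⟩ := ih
      obtain ⟨v, rfl⟩ := hs _ v
      refine ⟨E.freeCells.C.left ι v f, ((E.bracket π hπ).map_left ι v f).trans ?_⟩
      refine (congrArg ((Bimodule.free P E.X).left ι _) hf).trans ?_
      change Submodule.Quotient.mk (Bimodule.preLeft ι _ (Finsupp.single a 1)) = _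
      simp [Bimodule.preLeft, Finsupp.mapDomain_single]
    | right ι a v ih =>
      obtain ⟨f, hf⟩ := ih
      obtain ⟨v, rfl⟩ := hs _ v
      refine ⟨E.freeCells.C.right ι f v, ((E.bracket π hπ).map_right ι f v).trans ?_⟩
      refine (congrArg (fun z => (Bimodule.free P E.X).right ι z _) hf).trans ?_
      change Submodule.Quotient.mk (Bimodule.preRight ι _ (Finsupp.single a 1)) = _
      simp [Bimodule.preRight, Finsupp.mapDomain_single]
  induction a using Submodule.Quotient.induction_on with
  | H a =>
    induction a using Finsupp.induction_linear with
    | zero => exact ⟨0, map_zero _⟩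
    | add a b ha hb =>
      obtain ⟨f, hf⟩ := ha
      obtain ⟨g, hg⟩ := hb
      exact ⟨f + g, (map_add _ f g).trans (congrArg₂ (· + ·) hf hg)⟩
    | single w c =>
      obtain ⟨f, hf⟩ := key m w
      refine ⟨c • f, (map_smul _ c f).trans ((congrArg (c • ·) hf).trans ?_)⟩
      have e : c • Finsupp.single w (1 : K) = Finsupp.single w c := by simp
      exact congrArg Submodule.Quotient.mk e

end CellExt

/-- The difference of the values of a derivation on `0`-dimensional source and target. -/
noncomputable def derivationDiff {n : ℕ} (S : Cells F n) (π : F.Hom P)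
    (hπ : ∀ m a, π.map m (S.src₀.map m a) = π.map m (S.tgt₀.map m a)) {M : Bimodule P}
    (d : Derivation (M.restrict π)) : S.C.Hom (M.restrict π) where
  map := fun m => (d.map m).comp (S.src₀.map m) - (d.map m).comp (S.tgt₀.map m)
  map_left := fun {k l m} ι v a => by
    have h1 := d.map_comp ι v (S.src₀.map l a)
    have h2 := d.map_comp ι v (S.tgt₀.map l a)
    -- A derivation is not a morphism of bimodules; the obstruction is the term where it falls on
    -- `v`. That term involves the cell only through `π` of its `0`-boundary, so it is the same for
    -- source and target and cancels in the difference.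
    have h3 : (M.restrict π).right ι (d.map k v) (S.src₀.map l a) =
        (M.restrict π).right ι (d.map k v) (S.tgt₀.map l a) :=
      congrArg (M.right ι (d.map k v)) (hπ l a)
    simp only [LinearMap.sub_apply, LinearMap.comp_apply, map_sub, S.src₀.map_left,
      S.tgt₀.map_left]
    rw [h1, h2, h3, add_sub_add_left_eq_sub]
  map_right := fun {k l m} ι a v => by
    have h1 := d.map_comp ι (S.src₀.map k a) v
    have h2 := d.map_comp ι (S.tgt₀.map k a) v
    have h3 : (M.restrict π).left ι (S.src₀.map k a) (d.map l v) =
        (M.restrict π).left ι (S.tgt₀.map k a) (d.map l v) :=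
      congrArg (fun z => M.left ι z (d.map l v)) (hπ k a)
    simp only [LinearMap.sub_apply, LinearMap.comp_apply, map_sub, S.src₀.map_right,
      S.tgt₀.map_right]
    rw [h1, h2, h3, add_sub_add_right_eq_sub]

/-- In dimension zero every cell is the identity on its source, and an identity has equal source and
target. -/
theorem Cells.src₀_eq_tgt₀ (S : Cells F 0) {m : ℕ} (a : S.C.Car m) :
    S.src₀.map m a = S.tgt₀.map m a := by
  conv_rhs => rw [← S.idn_src₀ rfl m a, S.tgt₀_idn]

end

end Shuffle

namespace Shuffle

/-! ### Completion of pairs of elementary compositions -/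

namespace Insertion

theorem outer_zero {k l n : ℕ} (ι : Insertion k l n) : ι.outer 0 = 0 := by
  refine le_antisymm ?_ (Fin.zero_le _)
  rcases ι.cover 0 with ⟨p, hp⟩ | ⟨q, hq⟩
  · rw [← hp]; exact ι.outer.monotone (Fin.zero_le _)
  · rw [← hq]
    obtain ⟨i, hi⟩ := ι.graft
    calc ι.outer 0 ≤ ι.outer i := ι.outer.monotone (Fin.zero_le _)
      _ = ι.inner 0 := hi
      _ ≤ ι.inner q := ι.inner.monotone (Fin.zero_le _)

/-- Two increasing lists of labels that meet only at the smallest label of the second one are the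
lists of labels of an elementary composition. -/
theorem exists_glue {k l : ℕ} {L : Type*} [LinearOrder L] (f : Fin (k + 1) ↪o L)
    (g : Fin (l + 1) ↪o L) (hg : ∃ i, f i = g 0) (hm : ∀ p q, f p = g q → q = 0) :
    ∃ (n : ℕ) (ν : Fin (n + 1) ↪o L) (ι : Insertion k l n),
      (∀ p, ν (ι.outer p) = f p) ∧ ∀ q, ν (ι.inner q) = g q := by
  classical
  -- The labels of the composite are the union of both lists, enumerated increasingly by `ν`; the
  -- elementary composition is obtained by pulling the two lists back along `ν`.
  set U : Finset L := Finset.univ.map f.toEmbedding ∪ Finset.univ.map g.toEmbedding with hU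
  have hf : ∀ p, f p ∈ U := fun p => by simp [hU]
  have hgU : ∀ q, g q ∈ U := fun q => by simp [hU]
  obtain ⟨n, hn⟩ : ∃ n, U.card = n + 1 :=
    Nat.exists_eq_succ_of_ne_zero (Finset.card_ne_zero_of_mem (hf 0))
  set ν := U.orderEmbOfFin hn with hν
  have hr : Set.range ν = U := U.range_orderEmbOfFin hn
  have ho : ∀ p, ∃ j, ν j = f p := fun p => by
    have : f p ∈ Set.range ν := by rw [hr]; exact hf p
    exact this
  have hi : ∀ q, ∃ j, ν j = g q := fun q => by
    have : g q ∈ Set.range ν := by rw [hr]; exact hgU q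
    exact this
  choose o ho using ho
  choose i hi using hi
  refine ⟨n, ν, ⟨OrderEmbedding.ofStrictMono o (fun a b h => ?_),
    OrderEmbedding.ofStrictMono i (fun a b h => ?_), ?_, ?_, ?_⟩, ho, hi⟩
  · rw [← ν.lt_iff_lt, ho, ho]; exact f.strictMono h
  · rw [← ν.lt_iff_lt, hi, hi]; exact g.strictMono h
  · obtain ⟨p, hp⟩ := hg
    exact ⟨p, ν.injective ((ho p).trans (hp.trans (hi 0).symm))⟩
  · intro p q h
    refine hm p q ?_
    rw [← ho, ← hi]
    exact congrArg ν h
  · intro j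
    have : ν j ∈ U := by
      have h : ν j ∈ Set.range ν := ⟨j, rfl⟩
      rwa [hr] at h
    rw [hU, Finset.mem_union] at this
    simp only [Finset.mem_map, Finset.mem_univ, true_and] at this
    rcases this with ⟨p, hp⟩ | ⟨q, hq⟩
    · exact Or.inl ⟨p, ν.injective ((ho p).trans hp)⟩
    · exact Or.inr ⟨q, ν.injective ((hi q).trans hq)⟩

variable {k l p q r n : ℕ}

theorem inner_eq_zero {ι : Insertion k l n} {x : Fin (l + 1)} (h : ι.inner x = 0) : x = 0 := by
  have h0 : ι.inner 0 = ι.inner x := by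
    refine le_antisymm (ι.inner.monotone (Fin.zero_le _)) ?_
    rw [h]; exact Fin.zero_le _
  exact (ι.inner.injective h0).symm

/-- Reassociation to the left. -/
theorem exists_sequential_left (γ : Insertion k q n) (δ : Insertion l r q) :
    ∃ (p : ℕ) (α : Insertion k l p) (β : Insertion p r n), IsSequential α β γ δ := by
  obtain ⟨p, ν, α, ho, hi⟩ := exists_glue γ.outer (δ.outer.trans γ.inner)
    (by
      obtain ⟨i, hi⟩ := γ.graft
      exact ⟨i, by rw [hi]; exact congrArg γ.inner δ.outer_zero.symm⟩)
    (fun x y h => by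
      have h0 := γ.meet _ _ h
      rw [← δ.outer_zero] at h0
      exact δ.outer.injective h0)
  refine ⟨p, α, ⟨ν, δ.inner.trans γ.inner, ?_, ?_, ?_⟩, ⟨ho, hi, fun _ => rfl⟩⟩
  · obtain ⟨i, h⟩ := δ.graft
    exact ⟨α.inner i, (hi i).trans (congrArg γ.inner h)⟩
  · intro x y h
    rcases α.cover x with ⟨z, rfl⟩ | ⟨z, rfl⟩
    · rw [ho] at h
      exact inner_eq_zero (γ.meet _ _ h)
    · rw [hi] at h
      exact δ.meet _ _ (γ.inner.injective h)
  · intro j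
    rcases γ.cover j with ⟨x, rfl⟩ | ⟨x, rfl⟩
    · exact Or.inl ⟨_, ho x⟩
    · rcases δ.cover x with ⟨y, rfl⟩ | ⟨y, rfl⟩
      · exact Or.inl ⟨_, hi y⟩
      · exact Or.inr ⟨y, rfl⟩

/-- Reassociation to the right of a sequential composition. -/
theorem exists_sequential_right (α : Insertion k l p) (β : Insertion p r n)
    (h : ∃ z, α.inner z = β.slot) :
    ∃ (q : ℕ) (γ : Insertion k q n) (δ : Insertion l r q), IsSequential α β γ δ := by
  obtain ⟨z, hz⟩ := h
  obtain ⟨q, ν, δ, ho, hi⟩ := exists_glue (α.inner.trans β.outer) β.inner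
    ⟨z, by rw [← β.outer_slot, ← hz]; rfl⟩ (fun x y h => β.meet _ _ h)
  replace ho : ∀ x, ν (δ.outer x) = β.outer (α.inner x) := ho
  refine ⟨q, ⟨α.outer.trans β.outer, ν, ?_, ?_, ?_⟩, δ,
    ⟨fun _ => rfl, fun x => (ho x).symm, fun x => (hi x).symm⟩⟩
  · obtain ⟨i, h⟩ := α.graft
    refine ⟨i, ?_⟩
    rw [← δ.outer_zero, ho, ← h]
    rfl
  · intro x y h
    replace h : β.outer (α.outer x) = ν y := h
    rw [← δ.outer_zero]
    rcases δ.cover y with ⟨w, rfl⟩ | ⟨w, rfl⟩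
    · rw [ho] at h
      rw [α.meet _ _ (β.outer.injective h)]
    · rw [hi] at h
      obtain rfl := β.meet _ _ h
      rw [← β.outer_slot, ← hz] at h
      obtain rfl := α.meet _ _ (β.outer.injective h)
      refine ν.injective ?_
      rw [hi, ho, hz, β.outer_slot]
  · intro j
    rcases β.cover j with ⟨x, rfl⟩ | ⟨x, rfl⟩
    · rcases α.cover x with ⟨y, rfl⟩ | ⟨y, rfl⟩
      · exact Or.inl ⟨y, rfl⟩
      · exact Or.inr ⟨_, ho y⟩
    · exact Or.inr ⟨_, hi x⟩

/-- Exchange of two parallel compositions. -/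
theorem exists_parallel (α : Insertion k l p) (β : Insertion p r n)
    (h : ∀ z, α.inner z ≠ β.slot) :
    ∃ (q : ℕ) (γ : Insertion k r q) (δ : Insertion q l n), IsParallel α β γ δ := by
  obtain ⟨s, hs⟩ : ∃ s, α.outer s = β.slot := by
    rcases α.cover β.slot with ⟨s, hs⟩ | ⟨s, hs⟩
    · exact ⟨s, hs⟩
    · exact absurd hs (h s)
  obtain ⟨q, ν, γ, ho, hi⟩ := exists_glue (α.outer.trans β.outer) β.inner
    ⟨s, by rw [← β.outer_slot, ← hs]; rfl⟩ (fun x y h => β.meet _ _ h)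
  replace ho : ∀ x, ν (γ.outer x) = β.outer (α.outer x) := ho
  refine ⟨q, γ, ⟨ν, α.inner.trans β.outer, ?_, ?_, ?_⟩,
    ⟨fun x => (ho x).symm, fun _ => rfl, fun x => (hi x).symm, ?_⟩⟩
  · obtain ⟨i, h⟩ := α.graft
    exact ⟨γ.outer i, (ho i).trans (congrArg β.outer h)⟩
  · intro x y hxy
    replace hxy : ν x = β.outer (α.inner y) := hxy
    rcases γ.cover x with ⟨w, rfl⟩ | ⟨w, rfl⟩
    · rw [ho] at hxy
      exact α.meet _ _ (β.outer.injective hxy)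
    · rw [hi] at hxy
      obtain rfl := β.meet _ _ hxy.symm
      rw [← β.outer_slot] at hxy
      exact absurd (β.outer.injective hxy.symm) (h y)
  · intro j
    rcases β.cover j with ⟨x, rfl⟩ | ⟨x, rfl⟩
    · rcases α.cover x with ⟨y, rfl⟩ | ⟨y, rfl⟩
      · exact Or.inl ⟨_, ho y⟩
      · exact Or.inr ⟨y, rfl⟩
    · exact Or.inl ⟨_, hi x⟩
  · intro h0
    exact h 0 (β.outer.injective (β.outer_slot.trans h0).symm)

end Insertion

/-! ### Bimodules annihilated by the kernel of a surjection of operads -/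

section

variable {K : Type u} [Field K] {F P : Operad K}

theorem Operad.Hom.exists_section (π : F.Hom P) (hs : ∀ n, Function.Surjective (π.map n)) (n : ℕ) :
    ∃ σ : P.Op n →ₗ[K] F.Op n, ∀ p, π.map n (σ p) = p := by
  obtain ⟨σ, hσ⟩ := (π.map n).exists_rightInverse_of_surjective (LinearMap.range_eq_top.2 (hs n))
  exact ⟨σ, fun p => LinearMap.congr_fun hσ p⟩

namespace Bimodule

/-- The elements `r ∘ a` and `a ∘ r`, with `r` in the kernel of `π`. -/
def KernelAction (π : F.Hom P) (A : Bimodule F) (n : ℕ) (z : A.Car n) : Prop :=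
  (∃ (k l : ℕ) (ι : Insertion k l n) (r : F.Op k) (a : A.Car l), π.map k r = 0 ∧
    z = A.left ι r a) ∨
  ∃ (k l : ℕ) (ι : Insertion k l n) (a : A.Car k) (r : F.Op l), π.map l r = 0 ∧
    z = A.right ι a r

/-- A bimodule over `F` annihilated by the kernel of a surjection from `F` to `P` is a bimodule
over `P`. -/
theorem exists_descent (π : F.Hom P) (hs : ∀ n, Function.Surjective (π.map n)) (A : Bimodule F)
    (h : ∀ n z, A.KernelAction π n z → z = 0) :
    ∃ (B : Bimodule P) (f : A.Hom (B.restrict π)), ∀ n a, f.map n a = 0 → a = 0 := by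
  choose σ hσ using π.exists_section hs
  have hl : ∀ {k l n : ℕ} (ι : Insertion k l n) (u u' : F.Op k) (a : A.Car l),
      π.map k u = π.map k u' → A.left ι u a = A.left ι u' a := fun ι u u' a e => by
    rw [← sub_eq_zero, ← LinearMap.map_sub₂]
    exact h _ _ (Or.inl ⟨_, _, ι, _, a, by rw [map_sub, e, sub_self], rfl⟩)
  have hr : ∀ {k l n : ℕ} (ι : Insertion k l n) (a : A.Car k) (u u' : F.Op l),
      π.map l u = π.map l u' → A.right ι a u = A.right ι a u' := fun ι a u u' e => by
    rw [← sub_eq_zero, ← map_sub]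
    exact h _ _ (Or.inr ⟨_, _, ι, a, _, by rw [map_sub, e, sub_self], rfl⟩)
  have hc : ∀ {k l n : ℕ} (ι : Insertion k l n) (u : P.Op k) (v : P.Op l),
      π.map n (σ n (P.comp ι u v)) = π.map n (F.comp ι (σ k u) (σ l v)) := fun ι u v => by
    rw [hσ, π.map_comp, hσ, hσ]
  have h1 : π.map 0 (σ 0 P.one) = π.map 0 F.one := by rw [hσ, π.map_one]
  -- The actions of `P` go through a linear section `σ`. It is multiplicative only modulo the kernel
  -- of `π`, which suffices because the kernel acts by zero.
  let B : Bimodule P :=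
    { Car := A.Car
      left := fun ι => (A.left ι).comp (σ _)
      right := fun ι => (A.right ι).compl₂ (σ _)
      one_left := fun ι a => (hl ι _ _ a h1).trans (A.one_left ι a)
      right_one := fun ι a => (hr ι a _ _ h1).trans (A.right_one ι a)
      seq_left_left := fun s u v a => (hl _ _ _ a (hc _ u v)).trans (A.seq_left_left s _ _ a)
      seq_left_right := fun s u a v => A.seq_left_right s _ a _
      seq_right_right := fun s a u v =>
        (A.seq_right_right s a _ _).trans (hr _ a _ _ (hc _ u v)).symm
      par_left_right := fun s u a v =>
        (A.par_left_right s _ a _).trans (hl _ _ _ a (hc _ u v)).symm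
      par_right_right := fun s a u v => A.par_right_right s a _ _ }
  exact ⟨B,
    { map := fun _ => LinearMap.id
      map_left := fun ι v a => hl ι _ _ a (hσ _ _).symm
      map_right := fun ι a v => hr ι a _ _ (hσ _ _).symm }, fun _ _ h => h⟩

/-- A morphism `f` from `A` to a free bimodule over `P` which sends elements `φ y` to generators is
injective modulo the kernel of `F → P` and relations `J` such that morphisms that kill `J` are
determined by their values on the elements `φ y`. -/
theorem mem_gen_of_map_eq_zero (π : F.Hom P) (hs : ∀ n, Function.Surjective (π.map n))
    {A : Bimodule F} {Y : ℕ → Type u} (φ : ∀ n, Y n → A.Car n)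
    (f : A.Hom ((Bimodule.free P Y).restrict π)) (hf : ∀ n y, f.map n (φ n y) = free.of P y)
    (J : ∀ n, A.Car n → Prop) (hJ : ∀ n a, J n a → f.map n a = 0)
    (hext : ∀ {B : Bimodule F} (p q : A.Hom B), (∀ n y, p.map n (φ n y) = q.map n (φ n y)) →
      (∀ n a, J n a → p.map n a = q.map n a) → p = q) {n : ℕ} {a : A.Car n}
    (ha : f.map n a = 0) : a ∈ A.gen (fun m z => J m z ∨ A.KernelAction π m z) n := by
  set R : ∀ n, A.Car n → Prop := fun m z => J m z ∨ A.KernelAction π m z with hR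
  obtain ⟨B, g, hg⟩ := exists_descent π hs (A.quot R) (fun n z hz => by
    rcases hz with ⟨k, l, ι, r, a, hr, rfl⟩ | ⟨k, l, ι, a, r, hr, rfl⟩
    · obtain ⟨a, rfl⟩ := A.quotMk_surjective R l a
      rw [← (A.quotMk R).map_left, quotMk_eq_zero]
      exact Gen.of (Or.inr (Or.inl ⟨k, l, ι, r, a, hr, rfl⟩))
    · obtain ⟨a, rfl⟩ := A.quotMk_surjective R k a
      rw [← (A.quotMk R).map_right, quotMk_eq_zero]
      exact Gen.of (Or.inr (Or.inr ⟨k, l, ι, a, r, hr, rfl⟩)))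
  -- Modulo `R` the bimodule `A` becomes a bimodule over `P`, so the classes of the `φ y` define a
  -- morphism `θ` out of the free one. By `hext`, `θ ∘ f` agrees with the quotient map followed by
  -- the injection `g`; hence the kernel of `f` is contained in the sub-bimodule generated by `R`.
  set θ : (Bimodule.free P Y).Hom B := Bimodule.freeLift B
    (fun m y => g.map m ((A.quotMk R).map m (φ m y))) with hθ
  have e : g.comp (A.quotMk R) = (θ.restrict π).comp f := by
    refine hext _ _ (fun m y => ?_) (fun m z hz => ?_)
    · have h1 : (θ.restrict π).map m (f.map m (φ m y)) =
          g.map m ((A.quotMk R).map m (φ m y)) :=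
        (congrArg (θ.map m) (hf m y)).trans (freeLift_of _ _ y)
      exact h1.symm
    · have h1 : g.map m ((A.quotMk R).map m z) = 0 := by
        rw [quotMk_eq_zero.2 (Gen.of (Or.inl hz)), map_zero]
      have h2 : (θ.restrict π).map m (f.map m z) = 0 := by rw [hJ m z hz, map_zero]
      exact h1.trans h2.symm
  have h1 : g.map n ((A.quotMk R).map n a) = 0 := by
    refine (Hom.congr_map e a).trans ?_
    change (θ.restrict π).map n (f.map n a) = 0
    rw [ha, map_zero]
  exact quotMk_eq_zero.1 (hg n _ h1)

/-- The kernel of `F⟨Y⟩ → P⟨Y⟩` is generated by the action of the kernel of `F → P`. -/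
theorem mem_gen_of_free_map_eq_zero (π : F.Hom P) (hs : ∀ n, Function.Surjective (π.map n))
    {Y : ℕ → Type u} {n : ℕ} {a : (Bimodule.free F Y).Car n}
    (ha : (freeLift ((Bimodule.free P Y).restrict π) (fun _ y => free.of P y)).map n a = 0) :
    a ∈ (Bimodule.free F Y).gen ((Bimodule.free F Y).KernelAction π) n := by
  have h := mem_gen_of_map_eq_zero π hs (fun _ y => free.of F y)
    (freeLift ((Bimodule.free P Y).restrict π) (fun _ y => free.of P y))
    (fun _ y => freeLift_of _ _ y) (fun _ _ => False) (fun _ _ h => h.elim)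
    (fun p q h _ => free_hom_ext h) ha
  simpa only [false_or] using h

end Bimodule

/-! ### Generators of the kernel of the bracket. -/

namespace CellExt

variable {n : ℕ} {S : Cells F n} (E : CellExt S) (π : F.Hom P)
  (hπ : ∀ m a, π.map m (E.freeCells.src₀.map m a) = π.map m (E.freeCells.tgt₀.map m a))

theorem mem_gen_of_bracket_eq_zero (hs : ∀ n, Function.Surjective (π.map n)) {m : ℕ}
    {f : E.freeCells.C.Car m} (hf : (E.bracket π hπ).map m f = 0) :
    f ∈ E.freeCells.C.gen (fun m z => (∃ c, z = E.idc.map m c) ∨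
      E.freeCells.C.KernelAction π m z) m :=
  Bimodule.mem_gen_of_map_eq_zero π hs (fun _ x => E.ofGen x) (E.bracket π hπ)
    (fun _ x => E.bracket_ofGen π hπ x) (fun m z => ∃ c, z = E.idc.map m c)
    (fun m a h => by
      obtain ⟨c, rfl⟩ := h
      exact E.bracket_idc π hπ c)
    (fun p q h h' => E.hom_ext h (fun m c => h' m _ ⟨c, rfl⟩)) hf

end CellExt

/-! ### The exchange relation as a rule for moving boundaries between factors. -/

namespace Cells

variable {n : ℕ} (S : Cells F n)

/-- This is the exchange relation solved for its left actions. It trades the boundary of `b` acting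
on `a` for `b` acted on by the boundary of `a`, at the price of an identity. -/
theorem left_sub {k l m : ℕ} (ι : Insertion k l m) (b : S.C.Car k) (a : S.C.Car l) :
    S.C.left ι (S.src₀.map k b - S.tgt₀.map k b) a =
      S.C.right ι b (S.src₀.map l a - S.tgt₀.map l a) +
        S.idn.map m (F.comp ι (S.src₀.map k b) (S.tgt₀.map l a) -
          F.comp ι (S.tgt₀.map k b) (S.src₀.map l a)) := by
  have h := S.exchange ι b a
  unfold up down at h
  rw [map_sub, map_sub, map_sub, LinearMap.sub_apply, ← sub_eq_zero]
  rw [← sub_eq_zero] at h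
  rw [← neg_eq_zero, ← h]
  abel

theorem right_sub {k l m : ℕ} (ι : Insertion k l m) (a : S.C.Car k) (b : S.C.Car l) :
    S.C.right ι a (S.src₀.map l b - S.tgt₀.map l b) =
      S.C.left ι (S.src₀.map k a - S.tgt₀.map k a) b -
        S.idn.map m (F.comp ι (S.src₀.map k a) (S.tgt₀.map l b) -
          F.comp ι (S.tgt₀.map k a) (S.src₀.map l b)) := by
  rw [S.left_sub ι a b, add_sub_cancel_right]

end Cells

namespace CellExt

variable {n : ℕ} {S : Cells F n} (E : CellExt S)

theorem src₀_idc {m : ℕ} (c : S.C.Car m) :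
    E.freeCells.src₀.map m (E.idc.map m c) = S.src₀.map m c :=
  congrArg (S.src₀.map m) (E.src_idc c)

theorem tgt₀_idc {m : ℕ} (c : S.C.Car m) :
    E.freeCells.tgt₀.map m (E.idc.map m c) = S.tgt₀.map m c :=
  congrArg (S.tgt₀.map m) (E.tgt_idc c)

theorem idn_eq {m : ℕ} (u : F.Op m) : E.freeCells.idn.map m u = E.idc.map m (S.idn.map m u) := rfl

variable (π : F.Hom P)
  (hπ : ∀ m a, π.map m (E.freeCells.src₀.map m a) = π.map m (E.freeCells.tgt₀.map m a))

/-- In dimension at least two, the kernel of the bracket consists of identities. -/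
theorem exists_idc_of_bracket_eq_zero (hs : ∀ n, Function.Surjective (π.map n))
    (hS : ∀ m r, π.map m r = 0 → ∃ b, r = S.src₀.map m b - S.tgt₀.map m b) {m : ℕ}
    {f : E.freeCells.C.Car m} (hf : (E.bracket π hπ).map m f = 0) :
    ∃ c, f = E.idc.map m c := by
  have key : ∀ (m : ℕ) (z : E.freeCells.C.Car m),
      E.freeCells.C.Gen (fun m z => (∃ c, z = E.idc.map m c) ∨
        E.freeCells.C.KernelAction π m z) m z →
      E.freeCells.C.Gen (fun m z => ∃ c, z = E.idc.map m c) m z := by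
    intro m z hz
    induction hz with
    | zero => exact .zero _
    | add _ _ h1 h2 => exact .add h1 h2
    | smul c _ h => exact .smul c h
    | left ι v _ h => exact .left ι v h
    | right ι v _ h => exact .right ι v h
    | of hz =>
      rcases hz with ⟨c, rfl⟩ | ⟨k, l, ι, r, a, hr, rfl⟩ | ⟨k, l, ι, a, r, hr, rfl⟩
      · exact .of ⟨c, rfl⟩
      · obtain ⟨b, rfl⟩ := hS _ r hr
        -- The element of the kernel is written as the boundary of the identity on an `n`-cell `b`.
        -- After exchange, `a` enters only through its boundary, acting on an identity, so the
        -- result is an identity. This is where `n ≥ 1` matters: for `n = 0` boundaries of `n`-cells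
        -- vanish, so `hS` would force the kernel of `π` to be zero.
        rw [← E.src₀_idc, ← E.tgt₀_idc, E.freeCells.left_sub, E.src₀_idc, E.tgt₀_idc, E.idn_eq]
        exact .add (.right ι _ (.of ⟨_, rfl⟩)) (.of ⟨_, rfl⟩)
      · obtain ⟨b, rfl⟩ := hS _ r hr
        rw [← E.src₀_idc, ← E.tgt₀_idc, E.freeCells.right_sub, E.idn_eq, sub_eq_add_neg]
        exact .add (.left ι _ (.of ⟨_, rfl⟩)) (.of ⟨-_, (map_neg _ _).symm⟩)
  exact Bimodule.gen_range E.idc (key m f (E.mem_gen_of_bracket_eq_zero π hπ hs hf))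

end CellExt

namespace Bimodule

/-- The span of the elements `r ∘ a`, with `r` in the kernel of `π`. -/
def kernelSpan (π : F.Hom P) (A : Bimodule F) (n : ℕ) : Submodule K (A.Car n) :=
  Submodule.span K {z | ∃ (k l : ℕ) (ι : Insertion k l n) (r : F.Op k) (a : A.Car l),
    π.map k r = 0 ∧ z = A.left ι r a}

theorem left_mem_kernelSpan {π : F.Hom P} {A : Bimodule F} {k l n : ℕ} (ι : Insertion k l n)
    {r : F.Op k} (hr : π.map k r = 0) (a : A.Car l) : A.left ι r a ∈ A.kernelSpan π n :=
  Submodule.subset_span ⟨k, l, ι, r, a, hr, rfl⟩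

theorem kernelSpan_left {π : F.Hom P} {A : Bimodule F} {k l n : ℕ} (ι : Insertion k l n)
    (v : F.Op k) {a : A.Car l} (ha : a ∈ A.kernelSpan π l) : A.left ι v a ∈ A.kernelSpan π n := by
  induction ha using Submodule.span_induction with
  | mem a h =>
    obtain ⟨k', l', ι', r, a, hr, rfl⟩ := h
    obtain ⟨p, α, β, h⟩ := Insertion.exists_sequential_left ι ι'
    rw [← A.seq_left_left h]
    exact left_mem_kernelSpan β (by rw [π.map_comp, hr, map_zero]) a
  | zero => rw [map_zero]; exact zero_mem _
  | add x y _ _ hx hy => rw [map_add]; exact add_mem hx hy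
  | smul c x _ hx => rw [map_smul]; exact Submodule.smul_mem _ c hx

/-- Either `v` is grafted on a leaf of `a` and is absorbed by `a`, or it is grafted on a leaf of
`r`, and the composite of `r` and `v` is still in the kernel. -/
theorem kernelSpan_right {π : F.Hom P} {A : Bimodule F} {k l n : ℕ} (ι : Insertion k l n)
    {a : A.Car k} (v : F.Op l) (ha : a ∈ A.kernelSpan π k) :
    A.right ι a v ∈ A.kernelSpan π n := by
  induction ha using Submodule.span_induction with
  | mem a h =>
    obtain ⟨k', l', ι', r, a, hr, rfl⟩ := h
    by_cases hz : ∃ z, ι'.inner z = ι.slot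
    · obtain ⟨q, γ, δ, h⟩ := Insertion.exists_sequential_right ι' ι hz
      rw [A.seq_left_right h]
      exact left_mem_kernelSpan γ hr _
    · obtain ⟨q, γ, δ, h⟩ := Insertion.exists_parallel ι' ι (fun z e => hz ⟨z, e⟩)
      rw [A.par_left_right h]
      exact left_mem_kernelSpan δ (by rw [π.map_comp, hr, LinearMap.map_zero₂]) a
  | zero => rw [LinearMap.map_zero₂]; exact zero_mem _
  | add x y _ _ hx hy => rw [LinearMap.map_add₂]; exact add_mem hx hy
  | smul c x _ hx => rw [LinearMap.map_smul₂]; exact Submodule.smul_mem _ c hx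

end Bimodule

namespace CellExt

variable {S : Cells F 0} (E : CellExt S) (π : F.Hom P)
  (hπ : ∀ m a, π.map m (E.freeCells.src₀.map m a) = π.map m (E.freeCells.tgt₀.map m a))

/-- In dimension one, the kernel of the bracket consists of the sums of an identity and of elements
`r ∘ a` with `r` in the kernel of `π`. -/
theorem exists_idc_add_of_bracket_eq_zero (hs : ∀ n, Function.Surjective (π.map n))
    (hE : ∀ m r, π.map m r = 0 →
      ∃ b, r = E.freeCells.src₀.map m b - E.freeCells.tgt₀.map m b) {m : ℕ}
    {f : E.freeCells.C.Car m} (hf : (E.bracket π hπ).map m f = 0) :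
    ∃ c, ∃ z ∈ E.freeCells.C.kernelSpan π m, f = E.idc.map m c + z := by
  have key : ∀ (m : ℕ) (f : E.freeCells.C.Car m),
      E.freeCells.C.Gen (fun m z => (∃ c, z = E.idc.map m c) ∨
        E.freeCells.C.KernelAction π m z) m f →
      ∃ c, ∃ z ∈ E.freeCells.C.kernelSpan π m, f = E.idc.map m c + z := by
    intro m f hf
    induction hf with
    | zero => exact ⟨0, 0, zero_mem _, by simp⟩
    | add _ _ h1 h2 =>
      obtain ⟨c, z, hz, rfl⟩ := h1
      obtain ⟨c', z', hz', rfl⟩ := h2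
      exact ⟨c + c', z + z', add_mem hz hz', by rw [map_add, add_add_add_comm]⟩
    | smul k _ h =>
      obtain ⟨c, z, hz, rfl⟩ := h
      exact ⟨k • c, k • z, Submodule.smul_mem _ k hz, by rw [map_smul, smul_add]⟩
    | left ι v _ h =>
      obtain ⟨c, z, hz, rfl⟩ := h
      exact ⟨_, _, Bimodule.kernelSpan_left ι v hz, by rw [map_add, E.idc.map_left]⟩
    | right ι v _ h =>
      obtain ⟨c, z, hz, rfl⟩ := h
      exact ⟨_, _, Bimodule.kernelSpan_right ι v hz, by rw [LinearMap.map_add₂, E.idc.map_right]⟩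
    | of hz =>
      rcases hz with ⟨c, rfl⟩ | ⟨k, l, ι, r, a, hr, rfl⟩ | ⟨k, l, ι, a, r, hr, rfl⟩
      · exact ⟨c, 0, zero_mem _, (add_zero _).symm⟩
      · exact ⟨0, _, Bimodule.left_mem_kernelSpan ι hr a, by
          rw [map_zero]; exact (zero_add _).symm⟩
      · obtain ⟨b, rfl⟩ := hE _ r hr
        -- In dimension one the element `r` is only the boundary of a `1`-cell `b`. Exchange turns
        -- `a ∘ r` into `(s₀ a - t₀ a) ∘ b` minus an identity, and `s₀ a - t₀ a` is again in the
        -- kernel.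
        refine ⟨-S.idn.map _ (F.comp ι (E.freeCells.src₀.map k a) (E.freeCells.tgt₀.map l b) -
          F.comp ι (E.freeCells.tgt₀.map k a) (E.freeCells.src₀.map l b)),
          _, Bimodule.left_mem_kernelSpan ι (r := E.freeCells.src₀.map k a -
          E.freeCells.tgt₀.map k a) (by rw [map_sub, hπ, sub_self]) b, ?_⟩
        refine (E.freeCells.right_sub ι a b).trans ((sub_eq_neg_add _ _).trans ?_)
        exact congrArg (· + _) (map_neg (E.idc.map _) _).symm
  exact key m f (E.mem_gen_of_bracket_eq_zero π hπ hs hf)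

end CellExt

end

end Shuffle

namespace Shuffle

/-! ### Operations with leaves labelled by natural numbers -/

/-- Increasing lists of labels. -/
abbrev Label := Σ n : ℕ, Fin (n + 1) ↪o ℕ

noncomputable instance : DecidableEq Label := Classical.decEq _

/-- An increasing list is determined by its set of labels. Subsets of ℕ can therefore serve as
degrees, and iterated compositions can be handled without arities or shuffles. -/
theorem Label.ext_range {n m : ℕ} {ν : Fin (n + 1) ↪o ℕ} {μ : Fin (m + 1) ↪o ℕ}
    (h : Set.range ν = Set.range μ) : (⟨n, ν⟩ : Label) = ⟨m, μ⟩ := by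
  have hc : n + 1 = m + 1 := by
    have h1 := Set.ncard_range_of_injective ν.injective
    have h2 := Set.ncard_range_of_injective μ.injective
    rw [h, h2, Nat.card_fin, Nat.card_fin] at h1
    exact h1.symm
  obtain rfl : n = m := Nat.succ_injective hc
  rw [OrderEmbedding.range_eq_iff.1 h]

theorem Label.isLeast {n : ℕ} (ν : Fin (n + 1) ↪o ℕ) : IsLeast (Set.range ν) (ν 0) :=
  ⟨⟨0, rfl⟩, by rintro _ ⟨j, rfl⟩; exact ν.monotone (Fin.zero_le _)⟩

/-- The list with one label. -/
def Label.single (i : ℕ) : Fin (0 + 1) ↪o ℕ :=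
  OrderEmbedding.ofStrictMono (fun _ => i) (fun i j h => by omega)

theorem Label.range_single (i : ℕ) : Set.range (Label.single i) = {i} :=
  Set.range_const

/-- An operation with set of labels `V` may be grafted on the leaf `m` of an operation with set of
labels `U`. -/
structure Fits (U V : Set ℕ) (m : ℕ) : Prop where
  least : IsLeast V m
  mem : m ∈ U
  eq : ∀ x ∈ U, x ∈ V → x = m

theorem Fits.exists_glue {k l m : ℕ} {f : Fin (k + 1) ↪o ℕ} {g : Fin (l + 1) ↪o ℕ}
    (h : Fits (Set.range f) (Set.range g) m) :
    ∃ (n : ℕ) (ν : Fin (n + 1) ↪o ℕ) (ι : Insertion k l n),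
      ι.outer.trans ν = f ∧ ι.inner.trans ν = g := by
  have hm : m = g 0 := h.least.unique (Label.isLeast g)
  obtain ⟨n, ν, ι, ho, hi⟩ := Insertion.exists_glue f g
    (by
      obtain ⟨i, hi⟩ := h.mem
      exact ⟨i, hi.trans hm⟩)
    (fun p q e => g.injective (by
      rw [← hm, ← e]
      exact h.eq _ ⟨p, rfl⟩ ⟨q, e.symm⟩))
  exact ⟨n, ν, ι, DFunLike.ext _ _ ho, DFunLike.ext _ _ hi⟩

namespace Insertion

variable {k l n : ℕ} (ι : Insertion k l n) (ν : Fin (n + 1) ↪o ℕ)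

theorem range_union :
    Set.range (ι.outer.trans ν) ∪ Set.range (ι.inner.trans ν) = Set.range ν := by
  ext x
  constructor
  · rintro (⟨j, rfl⟩ | ⟨j, rfl⟩)
    · exact ⟨_, rfl⟩
    · exact ⟨_, rfl⟩
  · rintro ⟨j, rfl⟩
    rcases ι.cover j with ⟨p, rfl⟩ | ⟨q, rfl⟩
    · exact Or.inl ⟨p, rfl⟩
    · exact Or.inr ⟨q, rfl⟩

theorem fits :
    Fits (Set.range (ι.outer.trans ν)) (Set.range (ι.inner.trans ν)) (ν (ι.inner 0)) where
  least := Label.isLeast (ι.inner.trans ν)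
  mem := ⟨ι.slot, congrArg ν ι.outer_slot⟩
  eq := by
    rintro _ ⟨p, rfl⟩ ⟨q, h⟩
    have h1 := ν.injective h
    have h2 := ι.meet p q h1.symm
    rw [← h, h2]
    rfl

/-- The composite has the union of the two lists as labels, in increasing order, so nothing is left
to choose. This makes the choices in `hcomp` harmless. -/
theorem eq_of_trans {n' : ℕ} {ι' : Insertion k l n'} {ν' : Fin (n' + 1) ↪o ℕ}
    (ho : ι'.outer.trans ν' = ι.outer.trans ν) (hi : ι'.inner.trans ν' = ι.inner.trans ν) :
    (⟨n', ν', ι'⟩ : Σ n, Σ _ : Fin (n + 1) ↪o ℕ, Insertion k l n) = ⟨n, ν, ι⟩ := by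
  have h : (⟨n', ν'⟩ : Label) = ⟨n, ν⟩ := Label.ext_range (by
    rw [← ι'.range_union, ← ι.range_union, ho, hi])
  obtain ⟨rfl, h⟩ := Sigma.mk.inj_iff.1 h
  obtain rfl := eq_of_heq h
  have h1 : ι'.outer = ι.outer :=
    DFunLike.ext _ _ (fun p => ν'.injective (DFunLike.congr_fun ho p))
  have h2 : ι'.inner = ι.inner :=
    DFunLike.ext _ _ (fun p => ν'.injective (DFunLike.congr_fun hi p))
  obtain ⟨o, i, _, _, _⟩ := ι
  obtain ⟨o', i', _, _, _⟩ := ι'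
  obtain rfl : o' = o := h1
  obtain rfl : i' = i := h2
  rfl

end Insertion

section

variable {K : Type u} [Field K]

/-- Linear combinations of operations with labelled leaves. -/
abbrev Hat (G : Operad K) : Type u := DirectSum Label (fun L => G.Op L.1)

variable {G H : Operad K}

/-- Labelling of the leaves of an operation. -/
noncomputable def hat {n : ℕ} (ν : Fin (n + 1) ↪o ℕ) : G.Op n →ₗ[K] Hat G :=
  DirectSum.lof K Label (fun L => G.Op L.1) ⟨n, ν⟩

theorem hat_injective {n : ℕ} (ν : Fin (n + 1) ↪o ℕ) : Function.Injective (hat (G := G) ν) :=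
  DirectSum.of_injective (β := fun L : Label => G.Op L.1) ⟨n, ν⟩

theorem Hat.linearMap_ext {V : Type*} [AddCommGroup V] [Module K V] {f g : Hat G →ₗ[K] V}
    (h : ∀ (n : ℕ) (ν : Fin (n + 1) ↪o ℕ) (a : G.Op n), f (hat ν a) = g (hat ν a)) : f = g :=
  DirectSum.linearMap_ext K (fun L => LinearMap.ext (fun a => h L.1 L.2 a))

/-- The linear extension of a family of linear maps on operations with labelled leaves. -/
noncomputable def Hat.lift {V : Type*} [AddCommGroup V] [Module K V]
    (f : ∀ (n : ℕ) (_ : Fin (n + 1) ↪o ℕ), G.Op n →ₗ[K] V) : Hat G →ₗ[K] V :=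
  DirectSum.toModule K Label V (fun L => f L.1 L.2)

theorem Hat.lift_hat {V : Type*} [AddCommGroup V] [Module K V]
    (f : ∀ (n : ℕ) (_ : Fin (n + 1) ↪o ℕ), G.Op n →ₗ[K] V) {n : ℕ} (ν : Fin (n + 1) ↪o ℕ)
    (a : G.Op n) : Hat.lift f (hat ν a) = f n ν a :=
  DirectSum.toModule_lof K (M := fun L : Label => G.Op L.1) (φ := fun L => f L.1 L.2) ⟨n, ν⟩ a

/-- A family of linear maps, applied to operations with labelled leaves. -/
noncomputable def hatMap (f : ∀ n, G.Op n →ₗ[K] H.Op n) : Hat G →ₗ[K] Hat H :=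
  Hat.lift (fun n ν => (hat ν).comp (f n))

@[simp] theorem hatMap_hat (f : ∀ n, G.Op n →ₗ[K] H.Op n) {n : ℕ} (ν : Fin (n + 1) ↪o ℕ)
    (a : G.Op n) : hatMap f (hat ν a) = hat ν (f n a) := Hat.lift_hat _ _ _

open Classical in
/-- Composition of operations with labelled leaves. -/
noncomputable def hcomp : Hat G →ₗ[K] Hat G →ₗ[K] Hat G :=
  Hat.lift (fun _ f => (Hat.lift (fun _ g =>
    -- Composition is only partially defined. Incompatible sets of labels receive the value zero, so
    -- that `hcomp` is bilinear on the whole direct sum.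
    if h : ∃ m, Fits (Set.range f) (Set.range g) m then
      ((G.comp h.choose_spec.exists_glue.choose_spec.choose_spec.choose).compr₂
        (hat h.choose_spec.exists_glue.choose_spec.choose)).flip
    else 0)).flip)

theorem hcomp_hat {k l n : ℕ} (ι : Insertion k l n) (ν : Fin (n + 1) ↪o ℕ) (a : G.Op k)
    (b : G.Op l) :
    hcomp (hat (ι.outer.trans ν) a) (hat (ι.inner.trans ν) b) = hat ν (G.comp ι a b) := by
  have h : ∃ m, Fits (Set.range (ι.outer.trans ν)) (Set.range (ι.inner.trans ν)) m :=
    ⟨_, ι.fits ν⟩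
  unfold hcomp
  rw [Hat.lift_hat, LinearMap.flip_apply, Hat.lift_hat, dif_pos h]
  have hs := h.choose_spec.exists_glue.choose_spec.choose_spec.choose_spec
  have e := ι.eq_of_trans ν hs.1 hs.2
  exact congrArg (fun t : Σ n, Σ _ : Fin (n + 1) ↪o ℕ, Insertion k l n =>
    hat t.2.1 (G.comp t.2.2 a b)) e

theorem hcomp_hat_of_eq {k l n : ℕ} (ι : Insertion k l n) {ν : Fin (n + 1) ↪o ℕ}
    {f : Fin (k + 1) ↪o ℕ} {g : Fin (l + 1) ↪o ℕ} (hf : ι.outer.trans ν = f)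
    (hg : ι.inner.trans ν = g) (a : G.Op k) (b : G.Op l) :
    hcomp (hat f a) (hat g b) = hat ν (G.comp ι a b) := by
  subst hf hg
  exact hcomp_hat ι ν a b

theorem hcomp_hat_of_not_fits {k l : ℕ} {f : Fin (k + 1) ↪o ℕ} {g : Fin (l + 1) ↪o ℕ}
    (h : ¬ ∃ m, Fits (Set.range f) (Set.range g) m) (a : G.Op k) (b : G.Op l) :
    hcomp (hat f a) (hat g b) = 0 := by
  unfold hcomp
  rw [Hat.lift_hat, LinearMap.flip_apply, Hat.lift_hat, dif_neg h]
  rfl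

theorem hatMap_hcomp (f : G.Hom H) (a b : Hat G) :
    hatMap f.map (hcomp a b) = hcomp (hatMap f.map a) (hatMap f.map b) := by
  have h : (hcomp (G := G)).compr₂ (hatMap f.map) =
      (hcomp.comp (hatMap f.map)).compl₂ (hatMap f.map) := by
    refine Hat.linearMap_ext (fun k ν a => Hat.linearMap_ext (fun l μ b => ?_))
    rw [LinearMap.compr₂_apply, LinearMap.compl₂_apply, LinearMap.comp_apply, hatMap_hat,
      hatMap_hat]
    by_cases h : ∃ m, Fits (Set.range ν) (Set.range μ) m
    · obtain ⟨n, τ, ι, rfl, rfl⟩ := h.choose_spec.exists_glue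
      rw [hcomp_hat, hcomp_hat, hatMap_hat, f.map_comp]
    · rw [hcomp_hat_of_not_fits h, hcomp_hat_of_not_fits h, map_zero]
  exact LinearMap.congr_fun₂ h a b

/-- The unit, with its leaf labelled by `i`. -/
noncomputable def hone (G : Operad K) (i : ℕ) : Hat G := hat (Label.single i) G.one

/-- The operations with set of labels `U`. -/
def homog (G : Operad K) (U : Set ℕ) : Submodule K (Hat G) :=
  Submodule.span K {z | ∃ (n : ℕ) (ν : Fin (n + 1) ↪o ℕ) (a : G.Op n),
    Set.range ν = U ∧ z = hat ν a}

variable {U V W : Set ℕ} {m m' : ℕ} {a b c : Hat G}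

theorem hat_mem {n : ℕ} (ν : Fin (n + 1) ↪o ℕ) (a : G.Op n) : hat ν a ∈ homog G (Set.range ν) :=
  Submodule.subset_span ⟨n, ν, a, rfl, rfl⟩

theorem hat_mem_of_eq {n : ℕ} {ν : Fin (n + 1) ↪o ℕ} (a : G.Op n) (h : Set.range ν = U) :
    hat ν a ∈ homog G U := h ▸ hat_mem ν a

theorem hone_mem (i : ℕ) : hone G i ∈ homog G {i} := hat_mem_of_eq _ (Label.range_single i)

/-- All lists with set of labels `U` coincide, so the homogeneous part is a single summand.
Identities on homogeneous elements reduce to identities on labelled operations. -/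
theorem eq_zero_or_eq_hat (h : a ∈ homog G U) :
    a = 0 ∨ ∃ (n : ℕ) (ν : Fin (n + 1) ↪o ℕ) (x : G.Op n), Set.range ν = U ∧ a = hat ν x := by
  induction h using Submodule.span_induction with
  | mem x h => exact Or.inr h
  | zero => exact Or.inl rfl
  | add x y _ _ hx hy =>
    rcases hx with rfl | ⟨n, ν, x, hν, rfl⟩
    · rwa [zero_add]
    · rcases hy with rfl | ⟨n', ν', y, hν', rfl⟩
      · exact Or.inr ⟨n, ν, x, hν, add_zero _⟩
      · obtain ⟨rfl, h⟩ := Sigma.mk.inj_iff.1 (Label.ext_range (hν.trans hν'.symm))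
        obtain rfl := eq_of_heq h
        exact Or.inr ⟨n, ν, x + y, hν, (map_add _ _ _).symm⟩
  | smul k x _ hx =>
    rcases hx with rfl | ⟨n, ν, x, hν, rfl⟩
    · exact Or.inl (smul_zero _)
    · exact Or.inr ⟨n, ν, k • x, hν, (map_smul _ _ _).symm⟩

theorem exists_eq_hat {n : ℕ} {ν : Fin (n + 1) ↪o ℕ} (h : a ∈ homog G (Set.range ν)) :
    ∃ x, a = hat ν x := by
  rcases eq_zero_or_eq_hat h with rfl | ⟨n', ν', x, hν, rfl⟩
  · exact ⟨0, (map_zero _).symm⟩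
  · obtain ⟨rfl, h⟩ := Sigma.mk.inj_iff.1 (Label.ext_range hν)
    obtain rfl := eq_of_heq h
    exact ⟨x, rfl⟩

theorem hatMap_mem (f : ∀ n, G.Op n →ₗ[K] H.Op n) (h : a ∈ homog G U) :
    hatMap f a ∈ homog H U := by
  rcases eq_zero_or_eq_hat h with rfl | ⟨n, ν, x, rfl, rfl⟩
  · rw [map_zero]; exact zero_mem _
  · rw [hatMap_hat]; exact hat_mem _ _

theorem hcomp_mem (hU : a ∈ homog G U) (hV : b ∈ homog G V) (h : Fits U V m) :
    hcomp a b ∈ homog G (U ∪ V) := by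
  rcases eq_zero_or_eq_hat hU with rfl | ⟨k, f, x, rfl, rfl⟩
  · rw [LinearMap.map_zero₂]; exact zero_mem _
  rcases eq_zero_or_eq_hat hV with rfl | ⟨l, g, y, rfl, rfl⟩
  · rw [map_zero]; exact zero_mem _
  obtain ⟨n, ν, ι, rfl, rfl⟩ := h.exists_glue
  rw [hcomp_hat]
  exact hat_mem_of_eq _ (ι.range_union ν).symm

theorem hone_hcomp (hU : a ∈ homog G U) (h : IsLeast U m) : hcomp (hone G m) a = a := by
  rcases eq_zero_or_eq_hat hU with rfl | ⟨k, f, x, rfl, rfl⟩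
  · rw [map_zero]
  · obtain rfl := h.unique (Label.isLeast f)
    refine (hcomp_hat_of_eq (Insertion.root k) (ν := f) (DFunLike.ext _ _ fun _ => rfl)
      (DFunLike.ext _ _ fun _ => rfl) _ _).trans ?_
    rw [G.one_comp]

theorem hcomp_hone (hU : a ∈ homog G U) (h : m ∈ U) : hcomp a (hone G m) = a := by
  rcases eq_zero_or_eq_hat hU with rfl | ⟨k, f, x, rfl, rfl⟩
  · rw [LinearMap.map_zero₂]
  · obtain ⟨i, rfl⟩ := h
    refine (hcomp_hat_of_eq (Insertion.leaf i) (ν := f) (DFunLike.ext _ _ fun _ => rfl)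
      (DFunLike.ext _ _ fun _ => rfl) _ _).trans ?_
    rw [G.comp_one]

/-- The label `m'` lies in `V`, so `c` is grafted on a leaf of `b` and the two compositions are
sequential. -/
theorem hcomp_seq (ha : a ∈ homog G U) (hb : b ∈ homog G V) (hc : c ∈ homog G W)
    (h : Fits U V m) (h' : Fits V W m') (h'' : Fits (U ∪ V) W m') :
    hcomp (hcomp a b) c = hcomp a (hcomp b c) := by
  rcases eq_zero_or_eq_hat ha with rfl | ⟨k, f, x, rfl, rfl⟩
  · simp only [LinearMap.map_zero₂]
  rcases eq_zero_or_eq_hat hb with rfl | ⟨l, g, y, rfl, rfl⟩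
  · simp only [map_zero, LinearMap.zero_apply]
  rcases eq_zero_or_eq_hat hc with rfl | ⟨r, w, z, rfl, rfl⟩
  · simp only [map_zero]
  obtain ⟨p, μ, α, rfl, rfl⟩ := h.exists_glue
  rw [α.range_union] at h''
  obtain ⟨n, ν, β, rfl, rfl⟩ := h''.exists_glue
  have hm : m' = ν (β.inner 0) := h'.least.unique (Label.isLeast _)
  obtain ⟨j, hj⟩ := h'.mem
  obtain ⟨q, γ, δ, hs⟩ := Insertion.exists_sequential_right α β ⟨j, (β.slot_eq
    (ν.injective (hj.trans hm))).symm⟩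
  rw [hcomp_hat, hcomp_hat, G.comp_seq hs, ← hcomp_hat γ, ← hcomp_hat δ]
  exact congrArg₂ (fun f g => hcomp (hat f x) g) (DFunLike.ext _ _ fun j =>
    congrArg ν (hs.left j).symm) (congrArg₂ (fun f g => hcomp (hat f y) (hat g z))
      (DFunLike.ext _ _ fun j => congrArg ν (hs.middle j).symm)
      (DFunLike.ext _ _ fun j => congrArg ν (hs.right j).symm))

/-- Disjointness of `V` and `W` keeps the graft point of `c` out of `b`, which makes the two
compositions parallel. -/
theorem hcomp_par (ha : a ∈ homog G U) (hb : b ∈ homog G V) (hc : c ∈ homog G W)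
    (h : Fits U V m) (h' : Fits U W m') (hd : Disjoint V W) :
    hcomp (hcomp a b) c = hcomp (hcomp a c) b := by
  rcases eq_zero_or_eq_hat ha with rfl | ⟨k, f, x, rfl, rfl⟩
  · simp only [LinearMap.map_zero₂]
  rcases eq_zero_or_eq_hat hb with rfl | ⟨l, g, y, rfl, rfl⟩
  · simp only [map_zero, LinearMap.zero_apply]
  rcases eq_zero_or_eq_hat hc with rfl | ⟨r, w, z, rfl, rfl⟩
  · simp only [map_zero, LinearMap.zero_apply]
  have h'' : Fits (Set.range f ∪ Set.range g) (Set.range w) m' :=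
    ⟨h'.least, Or.inl h'.mem, fun x hx hw => hx.elim (fun hx => h'.eq x hx hw)
      (fun hx => (Set.disjoint_left.1 hd hx hw).elim)⟩
  obtain ⟨p, μ, α, rfl, rfl⟩ := h.exists_glue
  rw [α.range_union] at h''
  obtain ⟨n, ν, β, rfl, rfl⟩ := h''.exists_glue
  obtain ⟨q, γ, δ, hs⟩ := Insertion.exists_parallel α β (fun j hj =>
    Set.disjoint_left.1 hd ⟨j, rfl⟩ ⟨0, by
      change ν (β.inner 0) = ν (β.outer (α.inner j))
      rw [hj, β.outer_slot]⟩)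
  rw [hcomp_hat, hcomp_hat, G.comp_par hs, ← hcomp_hat δ, ← hcomp_hat γ]
  exact congrArg₂ (fun f g => hcomp f g) (congrArg₂ (fun f g => hcomp (hat f x) (hat g z))
      (DFunLike.ext _ _ fun j => congrArg ν (hs.left j).symm)
      (DFunLike.ext _ _ fun j => congrArg ν (hs.right j).symm))
    (congrArg (fun f => hat f y) (DFunLike.ext _ _ fun j => congrArg ν (hs.middle j).symm))

end

end Shuffle

namespace Shuffle

/-! ### Grafting on all the leaves of an operation -/

/-- The sets `V j` are disjoint, and `L j` is the smallest element of `V j`. -/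
structure Spread {k : ℕ} (L : Fin (k + 1) ↪o ℕ) (V : Fin (k + 1) → Set ℕ) : Prop where
  least : ∀ j, IsLeast (V j) (L j)
  disjoint : ∀ i j, i ≠ j → Disjoint (V i) (V j)

namespace Spread

variable {k : ℕ} {L : Fin (k + 1) ↪o ℕ} {V : Fin (k + 1) → Set ℕ}

/-- The labels after grafting on the leaves in a given list. -/
def labels (L : Fin (k + 1) ↪o ℕ) (V : Fin (k + 1) → Set ℕ) (l : List (Fin (k + 1))) : Set ℕ :=
  Set.range L ∪ ⋃ j ∈ l, V j

theorem labels_subset (h : Spread L V) (l : List (Fin (k + 1))) : labels L V l ⊆ ⋃ j, V j := by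
  rintro x (⟨j, rfl⟩ | hx)
  · exact Set.mem_iUnion.2 ⟨j, (h.least j).1⟩
  · obtain ⟨j, -, hx⟩ := Set.mem_iUnion₂.1 hx
    exact Set.mem_iUnion.2 ⟨j, hx⟩

theorem labels_cons (i : Fin (k + 1)) (l : List (Fin (k + 1))) :
    labels L V (i :: l) = labels L V l ∪ V i := by
  ext x
  simp only [labels, Set.mem_union, Set.mem_iUnion, List.mem_cons, exists_prop]
  constructor
  · rintro (hx | ⟨j, rfl | hj, hx⟩)
    · exact Or.inl (Or.inl hx)
    · exact Or.inr hx
    · exact Or.inl (Or.inr ⟨j, hj, hx⟩)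
  · rintro ((hx | ⟨j, hj, hx⟩) | hx)
    · exact Or.inl hx
    · exact Or.inr ⟨j, Or.inr hj, hx⟩
    · exact Or.inr ⟨i, Or.inl rfl, hx⟩

theorem labels_finRange (h : Spread L V) : labels L V (List.finRange (k + 1)) = ⋃ j, V j :=
  (h.labels_subset _).antisymm (Set.iUnion_subset fun j _ hx =>
    Or.inr (Set.mem_iUnion₂.2 ⟨j, List.mem_finRange j, hx⟩))

theorem notMem (h : Spread L V) {i j : Fin (k + 1)} (hij : i ≠ j) {x : ℕ} (hi : x ∈ V i) : x ∉ V j :=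
  Set.disjoint_left.1 (h.disjoint i j hij) hi

theorem fits (h : Spread L V) {i : Fin (k + 1)} {l : List (Fin (k + 1))} (hi : i ∉ l) :
    Fits (labels L V l) (V i) (L i) where
  least := h.least i
  mem := Or.inl ⟨i, rfl⟩
  eq := by
    rintro x (⟨j, rfl⟩ | hx) hV
    · by_cases hij : j = i
      · rw [hij]
      · exact absurd hV (h.notMem hij (h.least j).1)
    · obtain ⟨j, hj, hx⟩ := Set.mem_iUnion₂.1 hx
      exact absurd hV (h.notMem (fun e : j = i => hi (e ▸ hj)) hx)

theorem fits_of_fits {W : Set ℕ} {m : ℕ} {j : Fin (k + 1)} (hW : Fits (V j) W m)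
    (hd : ∀ i, i ≠ j → Disjoint (V i) W) {U : Set ℕ} (hU : U ⊆ ⋃ j, V j) (hm : m ∈ U) :
    Fits U W m where
  least := hW.least
  mem := hm
  eq := by
    intro x hx hxW
    obtain ⟨i, hi⟩ := Set.mem_iUnion.1 (hU hx)
    by_cases hij : i = j
    · exact hW.eq x (hij ▸ hi) hxW
    · exact absurd hxW (Set.disjoint_left.1 (hd i hij) hi)

theorem update (h : Spread L V) {W : Set ℕ} {j : Fin (k + 1)} (hW : IsLeast W (L j))
    (hd : ∀ i, i ≠ j → Disjoint (V i) W) : Spread L (Function.update V j W) where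
  least := fun i => by
    by_cases hi : i = j
    · subst hi; rwa [Function.update_self]
    · rw [Function.update_of_ne hi]; exact h.least i
  disjoint := fun i i' hi => by
    by_cases h1 : i = j
    · subst h1
      rw [Function.update_self, Function.update_of_ne hi.symm]
      exact (hd i' hi.symm).symm
    · rw [Function.update_of_ne h1]
      by_cases h2 : i' = j
      · subst h2
        rw [Function.update_self]
        exact hd i hi
      · rw [Function.update_of_ne h2]
        exact h.disjoint i i' hi

theorem update_single (h : Spread L V) (j : Fin (k + 1)) : Spread L (Function.update V j {L j}) :=
  h.update isLeast_singleton fun _ hi => Set.disjoint_singleton_right.2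
    (h.notMem (Ne.symm hi) (h.least j).1)

theorem singletons (L : Fin (k + 1) ↪o ℕ) : Spread L (fun j => {L j}) where
  least := fun _ => isLeast_singleton
  disjoint := fun _ _ hij => Set.disjoint_singleton.2 (fun e => hij (L.injective e))

end Spread

section

variable {K : Type u} [Field K] {G H : Operad K}

/-- Grafting on the leaves in a list. -/
noncomputable def graftList {I : Type*} (x : Hat G) (v : I → Hat G) : List I → Hat G
  | [] => x
  | i :: l => hcomp (graftList x v l) (v i)

theorem graftList_congr {I : Type*} (x : Hat G) {v w : I → Hat G} {l : List I}
    (h : ∀ i ∈ l, v i = w i) : graftList x v l = graftList x w l := by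
  induction l with
  | nil => rfl
  | cons i l ih =>
    rw [graftList, graftList, ih fun j hj => h j (List.mem_cons_of_mem i hj), h i List.mem_cons_self]

/-- Grafting on all the leaves. -/
noncomputable def node {k : ℕ} (x : Hat G) (v : Fin (k + 1) → Hat G) : Hat G :=
  graftList x v (List.finRange (k + 1))

theorem hatMap_node (f : G.Hom H) {k : ℕ} (x : Hat G) (v : Fin (k + 1) → Hat G) :
    hatMap f.map (node x v) = node (hatMap f.map x) (fun j => hatMap f.map (v j)) := by
  unfold node
  induction List.finRange (k + 1) with
  | nil => rfl
  | cons i l ih => rw [graftList, graftList, hatMap_hcomp, ih]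

section

variable {k : ℕ} {L : Fin (k + 1) ↪o ℕ} {V : Fin (k + 1) → Set ℕ} {x : Hat G}
  {v : Fin (k + 1) → Hat G}

theorem graftList_mem (h : Spread L V) (hx : x ∈ homog G (Set.range L))
    (hv : ∀ j, v j ∈ homog G (V j)) {l : List (Fin (k + 1))} (hl : l.Nodup) :
    graftList x v l ∈ homog G (Spread.labels L V l) := by
  induction l with
  | nil => simpa [Spread.labels, graftList] using hx
  | cons i l ih =>
    rw [List.nodup_cons] at hl
    rw [Spread.labels_cons, graftList]
    exact hcomp_mem (ih hl.2) (hv i) (h.fits hl.1)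

theorem node_mem (h : Spread L V) (hx : x ∈ homog G (Set.range L))
    (hv : ∀ j, v j ∈ homog G (V j)) : node x v ∈ homog G (⋃ j, V j) := by
  rw [← h.labels_finRange]
  exact graftList_mem h hx hv (List.nodup_finRange _)

/-- The operation `c` commutes with the grafts on leaves other than `j`, by the parallel law, until
it reaches `v j`, where the sequential law absorbs it. -/
theorem graftList_hcomp (h : Spread L V) (hx : x ∈ homog G (Set.range L))
    (hv : ∀ j, v j ∈ homog G (V j)) {l : List (Fin (k + 1))} (hl : l.Nodup) {j : Fin (k + 1)}
    (hj : j ∈ l) {W : Set ℕ} {m : ℕ} {c : Hat G} (hc : c ∈ homog G W) (hW : Fits (V j) W m)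
    (hd : ∀ i, i ≠ j → Disjoint (V i) W) :
    hcomp (graftList x v l) c = graftList x (Function.update v j (hcomp (v j) c)) l := by
  induction l with
  | nil => simp at hj
  | cons i l ih =>
    rw [List.nodup_cons] at hl
    rw [graftList, graftList]
    have hy := graftList_mem h hx hv hl.2
    by_cases hij : i = j
    · subst hij
      rw [Function.update_self, hcomp_seq hy (hv i) hc (h.fits hl.1) hW
        (Spread.fits_of_fits hW hd (by
          rw [← Spread.labels_cons]; exact h.labels_subset _) (Or.inr hW.mem))]
      refine congrArg (fun y => hcomp y (hcomp (v i) c)) (graftList_congr x fun i' hi' => ?_)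
      rw [Function.update_of_ne fun e : i' = i => hl.1 (e ▸ hi')]
    · have hj' : j ∈ l := (List.mem_cons.1 hj).resolve_left (Ne.symm hij)
      rw [Function.update_of_ne hij, ← ih hl.2 hj', hcomp_par hy (hv i) hc (h.fits hl.1)
        (Spread.fits_of_fits hW hd (h.labels_subset _)
          (Or.inr (Set.mem_iUnion₂.2 ⟨j, hj', hW.mem⟩))) (hd i hij)]

theorem node_hcomp (h : Spread L V) (hx : x ∈ homog G (Set.range L))
    (hv : ∀ j, v j ∈ homog G (V j)) {j : Fin (k + 1)} {W : Set ℕ} {m : ℕ} {c : Hat G}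
    (hc : c ∈ homog G W) (hW : Fits (V j) W m) (hd : ∀ i, i ≠ j → Disjoint (V i) W) :
    hcomp (node x v) c = node x (Function.update v j (hcomp (v j) c)) :=
  graftList_hcomp h hx hv (List.nodup_finRange _) (List.mem_finRange j) hc hW hd

/-- Putting the unit at the leaf `j` and grafting `c` afterwards expresses the node as one bilinear
composition. This provides linearity in the subtree at `j`. -/
theorem node_update (h : Spread L V) (hx : x ∈ homog G (Set.range L))
    (hv : ∀ j, v j ∈ homog G (V j)) (j : Fin (k + 1)) {W : Set ℕ} {c : Hat G}
    (hc : c ∈ homog G W) (hW : IsLeast W (L j)) (hd : ∀ i, i ≠ j → Disjoint (V i) W) :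
    node x (Function.update v j c) = hcomp (node x (Function.update v j (hone G (L j)))) c := by
  have hv' : ∀ i, Function.update v j (hone G (L j)) i ∈
      homog G (Function.update V j {L j} i) := fun i => by
    by_cases hi : i = j
    · subst hi; rw [Function.update_self, Function.update_self]; exact hone_mem _
    · rw [Function.update_of_ne hi, Function.update_of_ne hi]; exact hv i
  rw [node_hcomp (j := j) (m := L j) (h.update_single j) hx hv' hc ?_ ?_, Function.update_idem,
    Function.update_self, hone_hcomp hc hW]
  · rw [Function.update_self]
    exact ⟨hW, rfl, fun x hx _ => hx⟩
  · intro i hi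
    rw [Function.update_of_ne hi]
    exact hd i hi

theorem node_hone (hx : x ∈ homog G (Set.range L)) :
    node x (fun j => hone G (L j)) = x := by
  unfold node
  induction List.finRange (k + 1) with
  | nil => rfl
  | cons i l ih => rw [graftList, ih, hcomp_hone hx ⟨i, rfl⟩]

end

/-! ### Labelled trees -/

variable {X : ℕ → Type u}

/-- The labelled tree monomials, built from the root. -/
inductive IsTree (K : Type u) [Field K] (X : ℕ → Type u) : Set ℕ → Hat (freeOperad K X) → Prop
  | one (i : ℕ) : IsTree K X {i} (hone _ i)
  | node {k : ℕ} (x : X k) (L : Fin (k + 1) ↪o ℕ) (V : Fin (k + 1) → Set ℕ)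
      (v : Fin (k + 1) → Hat (freeOperad K X)) (h : Spread L V)
      (hv : ∀ j, IsTree K X (V j) (v j)) :
      IsTree K X (⋃ j, V j) (node (hat L (freeOperad.of K x)) v)

theorem IsTree.mem {U : Set ℕ} {t : Hat (freeOperad K X)} (h : IsTree K X U t) :
    t ∈ homog _ U := by
  induction h with
  | one i => exact hone_mem i
  | node x L V v h _ ih => exact node_mem h (hat_mem _ _) ih

/-- The label `m` lies in exactly one of the subtrees of the root; grafting takes place inside it,
and the description from the root persists. -/
theorem IsTree.hcomp {U W : Set ℕ} {t c : Hat (freeOperad K X)} {m : ℕ} (h : IsTree K X U t)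
    (hc : IsTree K X W c) (hW : Fits U W m) : IsTree K X (U ∪ W) (hcomp t c) := by
  induction h with
  | one i =>
    have hm : m = i := hW.mem
    subst hm
    rw [hone_hcomp hc.mem hW.least, Set.singleton_union, Set.insert_eq_of_mem hW.least.1]
    exact hc
  | node x L V v h hv ih =>
    obtain ⟨j, hj⟩ := Set.mem_iUnion.1 hW.mem
    have hW' : Fits (V j) W m :=
      ⟨hW.least, hj, fun x hx hx' => hW.eq x (Set.mem_iUnion.2 ⟨j, hx⟩) hx'⟩
    have hd : ∀ i, i ≠ j → Disjoint (V i) W := fun i hi => Set.disjoint_left.2 fun x hx hx' => by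
      obtain rfl := hW.eq x (Set.mem_iUnion.2 ⟨i, hx⟩) hx'
      exact h.notMem hi hx hj
    rw [node_hcomp h (hat_mem _ _) (fun j => (hv j).mem) hc.mem hW' hd]
    have hs : Spread L (Function.update V j (V j ∪ W)) := h.update
      ⟨Or.inl (h.least j).1, fun x hx => hx.elim (fun hx => (h.least j).2 hx)
        (fun hx => ((h.least j).2 hj).trans (hW.least.2 hx))⟩
      (fun i hi => Set.disjoint_union_right.2 ⟨h.disjoint i j hi, hd i hi⟩)
    have hU : (⋃ i, V i) ∪ W = ⋃ i, Function.update V j (V j ∪ W) i := by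
      ext x
      simp only [Set.mem_union, Set.mem_iUnion]
      constructor
      · rintro (⟨i, hx⟩ | hx)
        · by_cases hi : i = j
          · exact ⟨j, by rw [Function.update_self]; exact Or.inl (hi ▸ hx)⟩
          · exact ⟨i, by rwa [Function.update_of_ne hi]⟩
        · exact ⟨j, by rw [Function.update_self]; exact Or.inr hx⟩
      · rintro ⟨i, hx⟩
        by_cases hi : i = j
        · subst hi
          rw [Function.update_self] at hx
          exact hx.imp (fun hx => ⟨i, hx⟩) id
        · rw [Function.update_of_ne hi] at hx
          exact Or.inl ⟨i, hx⟩
    rw [hU]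
    refine .node x L _ _ hs (fun i => ?_)
    by_cases hi : i = j
    · subst hi
      rw [Function.update_self, Function.update_self]
      exact ih i hW'
    · rw [Function.update_of_ne hi, Function.update_of_ne hi]
      exact hv i

/-- Formal composites come with arbitrary bracketings. Closure of trees under grafting brings each
of them into the form built from the root, on which recursion is possible. -/
theorem isTree_mono {n : ℕ} (w : Word X n) (ν : Fin (n + 1) ↪o ℕ) :
    IsTree K X (Set.range ν) (hat ν (mono K w)) := by
  induction w with
  | gen x =>
    have h := IsTree.node (K := K) x ν _ _ (Spread.singletons ν) (fun j => .one (ν j))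
    rw [node_hone (hat_mem _ _), Set.iUnion_singleton_eq_range] at h
    exact h
  | one =>
    have h : ν = Label.single (ν 0) := by
      ext j
      obtain rfl : j = 0 := Subsingleton.elim (α := Fin 1) _ _
      rfl
    rw [h, Label.range_single]
    exact .one _
  | comp ι a b iha ihb =>
    rw [mono_comp, ← hcomp_hat, ← ι.range_union]
    exact (iha _).hcomp (ihb _) (ι.fits ν)

theorem homog_le_span_isTree (U : Set ℕ) :
    homog (freeOperad K X) U ≤ Submodule.span K {t | IsTree K X U t} := by
  refine Submodule.span_le.2 ?_
  rintro _ ⟨n, ν, a, rfl, rfl⟩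
  change a ∈ (Submodule.span K {t | IsTree K X (Set.range ν) t}).comap (hat ν)
  induction a using Finsupp.induction_linear with
  | zero => exact zero_mem _
  | add a b ha hb => exact add_mem ha hb
  | single t c =>
    induction t using Quot.ind with
    | mk w =>
      have e : (Finsupp.single (Quot.mk _ w) c : (freeOperad K X).Op n) = c • mono K w :=
        (Finsupp.smul_single_one _ _).symm
      rw [e]
      exact Submodule.smul_mem _ c (Submodule.subset_span (isTree_mono w ν))

/-! ### Recursion on labelled trees -/

/-- The data of a recursion on trees: generators are evaluated by `gen`, the values on the subtrees
are grafted on it, and the result is transformed by `op`. -/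
structure TreeRec (X : ℕ → Type u) (G : Operad K) where
  gen : ∀ {k : ℕ}, X k → G.Op k
  op : ∀ {k : ℕ}, X k → ∀ n, G.Op n →ₗ[K] G.Op n
  unit : G.Op 0

namespace TreeRec

variable (T : TreeRec X G)

open Classical in
/-- A step of the recursion; the first components are the smallest labels. -/
noncomputable def step {k : ℕ} (x : X k) (z : Fin (k + 1) → ℕ × Hat G) : ℕ × Hat G :=
  ((z 0).1, hatMap (T.op x) (node
    -- Each value carries its smallest label, from which the labels of the root vertex are
    -- reconstructed. On a formal composite the step must accept any values, so families with labels
    -- in the wrong order get the default zero; by `step_eq` this does not occur on actual trees.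
    (if h : StrictMono (fun j => (z j).1) then hat (OrderEmbedding.ofStrictMono _ h) (T.gen x)
      else 0) (fun j => (z j).2)))

theorem step_eq {k : ℕ} (x : X k) (L : Fin (k + 1) ↪o ℕ) (z : Fin (k + 1) → ℕ × Hat G)
    (hz : ∀ j, (z j).1 = L j) :
    T.step x z = (L 0, hatMap (T.op x) (node (hat L (T.gen x)) (fun j => (z j).2))) := by
  have h : StrictMono (fun j => (z j).1) := by
    simp only [hz]
    exact L.strictMono
  have e : OrderEmbedding.ofStrictMono _ h = L := DFunLike.ext _ _ hz
  rw [step, dif_pos h, e, hz]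

/-- Evaluation of a formal composite, given the values at its leaves. -/
noncomputable def eval : ∀ {n : ℕ}, Word X n → (Fin (n + 1) → ℕ × Hat G) → ℕ × Hat G
  | _, .gen x, e => T.step x e
  | _, .one, e => e 0
  | _, .comp ι a b, e => eval a (fun p => if p = ι.slot then eval b (fun q => e (ι.inner q))
      else e (ι.outer p))

/-- Evaluation of a composite is substitution into the values at the leaves, so the unit and
associativity laws become equalities of substitutions. No law of `G` and no property of the step
enters. -/
theorem eval_rel {n : ℕ} {a b : Word X n} (h : Word.Rel X a b) : T.eval a = T.eval b := by
  induction h with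
  | refl => rfl
  | symm _ h => exact h.symm
  | trans _ _ h h' => exact h.trans h'
  | comp ι _ _ iha ihb =>
    funext e
    rw [eval, eval, iha, ihb]
  | one_comp ι a =>
    funext e
    have h0 : (0 : Fin 1) = ι.slot := Subsingleton.elim _ _
    rw [eval, eval, if_pos h0]
    exact congrArg (T.eval a) (funext fun q => congrArg e (ι.inner_self q))
  | comp_one ι a =>
    funext e
    rw [eval]
    refine congrArg (T.eval a) (funext fun p => ?_)
    split_ifs with h
    · rw [eval, ← ι.outer_slot, ← h, ι.outer_self]
    · rw [ι.outer_self]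
  | @comp_seq k l p r n q α β γ δ h a b c =>
    funext e
    rw [eval, eval, eval]
    refine congrArg (T.eval a) (funext fun x => ?_)
    rw [h.slot_left]
    split_ifs with hx h1
    · rw [eval]
      refine congrArg (T.eval b) (funext fun y => ?_)
      have e1 : α.inner y = β.slot ↔ y = δ.slot := by
        rw [h.slot_right]; exact α.inner.injective.eq_iff
      simp only [e1, ← h.middle, ← h.right]
    · refine absurd ?_ hx
      rw [h.slot_right] at h1
      have h2 := α.meet _ _ h1
      exact (α.slot_eq (by rw [h1, h2])).symm
    · rw [h.left]
  | @comp_par k l p r n q α β γ δ h a b c =>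
    funext e
    rw [eval, eval, eval, eval]
    refine congrArg (T.eval a) (funext fun x => ?_)
    have e1 : α.outer x = β.slot ↔ x = γ.slot := by
      rw [h.slot_left]; exact α.outer.injective.eq_iff
    have e2 : γ.outer x = δ.slot ↔ x = α.slot := by
      rw [h.symm.slot_left]; exact γ.outer.injective.eq_iff
    have hne : α.slot ≠ γ.slot := fun hs => h.ne (by
      rw [← β.outer_slot, ← δ.outer_slot, h.slot_left, h.symm.slot_left, h.left, hs])
    have e3 : ∀ y, α.inner y ≠ β.slot := fun y hy => by
      rw [h.slot_left] at hy
      obtain rfl := α.meet _ _ hy.symm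
      exact hne (α.slot_eq hy.symm)
    have e4 : ∀ y, γ.inner y ≠ δ.slot := fun y hy => by
      rw [h.symm.slot_left] at hy
      obtain rfl := γ.meet _ _ hy.symm
      exact hne (γ.slot_eq hy.symm).symm
    simp only [e1, e2, e3, e4, if_false, h.left, h.middle, h.right]
    by_cases h1 : x = α.slot
    · rw [if_pos h1, if_neg fun h2 => hne (h1.symm.trans h2), if_pos h1]
    · rw [if_neg h1, if_neg h1]

theorem eval_fst {n : ℕ} (w : Word X n) (e : Fin (n + 1) → ℕ × Hat G) :
    (T.eval w e).1 = (e 0).1 := by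
  induction w with
  | gen x => rfl
  | one => rfl
  | comp ι a b iha ihb =>
    rw [eval, iha]
    split_ifs with h
    · rw [ihb, ← ι.outer_slot, ← h, ι.outer_zero]
    · rw [ι.outer_zero]

/-- The value at a leaf. -/
noncomputable def env (i : ℕ) : ℕ × Hat G := (i, hat (Label.single i) T.unit)

/-- The linear map on labelled trees defined by the recursion. -/
noncomputable def map : Hat (freeOperad K X) →ₗ[K] Hat G :=
  Hat.lift (fun _ ν => Finsupp.linearCombination K
    (Quot.lift (fun w => (T.eval w (fun j => T.env (ν j))).2)
      (fun _ _ h => by rw [T.eval_rel h])))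

theorem map_mono {n : ℕ} (ν : Fin (n + 1) ↪o ℕ) (w : Word X n) :
    T.map (hat ν (mono K w)) = (T.eval w (fun j => T.env (ν j))).2 := by
  refine (Hat.lift_hat _ _ _).trans ?_
  refine (Finsupp.linearCombination_single K _ _).trans ?_
  exact one_smul K _

theorem map_hone (i : ℕ) : T.map (hone _ i) = hat (Label.single i) T.unit :=
  T.map_mono (Label.single i) .one

/-- A partially grafted node is realised by a formal composite, whose evaluation is a single step in
which the leaves not yet grafted read their own labels. The values `e` are arbitrary because the
induction changes them. -/
theorem exists_word {k : ℕ} (x : X k) {L : Fin (k + 1) ↪o ℕ} {V : Fin (k + 1) → Set ℕ}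
    (h : Spread L V) {N : Fin (k + 1) → ℕ} (ν : ∀ j, Fin (N j + 1) ↪o ℕ)
    (hν : ∀ j, Set.range (ν j) = V j) (w : ∀ j, Word X (N j)) {l : List (Fin (k + 1))}
    (hl : l.Nodup) : ∃ (n : ℕ) (μ : Fin (n + 1) ↪o ℕ) (W : Word X n),
      Set.range μ = Spread.labels L V l ∧
      graftList (hat L (freeOperad.of K x)) (fun j => hat (ν j) (mono K (w j))) l =
        hat μ (mono K W) ∧
      ∀ e : ℕ → ℕ × Hat G, T.eval W (fun p => e (μ p)) =
        T.step x (fun j => if j ∈ l then T.eval (w j) (fun p => e (ν j p)) else e (L j)) := by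
  induction l with
  | nil =>
    refine ⟨k, L, .gen x, ?_, rfl, fun e => ?_⟩
    · simp [Spread.labels]
    · rw [eval]
      simp
  | cons i l ih =>
    rw [List.nodup_cons] at hl
    obtain ⟨n, μ, W, hμ, hW, he⟩ := ih hl.2
    have hf := h.fits hl.1
    rw [← hμ, ← hν] at hf
    obtain ⟨n', μ', ι, rfl, hi⟩ := hf.exists_glue
    have hm : L i = μ' (ι.inner 0) := hf.least.unique (hi ▸ Label.isLeast (ι.inner.trans μ'))
    refine ⟨n', μ', .comp ι W (w i), ?_, ?_, fun e => ?_⟩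
    · rw [Spread.labels_cons, ← hμ, ← hν, ← ι.range_union, hi]
    · rw [graftList, hW, ← hi, hcomp_hat, mono_comp]
    -- Grafting `w i` amounts to replacing the value at the label `L i` by the value of `w i`. Other
    -- subtrees do not contain this label, so the change does not affect them.
    · have he' := he (Function.update e (L i) (T.eval (w i) (fun p => e (ν i p))))
      rw [eval]
      refine Eq.trans (congrArg (T.eval W) (funext fun p => ?_)) (he'.trans
        (congrArg (T.step x) (funext fun j => ?_)))
      · by_cases hp : p = ι.slot
        · rw [if_pos hp, hp]
          have h1 : (ι.outer.trans μ') ι.slot = L i := (congrArg μ' ι.outer_slot).trans hm.symm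
          rw [h1, Function.update_self, ← hi]
          rfl
        · rw [if_neg hp]
          have h1 : (ι.outer.trans μ') p ≠ L i := fun h1 =>
            hp (ι.slot_eq (μ'.injective (h1.trans hm))).symm
          rw [Function.update_of_ne h1]
          rfl
      · by_cases hj : j = i
        · subst hj
          rw [if_neg hl.1, if_pos List.mem_cons_self, Function.update_self]
        · by_cases hjl : j ∈ l
          · rw [if_pos hjl, if_pos (List.mem_cons_of_mem i hjl)]
            refine congrArg (T.eval (w j)) (funext fun p => ?_)
            rw [Function.update_of_ne]
            intro h1
            have h2 : ν j p ∈ V j := hν j ▸ ⟨p, rfl⟩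
            exact h.notMem hj h2 (h1 ▸ (h.least i).1)
          · rw [if_neg hjl, if_neg fun h1 => (List.mem_cons.1 h1).elim hj hjl,
              Function.update_of_ne fun h1 => hj (L.injective h1)]

end TreeRec

/-- The recursion that does nothing. -/
def TreeRec.trivial (X : ℕ → Type u) (G : Operad K) : TreeRec X G where
  gen := fun _ => 0
  op := fun _ _ => 0
  unit := 0

theorem IsTree.exists_word {U : Set ℕ} {t : Hat (freeOperad K X)} (h : IsTree K X U t) :
    ∃ (n : ℕ) (ν : Fin (n + 1) ↪o ℕ) (w : Word X n), Set.range ν = U ∧ t = hat ν (mono K w) := by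
  induction h with
  | one i => exact ⟨0, Label.single i, .one, Label.range_single i, rfl⟩
  | node x L V v h _ ih =>
    choose N ν w hν hw using ih
    -- Only the formal composite is wanted here, and it may be obtained from any recursion.
    obtain ⟨n, μ, W, hμ, hW, -⟩ := (TreeRec.trivial X (freeOperad K X)).exists_word x h ν hν w
      (List.nodup_finRange _)
    refine ⟨n, μ, W, hμ.trans h.labels_finRange, Eq.trans ?_ hW⟩
    rw [funext hw]
    rfl

namespace TreeRec

variable (T : TreeRec X G)

/-- The recursion equation from the root: the map was defined through formal composites to make it
well defined on classes, and here the intended description is recovered. -/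
theorem map_node {k : ℕ} (x : X k) {L : Fin (k + 1) ↪o ℕ} {V : Fin (k + 1) → Set ℕ}
    {v : Fin (k + 1) → Hat (freeOperad K X)} (h : Spread L V) (hv : ∀ j, IsTree K X (V j) (v j)) :
    T.map (node (hat L (freeOperad.of K x)) v) =
      hatMap (T.op x) (node (hat L (T.gen x)) (fun j => T.map (v j))) := by
  choose N ν w hν hw using fun j => (hv j).exists_word
  obtain ⟨n, μ, W, -, hW, he⟩ := T.exists_word x h ν hν w (List.nodup_finRange _)
  obtain rfl : v = fun j => hat (ν j) (mono K (w j)) := funext hw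
  refine (congrArg T.map hW).trans ?_
  rw [T.map_mono, he, T.step_eq x L]
  · simp only [List.mem_finRange, if_true, T.map_mono]
  · intro j
    rw [if_pos (List.mem_finRange j), T.eval_fst]
    exact ((hν j) ▸ Label.isLeast (ν j)).unique (h.least j)

theorem map_mem {U : Set ℕ} {a : Hat (freeOperad K X)} (ha : a ∈ homog _ U) :
    T.map a ∈ homog G U := by
  have key : ∀ {U : Set ℕ} {t : Hat (freeOperad K X)}, IsTree K X U t → T.map t ∈ homog G U := by
    intro U t h
    induction h with
    | one i =>
      rw [T.map_hone]
      exact hat_mem_of_eq _ (Label.range_single i)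
    | node x L V v h hv ih =>
      rw [T.map_node x h hv]
      exact hatMap_mem _ (node_mem h (hat_mem _ _) ih)
  have h := homog_le_span_isTree U ha
  clear ha
  induction h using Submodule.span_induction with
  | mem t h => exact key h
  | zero => rw [map_zero]; exact zero_mem _
  | add x y _ _ hx hy => rw [map_add]; exact add_mem hx hy
  | smul c x _ hx => rw [map_smul]; exact Submodule.smul_mem _ c hx

/-- Recursion with a linear combination of trees at one leaf. -/
theorem map_node_update {k : ℕ} (x : X k) {L : Fin (k + 1) ↪o ℕ} {V : Fin (k + 1) → Set ℕ}
    {v : Fin (k + 1) → Hat (freeOperad K X)} (h : Spread L V) (hv : ∀ j, IsTree K X (V j) (v j))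
    (j : Fin (k + 1)) {W : Set ℕ} {c : Hat (freeOperad K X)} (hc : c ∈ homog _ W)
    (hW : IsLeast W (L j)) (hd : ∀ i, i ≠ j → Disjoint (V i) W) :
    T.map (node (hat L (freeOperad.of K x)) (Function.update v j c)) =
      hatMap (T.op x) (node (hat L (T.gen x)) (Function.update (fun j => T.map (v j)) j
        (T.map c))) := by
  have hT : ∀ i, T.map (v i) ∈ homog G (V i) := fun i => T.map_mem (hv i).mem
  -- Both sides are rewritten as compositions with `c` at one leaf. They are then linear in `c`,
  -- which may be taken to be a tree.
  rw [node_update h (hat_mem _ _) (fun j => (hv j).mem) j hc hW hd,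
    node_update h (hat_mem _ _) hT j (T.map_mem hc) hW hd]
  have hs := homog_le_span_isTree W hc
  clear hc
  induction hs using Submodule.span_induction with
  | mem t ht =>
    rw [← node_update h (hat_mem _ _) (fun j => (hv j).mem) j ht.mem hW hd,
      ← node_update h (hat_mem _ _) hT j (T.map_mem ht.mem) hW hd, T.map_node x (h.update hW hd)]
    · congr 2
      funext i
      by_cases hi : i = j
      · subst hi; rw [Function.update_self, Function.update_self]
      · rw [Function.update_of_ne hi, Function.update_of_ne hi]
    · intro i
      by_cases hi : i = j
      · subst hi; rw [Function.update_self, Function.update_self]; exact ht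
      · rw [Function.update_of_ne hi, Function.update_of_ne hi]; exact hv i
  | zero => simp only [map_zero]
  | add x y _ _ hx hy => simp only [map_add, hx, hy]
  | smul c x _ hx => simp only [map_smul, hx]

end TreeRec

end

end Shuffle

namespace Shuffle

section

variable {K : Type u} [Field K]

/-- A linear map factors through any linear map whose range contains its range. -/
theorem _root_.LinearMap.exists_comp_eq {V W C : Type*} [AddCommGroup V] [Module K V]
    [AddCommGroup W] [Module K W] [AddCommGroup C] [Module K C] (f : V →ₗ[K] W) (g : C →ₗ[K] W)
    (h : ∀ v, ∃ c, g c = f v) : ∃ l : V →ₗ[K] C, ∀ v, g (l v) = f v := by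
  obtain ⟨ρ, hρ⟩ := g.rangeRestrict.exists_rightInverse_of_surjective g.range_rangeRestrict
  refine ⟨ρ.comp (f.codRestrict (LinearMap.range g) h), fun v => ?_⟩
  exact congrArg Subtype.val (LinearMap.congr_fun hρ (f.codRestrict (LinearMap.range g) h v))

theorem hatMap_hone {G H : Operad K} (f : G.Hom H) (i : ℕ) :
    hatMap f.map (hone G i) = hone H i := by
  rw [hone, hatMap_hat, f.map_one, hone]

theorem Hat.ext_isTree {X : ℕ → Type u} {V : Type*} [AddCommGroup V] [Module K V]
    {f g : Hat (freeOperad K X) →ₗ[K] V} (h : ∀ U t, IsTree K X U t → f t = g t) : f = g :=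
  Hat.linearMap_ext fun _ ν a => LinearMap.congr_fun (freeOperad.linearMap_ext
    (f := f.comp (hat ν)) (g := g.comp (hat ν)) fun w => h _ _ (isTree_mono w ν)) a

/-! ### The operad of cells -/

namespace Cells

variable {F P : Operad K} {n : ℕ} (S : Cells F n)

/-- The composition `μ↑` of cells, as a bilinear map. -/
noncomputable def upComp {k l m : ℕ} (ι : Insertion k l m) :
    S.C.Car k →ₗ[K] S.C.Car l →ₗ[K] S.C.Car m :=
  (S.C.right ι).compl₂ (S.src₀.map l) + (S.C.left ι).comp (S.tgt₀.map k) -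
    (((F.comp ι).comp (S.tgt₀.map k)).compl₂ (S.src₀.map l)).compr₂ (S.idn.map m)

theorem upComp_apply {k l m : ℕ} (ι : Insertion k l m) (a : S.C.Car k) (b : S.C.Car l) :
    S.upComp ι a b = S.C.right ι a (S.src₀.map l b) + S.C.left ι (S.tgt₀.map k a) b -
      S.idn.map m (F.comp ι (S.tgt₀.map k a) (S.src₀.map l b)) := rfl

theorem src₀_upComp {k l m : ℕ} (ι : Insertion k l m) (a : S.C.Car k) (b : S.C.Car l) :
    S.src₀.map m (S.upComp ι a b) = F.comp ι (S.src₀.map k a) (S.src₀.map l b) := by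
  rw [upComp_apply, map_sub, map_add, S.src₀.map_right, S.src₀.map_left, S.src₀_idn,
    add_sub_cancel_right]

theorem tgt₀_upComp {k l m : ℕ} (ι : Insertion k l m) (a : S.C.Car k) (b : S.C.Car l) :
    S.tgt₀.map m (S.upComp ι a b) = F.comp ι (S.tgt₀.map k a) (S.tgt₀.map l b) := by
  rw [upComp_apply, map_sub, map_add, S.tgt₀.map_right, S.tgt₀.map_left, S.tgt₀_idn,
    add_sub_cancel_left]

theorem upComp_idn_left {k l m : ℕ} (ι : Insertion k l m) (u : F.Op k) (b : S.C.Car l) :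
    S.upComp ι (S.idn.map k u) b = S.C.left ι u b := by
  have h := S.idn.map_right ι u (S.src₀.map l b)
  rw [upComp_apply, S.tgt₀_idn, ← h]
  exact add_sub_cancel_left _ _

theorem upComp_idn_right {k l m : ℕ} (ι : Insertion k l m) (a : S.C.Car k) (v : F.Op l) :
    S.upComp ι a (S.idn.map l v) = S.C.right ι a v := by
  have h := S.idn.map_left ι (S.tgt₀.map k a) v
  rw [upComp_apply, S.src₀_idn, ← h]
  exact add_sub_cancel_right _ _

theorem upComp_eq {k l m : ℕ} (ι : Insertion k l m) (a : S.C.Car k) (b : S.C.Car l) :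
    S.upComp ι a b = S.C.left ι (S.src₀.map k a) b + S.C.right ι a (S.tgt₀.map l b) -
      S.idn.map m (F.comp ι (S.src₀.map k a) (S.tgt₀.map l b)) := S.exchange ι a b

/-- The operad of cells, with composition `μ↑`. -/
noncomputable def operad : Operad K where
  Op := S.C.Car
  one := S.idn.map 0 F.one
  comp := S.upComp
  one_comp := fun ι a => by rw [upComp_idn_left, S.C.one_left]
  comp_one := fun ι a => by rw [upComp_idn_right, S.C.right_one]
  comp_seq := fun {k l p r n q α β γ δ} h a b c => by
    have h1 := S.idn.map_right β (F.comp α (S.tgt₀.map k a) (S.src₀.map l b)) (S.src₀.map r c)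
    have h2 := S.idn.map_left γ (S.tgt₀.map k a) (F.comp δ (S.tgt₀.map l b) (S.src₀.map r c))
    rw [S.upComp_apply β, S.upComp_apply γ, src₀_upComp, tgt₀_upComp, S.upComp_apply α,
      S.upComp_apply δ, map_sub (S.C.right β), map_add (S.C.right β), LinearMap.sub_apply,
      LinearMap.add_apply, map_sub (S.C.left γ _), map_add (S.C.left γ _),
      S.C.seq_right_right h, S.C.seq_left_right h, S.C.seq_left_left h, ← h1, ← h2]
    change _ + _ - S.idn.map n (F.comp β _ _) + _ - _ =
      _ + (_ + _ - S.idn.map n (F.comp γ _ _)) - _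
    rw [F.comp_seq h, F.comp_seq h]
    abel
  comp_par := fun {k l p r n q α β γ δ} h a b c => by
    have h1 := S.idn.map_right β (F.comp α (S.tgt₀.map k a) (S.src₀.map l b)) (S.src₀.map r c)
    have h2 := S.idn.map_right δ (F.comp γ (S.tgt₀.map k a) (S.src₀.map r c)) (S.src₀.map l b)
    -- The parallel law for `μ↑` is not formal. Once the common terms are removed, interchanging `b`
    -- and `c` amounts to the exchange relation between `t₀(a) ∘ b` and `c`.
    have e := S.exchange β (S.C.left α (S.tgt₀.map k a) b) c
    unfold up down at e
    rw [S.src₀.map_left, S.tgt₀.map_left, S.C.par_left_right h, S.C.par_left_right h] at e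
    rw [S.upComp_apply β, S.upComp_apply δ, tgt₀_upComp, tgt₀_upComp, S.upComp_apply α,
      S.upComp_apply γ, map_sub (S.C.right β), map_add (S.C.right β), LinearMap.sub_apply,
      LinearMap.add_apply, map_sub (S.C.right δ), map_add (S.C.right δ), LinearMap.sub_apply,
      LinearMap.add_apply, S.C.par_right_right h, S.C.par_left_right h,
      S.C.par_left_right h.symm, ← h1, ← h2]
    change _ + _ - S.idn.map n (F.comp β _ _) + _ - _ =
      _ + _ - S.idn.map n (F.comp δ _ _) + _ - _
    change _ + S.C.left β (F.comp α _ _) c - S.idn.map n (F.comp β (F.comp α _ _) _) =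
      S.C.left β (F.comp α _ _) c + _ - S.idn.map n (F.comp β (F.comp α _ _) _) at e
    rw [F.comp_par h, F.comp_par h] at e
    rw [F.comp_par h, F.comp_par h]
    rw [sub_eq_sub_iff_add_eq_add] at e ⊢
    have e' := congrArg (S.C.right δ (S.C.right γ a (S.src₀.map r c)) (S.src₀.map l b) + · -
      S.idn.map n (F.comp δ (F.comp γ (S.tgt₀.map k a) (S.src₀.map r c)) (S.src₀.map l b))) e
    refine Eq.trans ?_ (e'.trans ?_)
    · abel
    · abel

/-- Source, as a morphism of operads. -/
noncomputable def srcHom : S.operad.Hom F := ⟨S.src₀.map, S.src₀_idn 0 _, S.src₀_upComp⟩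

/-- Target, as a morphism of operads. -/
noncomputable def tgtHom : S.operad.Hom F := ⟨S.tgt₀.map, S.tgt₀_idn 0 _, S.tgt₀_upComp⟩

/-- Identities, as a morphism of operads. -/
noncomputable def idnHom : F.Hom S.operad :=
  ⟨S.idn.map, rfl, fun ι a b => (S.idn.map_left ι a b).trans (S.upComp_idn_left ι a _).symm⟩

/-- Labelling of the leaves of a cell. -/
noncomputable def hatCell {m : ℕ} (ν : Fin (m + 1) ↪o ℕ) : S.C.Car m →ₗ[K] Hat S.operad :=
  hat (G := S.operad) ν

theorem src_hatCell {m : ℕ} (ν : Fin (m + 1) ↪o ℕ) (a : S.C.Car m) :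
    hatMap S.srcHom.map (S.hatCell ν a) = hat ν (S.src₀.map m a) := hatMap_hat _ _ _

theorem tgt_hatCell {m : ℕ} (ν : Fin (m + 1) ↪o ℕ) (a : S.C.Car m) :
    hatMap S.tgtHom.map (S.hatCell ν a) = hat ν (S.tgt₀.map m a) := hatMap_hat _ _ _

theorem idnHom_hat {m : ℕ} (ν : Fin (m + 1) ↪o ℕ) (u : F.Op m) :
    hatMap S.idnHom.map (hat ν u) = S.hatCell ν (S.idn.map m u) := hatMap_hat _ _ _

theorem hatCell_left {k l m : ℕ} (ν : Fin (m + 1) ↪o ℕ) (ι : Insertion k l m) (r : F.Op k)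
    (c : S.C.Car l) : S.hatCell ν (S.C.left ι r c) =
      hcomp (hatMap S.idnHom.map (hat (ι.outer.trans ν) r)) (S.hatCell (ι.inner.trans ν) c) := by
  rw [idnHom_hat]
  exact (congrArg (hat (G := S.operad) ν) (S.upComp_idn_left ι r c).symm).trans
    (hcomp_hat (G := S.operad) ι ν _ _).symm

theorem hatCell_mem {m : ℕ} (ν : Fin (m + 1) ↪o ℕ) (a : S.C.Car m) :
    S.hatCell ν a ∈ homog S.operad (Set.range ν) := hat_mem (G := S.operad) ν a

theorem hatCell_injective {m : ℕ} (ν : Fin (m + 1) ↪o ℕ) : Function.Injective (S.hatCell ν) :=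
  hat_injective (G := S.operad) ν

theorem srcHom_idnHom (a : Hat F) : hatMap S.srcHom.map (hatMap S.idnHom.map a) = a := by
  have h : (hatMap S.srcHom.map).comp (hatMap S.idnHom.map) = LinearMap.id :=
    Hat.linearMap_ext fun n ν a => by
      rw [LinearMap.comp_apply, hatMap_hat, hatMap_hat]
      exact congrArg (hat ν) (S.src₀_idn n a)
  exact LinearMap.congr_fun h a

theorem tgtHom_idnHom (a : Hat F) : hatMap S.tgtHom.map (hatMap S.idnHom.map a) = a := by
  have h : (hatMap S.tgtHom.map).comp (hatMap S.idnHom.map) = LinearMap.id :=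
    Hat.linearMap_ext fun n ν a => by
      rw [LinearMap.comp_apply, hatMap_hat, hatMap_hat]
      exact congrArg (hat ν) (S.tgt₀_idn n a)
  exact LinearMap.congr_fun h a

/-- Composition with a cell whose target is zero only depends on the source. -/
theorem hcomp_of_tgt_eq_zero {U V : Set ℕ} {m : ℕ} {a b : Hat S.operad}
    (ha : a ∈ homog _ U) (hb : b ∈ homog _ V) (h : Fits U V m)
    (ht : hatMap S.tgtHom.map b = 0) :
    hcomp a b = hcomp (hatMap S.idnHom.map (hatMap S.srcHom.map a)) b := by
  rcases eq_zero_or_eq_hat ha with rfl | ⟨k, f, x, rfl, rfl⟩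
  · simp only [map_zero, LinearMap.zero_apply]
  rcases eq_zero_or_eq_hat hb with rfl | ⟨l, g, y, rfl, rfl⟩
  · simp only [map_zero]
  obtain ⟨n, ν, ι, rfl, rfl⟩ := h.exists_glue
  rw [hatMap_hat] at ht
  have ht' : S.tgt₀.map l y = 0 := hat_injective _ (ht.trans (map_zero _).symm)
  rw [hatMap_hat, hatMap_hat, hcomp_hat, hcomp_hat]
  -- In the form `μ↓` of the composition, the terms other than `s₀(x) ∘ y` contain the target of
  -- `y`, which is zero.
  refine congrArg (hat ν) ((S.upComp_eq ι x y).trans (Eq.trans ?_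
    (S.upComp_idn_left ι (S.src₀.map k x) y).symm))
  rw [ht', map_zero, map_zero, map_zero, add_zero, sub_zero]

/-- Exchange replaces the boundary of `b` acting on `e` by the boundary of `e` acting on `b`, and
the boundary of `e` is zero. -/
theorem left_eq_zero {k l m : ℕ} (ι : Insertion k l m) {r : F.Op k} {b : S.C.Car k}
    (hr : r = S.src₀.map k b - S.tgt₀.map k b) {e : S.C.Car l} (hs : S.src₀.map l e = 0)
    (ht : S.tgt₀.map l e = 0) : S.C.left ι r e = 0 := by
  rw [hr, left_sub, hs, ht]
  simp only [map_zero, sub_zero, add_zero]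

end Cells

/-! ### Normalisation of trees -/

section

variable {X : ℕ → Type u} {P : Operad K} {n : ℕ} (S : Cells (freeOperad K X) n)
  (π : (freeOperad K X).Hom P)

/-- Linear normal forms, and cells from zero to the differences of elements and their normal
forms. -/
structure Normalisation where
  σ : ∀ m, P.Op m →ₗ[K] (freeOperad K X).Op m
  π_σ : ∀ m p, π.map m (σ m p) = p
  cell : ∀ m, (freeOperad K X).Op m →ₗ[K] S.C.Car m
  src_cell : ∀ m u, S.src₀.map m (cell m u) = 0
  tgt_cell : ∀ m u, S.tgt₀.map m (cell m u) = σ m (π.map m u) - u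

theorem Normalisation.nonempty (hs : ∀ m, Function.Surjective (π.map m))
    (hS : ∀ m r, π.map m r = 0 → ∃ b, r = S.src₀.map m b - S.tgt₀.map m b) :
    Nonempty (Normalisation S π) := by
  choose σ hσ using π.exists_section hs
  have h : ∀ m, ∃ l : (freeOperad K X).Op m →ₗ[K] S.C.Car m, ∀ u,
      ((S.src₀.map m).prod (S.tgt₀.map m)) (l u) =
        ((0 : (freeOperad K X).Op m →ₗ[K] _).prod ((σ m).comp (π.map m) - LinearMap.id)) u :=
    fun m => LinearMap.exists_comp_eq _ _ fun u => by
      obtain ⟨b, hb⟩ := hS m (u - σ m (π.map m u)) (by rw [map_sub, hσ, sub_self])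
      -- Subtracting the identity on its source moves `b` to a cell starting at zero without
      -- altering target minus source.
      refine ⟨b - S.idn.map m (S.src₀.map m b), Prod.ext ?_ ?_⟩
      · change S.src₀.map m (b - S.idn.map m (S.src₀.map m b)) = 0
        rw [map_sub, S.src₀_idn, sub_self]
      · change S.tgt₀.map m (b - S.idn.map m (S.src₀.map m b)) = σ m (π.map m u) - u
        rw [map_sub, S.tgt₀_idn, ← neg_sub, ← hb, neg_sub]
  choose l hl using h
  exact ⟨⟨σ, hσ, l, fun m u => congrArg Prod.fst (hl m u), fun m u => congrArg Prod.snd (hl m u)⟩⟩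

namespace Normalisation

variable {S π} (N : Normalisation S π)

/-- A cell, followed by the normalisation of its target. -/
noncomputable def reduce (m : ℕ) : S.operad.Op m →ₗ[K] S.operad.Op m :=
  LinearMap.id + (N.cell m).comp (S.tgt₀.map m)

/-- The normalisation of trees, from the leaves to the root. -/
noncomputable def treeRec : TreeRec X S.operad where
  gen := fun x => S.idn.map _ (freeOperad.of K x)
  op := fun _ => N.reduce
  -- The section is only linear, so the unit need not be its own normal form; leaves have to be
  -- normalised too.
  unit := N.reduce 0 S.operad.one

/-- Normal forms of labelled operations. -/
noncomputable def nf (a : Hat (freeOperad K X)) : Hat (freeOperad K X) :=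
  hatMap N.σ (hatMap π.map a)

theorem π_nf (a : Hat (freeOperad K X)) : hatMap π.map (N.nf a) = hatMap π.map a := by
  have h : ∀ b : Hat P, hatMap π.map (hatMap N.σ b) = b := fun b => by
    have h : (hatMap π.map).comp (hatMap N.σ) = LinearMap.id :=
      Hat.linearMap_ext fun m ν a => by
        rw [LinearMap.comp_apply, hatMap_hat, hatMap_hat, N.π_σ]
        rfl
    exact LinearMap.congr_fun h b
  exact h _

theorem src_reduce (a : Hat S.operad) :
    hatMap S.srcHom.map (hatMap N.reduce a) = hatMap S.srcHom.map a := by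
  have h : (hatMap S.srcHom.map).comp (hatMap N.reduce) = hatMap S.srcHom.map :=
    Hat.linearMap_ext fun m ν a => by
      rw [LinearMap.comp_apply, hatMap_hat, hatMap_hat, hatMap_hat]
      refine congrArg (hat ν) ((map_add (S.src₀.map m) _ _).trans ?_)
      exact (congrArg (_ + ·) (N.src_cell m _)).trans (add_zero _)
  exact LinearMap.congr_fun h a

theorem tgt_reduce (a : Hat S.operad) :
    hatMap S.tgtHom.map (hatMap N.reduce a) = N.nf (hatMap S.tgtHom.map a) := by
  have h : (hatMap S.tgtHom.map).comp (hatMap N.reduce) =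
      (hatMap N.σ).comp ((hatMap π.map).comp (hatMap S.tgtHom.map)) :=
    Hat.linearMap_ext fun m ν a => by
      simp only [LinearMap.comp_apply, hatMap_hat]
      refine congrArg (hat ν) ((map_add (S.tgt₀.map m) _ _).trans ?_)
      exact (congrArg (_ + ·) (N.tgt_cell m _)).trans (add_sub_cancel _ _)
  exact LinearMap.congr_fun h a

theorem reduce_of_tgt_eq_zero {a : Hat S.operad} (h : hatMap S.tgtHom.map a = 0) :
    hatMap N.reduce a = a := by
  have e : hatMap N.reduce = LinearMap.id +
      (hatMap (G := freeOperad K X) (H := S.operad) N.cell).comp (hatMap S.tgtHom.map) :=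
    Hat.linearMap_ext fun m ν a => by
      simp only [LinearMap.comp_apply, LinearMap.add_apply, hatMap_hat, LinearMap.id_apply]
      refine (map_add (hat (G := S.operad) ν) a (N.cell m (S.tgt₀.map m a))).trans ?_
      exact congrArg (_ + ·) (hatMap_hat (G := freeOperad K X) (H := S.operad) N.cell ν _).symm
  rw [e, LinearMap.add_apply, LinearMap.comp_apply, h, map_zero, add_zero]
  rfl

theorem map_hone (i : ℕ) : N.treeRec.map (hone _ i) = hatMap N.reduce (hone _ i) := by
  rw [TreeRec.map_hone, hone, hatMap_hat]
  rfl

theorem src_map (a : Hat (freeOperad K X)) : hatMap S.srcHom.map (N.treeRec.map a) = a := by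
  have h : (hatMap S.srcHom.map).comp N.treeRec.map = LinearMap.id :=
    Hat.ext_isTree fun U t ht => by
      rw [LinearMap.comp_apply, LinearMap.id_apply]
      induction ht with
      | one i => rw [N.map_hone, N.src_reduce, hatMap_hone]
      | node x L V v h hv ih =>
        rw [TreeRec.map_node _ x h hv]
        refine (N.src_reduce _).trans ?_
        rw [hatMap_node, hatMap_hat]
        exact congrArg₂ node (congrArg (hat L) (S.src₀_idn _ _)) (funext ih)
  exact LinearMap.congr_fun h a

/-- The target at a node is the normal form of a composite of normal forms. Since `π` does not
distinguish a subtree from its normal form, this is the normal form of the whole tree. -/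
theorem tgt_map (a : Hat (freeOperad K X)) :
    hatMap S.tgtHom.map (N.treeRec.map a) = N.nf a := by
  have h : (hatMap S.tgtHom.map).comp N.treeRec.map = (hatMap N.σ).comp (hatMap π.map) :=
    Hat.ext_isTree fun U t ht => by
      rw [LinearMap.comp_apply]
      change _ = N.nf t
      induction ht with
      | one i => rw [N.map_hone, N.tgt_reduce, hatMap_hone]
      | node x L V v h hv ih =>
        rw [TreeRec.map_node _ x h hv]
        refine (N.tgt_reduce _).trans ?_
        rw [hatMap_node, hatMap_hat, funext ih]
        refine congrArg (hatMap N.σ) ?_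
        rw [hatMap_node, hatMap_node]
        exact congrArg₂ node (congrArg _ (congrArg (hat L) (S.tgt₀_idn _ _)))
          (funext fun j => N.π_nf _)
  exact LinearMap.congr_fun h a

theorem tgt_map_eq_zero {a : Hat (freeOperad K X)} (h : hatMap π.map a = 0) :
    hatMap S.tgtHom.map (N.treeRec.map a) = 0 := by
  rw [N.tgt_map, nf, h, map_zero]

/-- Normalisation commutes with the left action on elements of the ideal. -/
theorem map_hcomp_of_isTree {U W : Set ℕ} {m : ℕ} {t c : Hat (freeOperad K X)}
    (ht : IsTree K X U t) (hc : c ∈ homog _ W) (h0 : hatMap π.map c = 0) (hW : Fits U W m) :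
    N.treeRec.map (hcomp t c) = hcomp (hatMap S.idnHom.map t) (N.treeRec.map c) := by
  induction ht with
  | one i =>
    obtain rfl : m = i := hW.mem
    rw [hone_hcomp hc hW.least, hatMap_hone, hone_hcomp (N.treeRec.map_mem hc) hW.least]
  | @node k x L V v h hv ih =>
    obtain ⟨j, hj⟩ := Set.mem_iUnion.1 hW.mem
    have hW' : Fits (V j) W m :=
      ⟨hW.least, hj, fun x hx hx' => hW.eq x (Set.mem_iUnion.2 ⟨j, hx⟩) hx'⟩
    have hd : ∀ i, i ≠ j → Disjoint (V i) W := fun i hi => Set.disjoint_left.2 fun x hx hx' => by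
      obtain rfl := hW.eq x (Set.mem_iUnion.2 ⟨i, hx⟩) hx'
      exact h.notMem hi hx hj
    have hl : IsLeast (V j ∪ W) (L j) := ⟨Or.inl (h.least j).1, fun x hx =>
      hx.elim (fun hx => (h.least j).2 hx) (fun hx => ((h.least j).2 hj).trans (hW.least.2 hx))⟩
    have hd' : ∀ i, i ≠ j → Disjoint (V i) (V j ∪ W) := fun i hi =>
      Set.disjoint_union_right.2 ⟨h.disjoint i j hi, hd i hi⟩
    have hvm : ∀ i, v i ∈ homog (freeOperad K X) (V i) := fun i => (hv i).mem
    have hTm : ∀ i, N.treeRec.map (v i) ∈ homog S.operad (V i) := fun i =>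
      N.treeRec.map_mem (hvm i)
    have him : ∀ i, hatMap S.idnHom.map (v i) ∈ homog S.operad (V i) := fun i =>
      hatMap_mem _ (hvm i)
    have hcm := N.treeRec.map_mem hc
    have hz : hcomp (hatMap S.idnHom.map (v j)) (N.treeRec.map c) ∈
        homog S.operad (V j ∪ W) := hcomp_mem (him j) hcm hW'
    have ht0 := N.tgt_map_eq_zero h0
    have hzt : hatMap S.tgtHom.map (hcomp (hatMap S.idnHom.map (v j)) (N.treeRec.map c)) = 0 := by
      rw [hatMap_hcomp, ht0, map_zero]
    rw [node_hcomp h (hat_mem _ _) hvm hc hW' hd, TreeRec.map_node_update _ x h hv j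
      (hcomp_mem (hvm j) hc hW') hl hd', ih j hW', hatMap_node,
      node_hcomp h (by rw [hatMap_hat]; exact hat_mem _ _) him hcm hW' hd]
    have hg : hat L (N.treeRec.gen x) ∈ homog S.operad (Set.range L) := hat_mem _ _
    have hym : node (hat L (N.treeRec.gen x)) (Function.update (fun i => N.treeRec.map (v i)) j
        (hone S.operad (L j))) ∈ homog S.operad (⋃ i, Function.update V j {L j} i) :=
      node_mem (h.update_single j) hg fun i => by
        by_cases hi : i = j
        · subst hi; rw [Function.update_self, Function.update_self]; exact hone_mem _
        · rw [Function.update_of_ne hi, Function.update_of_ne hi]; exact hTm i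
    have hfit : Fits (⋃ i, Function.update V j {L j} i) (V j ∪ W) (L j) := by
      refine ⟨hl, Set.mem_iUnion.2 ⟨j, by rw [Function.update_self]; rfl⟩, fun x hx hx' => ?_⟩
      obtain ⟨i, hi⟩ := Set.mem_iUnion.1 hx
      by_cases hij : i = j
      · subst hij; rw [Function.update_self] at hi; exact hi
      · rw [Function.update_of_ne hij] at hi
        exact absurd hx' (Set.disjoint_left.1 (hd' i hij) hi)
    -- Both sides are now compositions with the same cell, whose target is zero. Therefore only the
    -- source of the remaining node matters, and that source is the unnormalised tree. The composite
    -- also has zero target, so the final reduction at the root does nothing.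
    rw [node_update h hg hTm j hz hl hd', node_update h (by rw [hatMap_hat]; exact hat_mem _ _)
      him j hz hl hd', S.hcomp_of_tgt_eq_zero hym hz hfit hzt]
    refine (N.reduce_of_tgt_eq_zero (by rw [hatMap_hcomp, hzt, map_zero])).trans ?_
    refine congrArg (fun y => hcomp y _) ?_
    rw [hatMap_node, hatMap_node]
    refine congrArg₂ node ?_ (funext fun i => ?_)
    · rw [hatMap_hat, hatMap_hat, hatMap_hat]
      exact congrArg (hat L) (congrArg (S.idn.map k) (S.src₀_idn k _))
    · by_cases hi : i = j
      · subst hi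
        rw [Function.update_self, Function.update_self, hatMap_hone, hatMap_hone]
      · rw [Function.update_of_ne hi, Function.update_of_ne hi, N.src_map]

theorem map_hcomp {U W : Set ℕ} {m : ℕ} {a c : Hat (freeOperad K X)} (ha : a ∈ homog _ U)
    (hc : c ∈ homog _ W) (h0 : hatMap π.map c = 0) (hW : Fits U W m) :
    N.treeRec.map (hcomp a c) = hcomp (hatMap S.idnHom.map a) (N.treeRec.map c) := by
  have h := homog_le_span_isTree U ha
  clear ha
  induction h using Submodule.span_induction with
  | mem t ht => exact N.map_hcomp_of_isTree ht hc h0 hW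
  | zero => simp only [map_zero, LinearMap.zero_apply]
  | add x y _ _ hx hy => simp only [map_add, LinearMap.add_apply, hx, hy]
  | smul k x _ hx => simp only [map_smul, LinearMap.smul_apply, hx]

/-- The defect of a cell from the normalisation of its source minus its target. -/
noncomputable def defect : Hat S.operad →ₗ[K] Hat S.operad :=
  LinearMap.id - (hatMap S.idnHom.map).comp (hatMap S.tgtHom.map) -
    N.treeRec.map.comp (hatMap S.srcHom.map - hatMap S.tgtHom.map)

theorem defect_apply (a : Hat S.operad) : N.defect a = a - hatMap S.idnHom.map
    (hatMap S.tgtHom.map a) - N.treeRec.map (hatMap S.srcHom.map a - hatMap S.tgtHom.map a) := rfl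

theorem defect_idn {m : ℕ} (ν : Fin (m + 1) ↪o ℕ) (u : (freeOperad K X).Op m) :
    N.defect (S.hatCell ν (S.idn.map m u)) = 0 := by
  rw [← S.idnHom_hat, defect_apply, S.tgtHom_idnHom, S.srcHom_idnHom, sub_self, sub_self, map_zero, sub_zero]

/-- The defect commutes with the left action of `r`, since the normalisation does so on `s₀(a) -
t₀(a)`, which is in the kernel. The defect of `a` has zero source and target, and elements of the
kernel annihilate such cells by exchange. -/
theorem defect_left (hS : ∀ m r, π.map m r = 0 → ∃ b, r = S.src₀.map m b - S.tgt₀.map m b)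
    (hπ : ∀ m a, π.map m (S.src₀.map m a) = π.map m (S.tgt₀.map m a)) {k l m : ℕ}
    (ν : Fin (m + 1) ↪o ℕ) (ι : Insertion k l m) {r : (freeOperad K X).Op k}
    (hr : π.map k r = 0) (a : S.C.Car l) : N.defect (S.hatCell ν (S.C.left ι r a)) = 0 := by
  set r' : Hat (freeOperad K X) := hat (ι.outer.trans ν) r with hr'
  set a' : Hat S.operad := S.hatCell (ι.inner.trans ν) a with ha'
  have hd0 : hatMap π.map (hatMap S.srcHom.map a' - hatMap S.tgtHom.map a') = 0 := by
    rw [ha', map_sub, S.src_hatCell, S.tgt_hatCell, hatMap_hat, hatMap_hat]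
    exact sub_eq_zero.2 (congrArg _ (hπ l a))
  have ham : a' ∈ homog S.operad (Set.range (ι.inner.trans ν)) := S.hatCell_mem _ a
  have hdm : hatMap S.srcHom.map a' - hatMap S.tgtHom.map a' ∈
      homog (freeOperad K X) (Set.range (ι.inner.trans ν)) :=
    sub_mem (hatMap_mem _ ham) (hatMap_mem _ ham)
  have e : N.defect (hcomp (hatMap S.idnHom.map r') a') =
      hcomp (hatMap S.idnHom.map r') (N.defect a') := by
    rw [defect_apply, defect_apply, hatMap_hcomp S.srcHom, hatMap_hcomp S.tgtHom, S.tgtHom_idnHom,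
      S.srcHom_idnHom, ← map_sub (hcomp r'), N.map_hcomp (a := r') (hat_mem _ _) hdm hd0 (ι.fits ν),
      hatMap_hcomp, map_sub (hcomp _), map_sub (hcomp _)]
  obtain ⟨c, hc⟩ : ∃ c : S.C.Car l, N.defect a' = S.hatCell (ι.inner.trans ν) c :=
    exists_eq_hat (G := S.operad) (sub_mem (sub_mem ham
      (hatMap_mem _ (hatMap_mem _ ham))) (N.treeRec.map_mem hdm))
  obtain ⟨b, hb⟩ := hS k r hr
  have hs0 : hatMap S.srcHom.map (N.defect a') = 0 := by
    rw [defect_apply, map_sub, map_sub, S.srcHom_idnHom, N.src_map, sub_self]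
  have ht0 : hatMap S.tgtHom.map (N.defect a') = 0 := by
    rw [defect_apply, map_sub, map_sub, S.tgtHom_idnHom, N.tgt_map_eq_zero hd0, sub_self, sub_zero]
  rw [hc, S.src_hatCell] at hs0
  rw [hc, S.tgt_hatCell] at ht0
  rw [S.hatCell_left, e, hc, ← S.hatCell_left,
    S.left_eq_zero ι hb (hat_injective _ (hs0.trans (map_zero _).symm))
      (hat_injective _ (ht0.trans (map_zero _).symm)), map_zero]

end Normalisation

/-- A cell with zero source and target is zero, if it is the sum of an identity and of elements
`r ∘ a` with `r` in the kernel of `π`. -/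
theorem Cells.eq_zero_of_idn_add (hs : ∀ m, Function.Surjective (π.map m))
    (hS : ∀ m r, π.map m r = 0 → ∃ b, r = S.src₀.map m b - S.tgt₀.map m b)
    (hπ : ∀ m a, π.map m (S.src₀.map m a) = π.map m (S.tgt₀.map m a)) {m : ℕ}
    {u : (freeOperad K X).Op m} {z f : S.C.Car m} (hz : z ∈ S.C.kernelSpan π m)
    (hf : f = S.idn.map m u + z) (hsrc : S.src₀.map m f = 0) (htgt : S.tgt₀.map m f = 0) :
    f = 0 := by
  obtain ⟨N⟩ := Normalisation.nonempty S π hs hS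
  set ν : Fin (m + 1) ↪o ℕ := Fin.valOrderEmb (m + 1) with hν
  have h0 : N.defect (S.hatCell ν z) = 0 := by
    clear hf
    induction hz using Submodule.span_induction with
    | mem z h =>
      obtain ⟨k, l, ι, r, a, hr, rfl⟩ := h
      exact N.defect_left hS hπ ν ι hr a
    | zero => rw [map_zero, map_zero]
    | add x y _ _ hx hy => rw [map_add, map_add, hx, hy, add_zero]
    | smul c x _ hx => rw [map_smul, map_smul, hx, smul_zero]
  -- A cell with zero source and target equals its own defect, whereas the defect of each of the two
  -- summands vanishes.
  have h1 : N.defect (S.hatCell ν f) = S.hatCell ν f := by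
    rw [N.defect_apply, S.src_hatCell, S.tgt_hatCell, hsrc, htgt]
    simp only [map_zero, sub_zero]
  refine S.hatCell_injective ν (h1.symm.trans ?_)
  rw [hf, map_add, map_add, N.defect_idn, h0, add_zero, map_zero]

end

end

end Shuffle

namespace Shuffle

theorem Insertion.root_isSequential {k l n : ℕ} (ι : Insertion k l n) :
    IsSequential (Insertion.root k) ι (Insertion.root n) ι where
  left := fun x => by
    obtain rfl : x = 0 := Subsingleton.elim (α := Fin 1) _ _
    exact ι.outer_zero
  middle := fun _ => rfl
  right := fun _ => rfl

section

variable {K : Type u} [Field K]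

/-! ### Functoriality of free operads -/

section

variable {X Y : ℕ → Type u}

/-- Renaming of generators. -/
def Word.map (f : ∀ n, X n → Y n) : ∀ {n : ℕ}, Word X n → Word Y n
  | _, .gen x => .gen (f _ x)
  | _, .one => .one
  | _, .comp ι a b => .comp ι (a.map f) (b.map f)

theorem Word.Rel.map (f : ∀ n, X n → Y n) {n : ℕ} {a b : Word X n} (h : Word.Rel X a b) :
    Word.Rel Y (a.map f) (b.map f) := by
  induction h with
  | refl a => exact .refl _
  | symm _ h => exact .symm h
  | trans _ _ h h' => exact .trans h h'
  | comp ι _ _ h h' => exact .comp ι h h'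
  | one_comp ι a => exact .one_comp ι _
  | comp_one ι a => exact .comp_one ι _
  | comp_seq h a b c => exact .comp_seq h _ _ _
  | comp_par h a b c => exact .comp_par h _ _ _

/-- The linear map of free operads given by a renaming of generators. -/
noncomputable def freeOperad.mapLin (K : Type u) [Field K] (f : ∀ n, X n → Y n) (n : ℕ) :
    (freeOperad K X).Op n →ₗ[K] (freeOperad K Y).Op n :=
  Finsupp.lmapDomain K K (Quot.map (Word.map f) (fun _ _ h => h.map f))

theorem freeOperad.mapLin_mono (f : ∀ n, X n → Y n) {n : ℕ} (w : Word X n) :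
    freeOperad.mapLin K f n (mono K w) = mono K (w.map f) := Finsupp.mapDomain_single

/-- The morphism of free operads given by a renaming of generators. -/
noncomputable def freeOperad.map (f : ∀ n, X n → Y n) : (freeOperad K X).Hom (freeOperad K Y) where
  map := freeOperad.mapLin K f
  map_one := freeOperad.mapLin_mono f .one
  map_comp := fun {k l n} ι a b => by
    have h : ((freeOperad K X).comp ι).compr₂ (freeOperad.mapLin K f n) =
        (((freeOperad K Y).comp ι).comp (freeOperad.mapLin K f k)).compl₂
          (freeOperad.mapLin K f l) := by
      refine freeOperad.linearMap_ext (fun v => freeOperad.linearMap_ext (fun w => ?_))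
      rw [LinearMap.compr₂_apply, LinearMap.compl₂_apply, LinearMap.comp_apply,
        freeOperad.mapLin_mono, freeOperad.mapLin_mono, ← mono_comp, ← mono_comp,
        freeOperad.mapLin_mono, Word.map]
    exact LinearMap.congr_fun₂ h a b

theorem freeOperad.map_of (f : ∀ n, X n → Y n) {n : ℕ} (x : X n) :
    (freeOperad.map f).map n (freeOperad.of K x) = freeOperad.of K (f n x) :=
  freeOperad.mapLin_mono f (.gen x)

theorem IsTree.map (f : ∀ n, X n → Y n) {U : Set ℕ} {t : Hat (freeOperad K X)}
    (h : IsTree K X U t) : IsTree K Y U (hatMap (freeOperad.map f).map t) := by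
  induction h with
  | one i => rw [hatMap_hone]; exact .one i
  | node x L V v h _ ih =>
    rw [hatMap_node, hatMap_hat, freeOperad.map_of]
    exact .node _ L V _ h ih

end

/-! ### Elements of free bimodules -/

namespace Bimodule

variable {Q P : Operad K}

theorem free_mem {Y : ℕ → Type u} (S : ∀ n, Submodule K ((free Q Y).Car n))
    (hgen : ∀ n (y : Y n), free.of Q y ∈ S n)
    (hleft : ∀ {k l n : ℕ} (ι : Insertion k l n) (v : Q.Op k) (a : (free Q Y).Car l), a ∈ S l →
      (free Q Y).left ι v a ∈ S n)
    (hright : ∀ {k l n : ℕ} (ι : Insertion k l n) (a : (free Q Y).Car k) (v : Q.Op l), a ∈ S k →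
      (free Q Y).right ι a v ∈ S n) {n : ℕ} (a : (free Q Y).Car n) : a ∈ S n := by
  have key : ∀ n (w : Mon Q Y n),
      (Submodule.Quotient.mk (Finsupp.single w 1) : (free Q Y).Car n) ∈ S n := by
    intro n w
    induction w with
    | gen y => exact hgen _ y
    | left ι v a ih =>
      have h := hleft ι v _ ih
      change Submodule.Quotient.mk (preLeft ι v (Finsupp.single a 1)) ∈ S _ at h
      rwa [preLeft, Finsupp.lmapDomain_apply, Finsupp.mapDomain_single] at h
    | right ι a v ih =>
      have h := hright ι _ v ih
      change Submodule.Quotient.mk (preRight ι v (Finsupp.single a 1)) ∈ S _ at h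
      rwa [preRight, Finsupp.lmapDomain_apply, Finsupp.mapDomain_single] at h
  induction a using Submodule.Quotient.induction_on with
  | H a =>
    change a ∈ (S n).comap (freeKer Q Y n).mkQ
    induction a using Finsupp.induction_linear with
    | zero => exact zero_mem _
    | add a b ha hb => exact add_mem ha hb
    | single w c =>
      rw [← Finsupp.smul_single_one]
      exact Submodule.smul_mem _ c (key n w)

/-- The free bimodule on `ε` is spanned by the elements `u ∘ (ε | v)`. -/
theorem free_eps_mem_span {n : ℕ} (y : (free Q (UnitSet.{u})).Car n) :
    y ∈ Submodule.span K {y | ∃ (k l : ℕ) (ι : Insertion k l n) (u : Q.Op k) (v : Q.Op l),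
      y = (free Q UnitSet).left ι u ((free Q UnitSet).right (Insertion.root l) (eps Q) v)} := by
  refine free_mem (fun n => Submodule.span K {y | ∃ (k l : ℕ) (ι : Insertion k l n) (u : Q.Op k)
      (v : Q.Op l), y = (free Q UnitSet).left ι u
        ((free Q UnitSet).right (Insertion.root l) (eps Q) v)}) ?_ ?_ ?_ y
  · rintro _ ⟨⟩
    refine Submodule.subset_span ⟨0, 0, Insertion.root 0, Q.one, Q.one, ?_⟩
    rw [Bimodule.one_left, Bimodule.right_one]
    rfl
  · intro k l n ι v a ha
    induction ha using Submodule.span_induction with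
    | mem a h =>
      obtain ⟨k', l', δ, u, w, rfl⟩ := h
      obtain ⟨p, α, β, h⟩ := Insertion.exists_sequential_left ι δ
      rw [← Bimodule.seq_left_left _ h]
      exact Submodule.subset_span ⟨_, _, β, _, w, rfl⟩
    | zero => rw [map_zero]; exact zero_mem _
    | add x y _ _ hx hy => rw [map_add]; exact add_mem hx hy
    | smul c x _ hx => rw [map_smul]; exact Submodule.smul_mem _ c hx
  · intro k l n ι a v ha
    induction ha using Submodule.span_induction with
    | mem a h =>
      obtain ⟨k', l', α, u, w, rfl⟩ := h
      by_cases hz : ∃ z, α.inner z = ι.slot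
      · obtain ⟨q, γ, δ, h⟩ := Insertion.exists_sequential_right α ι hz
        rw [Bimodule.seq_left_right _ h, Bimodule.seq_right_right _ δ.root_isSequential]
        exact Submodule.subset_span ⟨_, _, γ, _, _, rfl⟩
      · obtain ⟨q, γ, δ, h⟩ := Insertion.exists_parallel α ι (fun z e => hz ⟨z, e⟩)
        rw [Bimodule.par_left_right _ h]
        exact Submodule.subset_span ⟨_, _, δ, _, _, rfl⟩
    | zero => rw [LinearMap.map_zero₂]; exact zero_mem _
    | add x y _ _ hx hy => rw [LinearMap.map_add₂]; exact add_mem hx hy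
    | smul c x _ hx => rw [LinearMap.map_smul₂]; exact Submodule.smul_mem _ c hx

/-- Reassociation absorbs any further action either into the cofactor `a`, or into `r`, whose
composites stay in the kernel. The span is thus already a sub-bimodule. -/
theorem gen_kernelAction_le (π : Q.Hom P) (A : Bimodule Q) (n : ℕ) :
    A.gen (A.KernelAction π) n ≤ Submodule.span K {z | A.KernelAction π n z} := by
  intro z hz
  induction (hz : Gen A _ n z) with
  | of h => exact Submodule.subset_span h
  | zero => exact zero_mem _
  | add _ _ h1 h2 => exact add_mem h1 h2
  | smul c _ h => exact Submodule.smul_mem _ c h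
  | left ι v h0 h =>
    clear h0
    induction h using Submodule.span_induction with
    | mem a h =>
      rcases h with ⟨k, l, δ, r, a, hr, rfl⟩ | ⟨k, l, δ, a, r, hr, rfl⟩
      · obtain ⟨p, α, β, h⟩ := Insertion.exists_sequential_left ι δ
        rw [← A.seq_left_left h]
        exact Submodule.subset_span (Or.inl ⟨_, _, β, _, a, by rw [π.map_comp, hr, map_zero], rfl⟩)
      · obtain ⟨p, α, β, h⟩ := Insertion.exists_sequential_left ι δ
        rw [← A.seq_left_right h]
        exact Submodule.subset_span (Or.inr ⟨_, _, β, _, r, hr, rfl⟩)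
    | zero => rw [map_zero]; exact zero_mem _
    | add x y _ _ hx hy => rw [map_add]; exact add_mem hx hy
    | smul c x _ hx => rw [map_smul]; exact Submodule.smul_mem _ c hx
  | right ι v h0 h =>
    clear h0
    induction h using Submodule.span_induction with
    | mem a h =>
      rcases h with ⟨k, l, α, r, a, hr, rfl⟩ | ⟨k, l, α, a, r, hr, rfl⟩
      · by_cases hz : ∃ z, α.inner z = ι.slot
        · obtain ⟨q, γ, δ, h⟩ := Insertion.exists_sequential_right α ι hz
          rw [A.seq_left_right h]
          exact Submodule.subset_span (Or.inl ⟨_, _, γ, r, _, hr, rfl⟩)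
        · obtain ⟨q, γ, δ, h⟩ := Insertion.exists_parallel α ι (fun z e => hz ⟨z, e⟩)
          rw [A.par_left_right h]
          exact Submodule.subset_span
            (Or.inl ⟨_, _, δ, _, a, by rw [π.map_comp, hr, LinearMap.map_zero₂], rfl⟩)
      · by_cases hz : ∃ z, α.inner z = ι.slot
        · obtain ⟨q, γ, δ, h⟩ := Insertion.exists_sequential_right α ι hz
          rw [A.seq_right_right h]
          exact Submodule.subset_span
            (Or.inr ⟨_, _, γ, a, _, by rw [π.map_comp, hr, LinearMap.map_zero₂], rfl⟩)
        · obtain ⟨q, γ, δ, h⟩ := Insertion.exists_parallel α ι (fun z e => hz ⟨z, e⟩)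
          rw [A.par_right_right h]
          exact Submodule.subset_span (Or.inr ⟨_, _, δ, _, r, hr, rfl⟩)
    | zero => rw [LinearMap.map_zero₂]; exact zero_mem _
    | add x y _ _ hx hy => rw [LinearMap.map_add₂]; exact add_mem hx hy
    | smul c x _ hx => rw [LinearMap.map_smul₂]; exact Submodule.smul_mem _ c hx

end Bimodule

/-! ### The square of the kernel -/

/-- The span of the compositions of two elements of the kernel of `π`. -/
def kernelSq {F P : Operad K} (π : F.Hom P) (n : ℕ) : Submodule K (F.Op n) :=
  Submodule.span K {z | ∃ (k l : ℕ) (ι : Insertion k l n) (r : F.Op k) (r' : F.Op l),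
    π.map k r = 0 ∧ π.map l r' = 0 ∧ z = F.comp ι r r'}

theorem comp_mem_kernelSq {F P : Operad K} {π : F.Hom P} {k l n : ℕ} (ι : Insertion k l n)
    {r : F.Op k} {r' : F.Op l} (hr : π.map k r = 0) (hr' : π.map l r' = 0) :
    F.comp ι r r' ∈ kernelSq π n :=
  Submodule.subset_span ⟨k, l, ι, r, r', hr, hr', rfl⟩

/-! ### The free bimodule on `ε`, realised with an additional generator. -/

section

variable {X : ℕ → Type u} {P : Operad K} (π : (freeOperad K X).Hom P)

/-- The generators, with an additional generator `ε`. -/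
abbrev WithEps (X : ℕ → Type u) (n : ℕ) : Type u := X n ⊕ UnitSet.{u} n

/-- The inclusion of the free operad in the free operad with an additional generator `ε`. -/
noncomputable abbrev inclEps (K : Type u) [Field K] (X : ℕ → Type u) :
    (freeOperad K X).Hom (freeOperad K (WithEps X)) := freeOperad.map (fun _ => Sum.inl)

/-- The free bimodule on `ε`, in the free operad with an additional generator `ε`. -/
noncomputable def epsHom (K : Type u) [Field K] (X : ℕ → Type u) :
    (Bimodule.free (freeOperad K X) (UnitSet.{u})).Hom
      ((Bimodule.self (freeOperad K (WithEps X))).restrict (inclEps K X)) :=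
  Bimodule.freeLift _ (fun _ e => freeOperad.of K (X := WithEps X) (.inr e))

/-- Generators, with `ε` evaluated to the unit. -/
noncomputable def genEps (K : Type u) [Field K] (X : ℕ → Type u) :
    ∀ {k : ℕ}, WithEps X k → (freeOperad K X).Op k
  | _, .inl x => freeOperad.of K x
  | _, .inr .ε => (freeOperad K X).one

/-- The recursion that reduces the subtree above `ε`. -/
noncomputable def reduceEps (σ : ∀ m, P.Op m →ₗ[K] (freeOperad K X).Op m) :
    TreeRec (WithEps X) (freeOperad K X) where
  gen := genEps K X
  op := fun x n => match x with
    | .inl _ => LinearMap.id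
    -- The vertex `ε` is evaluated to the unit, hence disappears, and the subtree `v` above it is
    -- replaced by `v` minus its normal form, an element of the kernel when `σ` is a section of `π`.
    | .inr _ => LinearMap.id - (σ n).comp (π.map n)
  unit := (freeOperad K X).one

variable (σ : ∀ m, P.Op m →ₗ[K] (freeOperad K X).Op m)

theorem hatMap_id {G : Operad K} (a : Hat G) : hatMap (fun _ => LinearMap.id) a = a := by
  have h : hatMap (fun n => (LinearMap.id : G.Op n →ₗ[K] G.Op n)) = LinearMap.id :=
    Hat.linearMap_ext fun n ν a => by rw [hatMap_hat]; rfl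
  rw [h]
  rfl

theorem reduceEps_incl (a : Hat (freeOperad K X)) :
    (reduceEps π σ).map (hatMap (inclEps K X).map a) = a := by
  have h : (reduceEps π σ).map.comp (hatMap (inclEps K X).map) = LinearMap.id :=
    Hat.ext_isTree fun U t ht => by
      rw [LinearMap.comp_apply, LinearMap.id_apply]
      induction ht with
      | one i => rw [hatMap_hone, TreeRec.map_hone]; rfl
      | node x L V v h hv ih =>
        rw [hatMap_node, hatMap_hat, freeOperad.map_of, TreeRec.map_node _ _ h
          (fun j => (hv j).map _), funext ih]
        exact hatMap_id _
  exact LinearMap.congr_fun h a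

/-- The recursion acts only at `ε`. The tree below it contains no `ε` and is returned unchanged. -/
theorem reduceEps_hcomp_of_isTree {U W : Set ℕ} {m : ℕ} {t : Hat (freeOperad K X)}
    {c : Hat (freeOperad K (WithEps X))} (ht : IsTree K X U t) (hc : c ∈ homog _ W)
    (hW : Fits U W m) : (reduceEps π σ).map (hcomp (hatMap (inclEps K X).map t) c) =
      hcomp t ((reduceEps π σ).map c) := by
  induction ht with
  | one i =>
    obtain rfl : m = i := hW.mem
    rw [hatMap_hone, hone_hcomp hc hW.least, hone_hcomp (TreeRec.map_mem _ hc) hW.least]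
  | @node k x L V v h hv ih =>
    obtain ⟨j, hj⟩ := Set.mem_iUnion.1 hW.mem
    have hW' : Fits (V j) W m :=
      ⟨hW.least, hj, fun x hx hx' => hW.eq x (Set.mem_iUnion.2 ⟨j, hx⟩) hx'⟩
    have hd : ∀ i, i ≠ j → Disjoint (V i) W := fun i hi => Set.disjoint_left.2 fun x hx hx' => by
      obtain rfl := hW.eq x (Set.mem_iUnion.2 ⟨i, hx⟩) hx'
      exact h.notMem hi hx hj
    have hl : IsLeast (V j ∪ W) (L j) := ⟨Or.inl (h.least j).1, fun x hx =>
      hx.elim (fun hx => (h.least j).2 hx) (fun hx => ((h.least j).2 hj).trans (hW.least.2 hx))⟩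
    have hd' : ∀ i, i ≠ j → Disjoint (V i) (V j ∪ W) := fun i hi =>
      Set.disjoint_union_right.2 ⟨h.disjoint i j hi, hd i hi⟩
    have hv' : ∀ i, IsTree K (WithEps X) (V i) (hatMap (inclEps K X).map (v i)) :=
      fun i => (hv i).map _
    rw [hatMap_node, hatMap_hat, freeOperad.map_of, node_hcomp h (hat_mem _ _)
      (fun i => (hv' i).mem) hc hW' hd, TreeRec.map_node_update _ _ h hv' j
      (hcomp_mem (hv' j).mem hc hW') hl hd', ih j hW', node_hcomp h (hat_mem _ _)
      (fun i => (hv i).mem) (TreeRec.map_mem _ hc) hW' hd,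
      funext fun i => reduceEps_incl π σ (v i)]
    exact hatMap_id _

theorem reduceEps_hcomp {U W : Set ℕ} {m : ℕ} {a : Hat (freeOperad K X)}
    {c : Hat (freeOperad K (WithEps X))} (ha : a ∈ homog _ U) (hc : c ∈ homog _ W)
    (hW : Fits U W m) : (reduceEps π σ).map (hcomp (hatMap (inclEps K X).map a) c) =
      hcomp a ((reduceEps π σ).map c) := by
  have h := homog_le_span_isTree U ha
  clear ha
  induction h using Submodule.span_induction with
  | mem t ht => exact reduceEps_hcomp_of_isTree π σ ht hc hW
  | zero => simp only [map_zero, LinearMap.zero_apply]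
  | add x y _ _ hx hy => simp only [map_add, LinearMap.add_apply, hx, hy]
  | smul k x _ hx => simp only [map_smul, LinearMap.smul_apply, hx]

/-- The map from the free bimodule on `ε` to labelled operations which sends `u ∘ (ε | v)` to the
composite of `u` with the difference of `v` and its normal form. -/
noncomputable def epsDefect {n : ℕ} (ν : Fin (n + 1) ↪o ℕ) :
    (Bimodule.free (freeOperad K X) (UnitSet.{u})).Car n →ₗ[K] Hat (freeOperad K X) :=
  (reduceEps π σ).map.comp ((hat (G := freeOperad K (WithEps X)) ν).comp ((epsHom K X).map n))

theorem epsDefect_left {k l n : ℕ} (ν : Fin (n + 1) ↪o ℕ) (ι : Insertion k l n)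
    (u : (freeOperad K X).Op k) (y : (Bimodule.free (freeOperad K X) UnitSet).Car l) :
    epsDefect π σ ν ((Bimodule.free (freeOperad K X) UnitSet).left ι u y) =
      hcomp (hat (ι.outer.trans ν) u) (epsDefect π σ (ι.inner.trans ν) y) := by
  have e : (hat ν ((epsHom K X).map n ((Bimodule.free (freeOperad K X) UnitSet).left ι u y)) :
      Hat (freeOperad K (WithEps X))) = hcomp (hatMap (inclEps K X).map (hat (ι.outer.trans ν) u))
        (hat (ι.inner.trans ν) ((epsHom K X).map l y)) := by
    rw [hatMap_hat]
    exact (congrArg (hat (G := freeOperad K (WithEps X)) ν) ((epsHom K X).map_left ι u y)).trans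
      (hcomp_hat (G := freeOperad K (WithEps X)) ι ν _ _).symm
  refine (congrArg (reduceEps π σ).map e).trans ?_
  exact reduceEps_hcomp π σ (hat_mem _ _) (hat_mem (G := freeOperad K (WithEps X)) _ _) (ι.fits ν)

theorem epsDefect_root {n : ℕ} (ν : Fin (n + 1) ↪o ℕ) (v : (freeOperad K X).Op n) :
    epsDefect π σ ν ((Bimodule.free (freeOperad K X) UnitSet).right (Insertion.root n) (eps _) v) =
      hat ν (v - σ n (π.map n v)) := by
  -- The element `(ε | v)` is a node with a single subtree; its leaf must bear the smallest label of
  -- `v`.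
  set L := Label.single (ν 0) with hL
  set c : Hat (freeOperad K (WithEps X)) := hat ν ((inclEps K X).map n v) with hc
  have hcm : c ∈ homog _ (Set.range ν) := hat_mem _ _
  have e : (hat ν ((epsHom K X).map n ((Bimodule.free (freeOperad K X) UnitSet).right
      (Insertion.root n) (eps _) v)) : Hat (freeOperad K (WithEps X))) =
      node (hat L (freeOperad.of K (X := WithEps X) (.inr .ε)))
        (Function.update (fun i => hone _ (L i)) 0 c) := by
    have e1 := (epsHom K X).map_right (Insertion.root n) (eps _) v
    have e2 : (epsHom K X).map 0 (eps _) = freeOperad.of K (X := WithEps X) (.inr .ε) :=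
      Bimodule.freeLift_of _ _ _
    rw [e2] at e1
    refine (congrArg (hat (G := freeOperad K (WithEps X)) ν) e1).trans ?_
    refine (hcomp_hat_of_eq (G := freeOperad K (WithEps X)) (Insertion.root n) (f := L)
      (g := ν) (DFunLike.ext _ _ fun _ => rfl) (DFunLike.ext _ _ fun _ => rfl) _ _).symm.trans ?_
    rfl
  refine (congrArg (reduceEps π σ).map e).trans ?_
  have hd : ∀ i : Fin 1, i ≠ 0 → Disjoint (({L i} : Set ℕ)) (Set.range ν) := fun i hi =>
    absurd (Subsingleton.elim i 0) hi
  have hcT : (reduceEps π σ).map c = hat ν v := by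
    rw [hc, ← hatMap_hat, reduceEps_incl]
  refine (TreeRec.map_node_update _ _ (Spread.singletons L) (fun j => .one (L j)) 0 hcm
    (Label.isLeast ν) hd).trans ?_
  rw [hcT]
  have e3 : node (hat L ((reduceEps π σ).gen (.inr .ε))) (Function.update
      (fun j => (reduceEps π σ).map (hone _ (L j))) 0 (hat ν v)) = hat ν v :=
    hone_hcomp (hat_mem _ _) (Label.isLeast ν)
  rw [e3, hatMap_hat]
  rfl

variable {π σ}

/-- The values of `epsDefect` are in the kernel of `π`. -/
theorem epsDefect_mem_ker (hσ : ∀ m p, π.map m (σ m p) = p) {n : ℕ} (ν : Fin (n + 1) ↪o ℕ)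
    (y : (Bimodule.free (freeOperad K X) UnitSet).Car n) :
    epsDefect π σ ν y ∈ (LinearMap.ker (π.map n)).map (hat ν) := by
  have h := Bimodule.free_eps_mem_span y
  induction h using Submodule.span_induction with
  | mem y h =>
    obtain ⟨k, l, ι, u, v, rfl⟩ := h
    rw [epsDefect_left, epsDefect_root, hcomp_hat]
    refine Submodule.mem_map_of_mem (LinearMap.mem_ker.2 ?_)
    rw [π.map_comp, map_sub, hσ, sub_self, map_zero]
  | zero => rw [map_zero]; exact zero_mem _
  | add x y _ _ hx hy => rw [map_add]; exact add_mem hx hy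
  | smul c x _ hx => rw [map_smul]; exact Submodule.smul_mem _ c hx

theorem epsDefect_left_mem (hσ : ∀ m p, π.map m (σ m p) = p) {k l n : ℕ} (ν : Fin (n + 1) ↪o ℕ)
    (ι : Insertion k l n) {r : (freeOperad K X).Op k} (hr : π.map k r = 0)
    (y : (Bimodule.free (freeOperad K X) UnitSet).Car l) :
    epsDefect π σ ν ((Bimodule.free (freeOperad K X) UnitSet).left ι r y) ∈
      (kernelSq π n).map (hat ν) := by
  rw [epsDefect_left]
  obtain ⟨r', hr', h⟩ := epsDefect_mem_ker hσ (ι.inner.trans ν) y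
  rw [← h, hcomp_hat]
  exact Submodule.mem_map_of_mem (comp_mem_kernelSq ι hr hr')

/-- The right action of the kernel on `ε`, modulo the square of the kernel. -/
theorem epsDefect_right_mem (hσ : ∀ m p, π.map m (σ m p) = p)
    {M : Bimodule (freeOperad K X)} (d : Derivation M) {k l n : ℕ} (ν : Fin (n + 1) ↪o ℕ)
    (ι : Insertion k l n) (y : (Bimodule.free (freeOperad K X) UnitSet).Car k)
    {r : (freeOperad K X).Op l} (hr : π.map l r = 0) :
    epsDefect π σ ν ((Bimodule.free (freeOperad K X) UnitSet).right ι y r) -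
      hat ν ((freeOperad K X).comp ι (((toTwisted d).map k y).2 ι.slot) r) ∈
      (kernelSq π n).map (hat ν) := by
  have h := Bimodule.free_eps_mem_span y
  induction h using Submodule.span_induction with
  | mem y h =>
    obtain ⟨k', l', α, u, v, rfl⟩ := h
    have hp : ((toTwisted d).map k ((Bimodule.free (freeOperad K X) UnitSet).left α u
        ((Bimodule.free (freeOperad K X) UnitSet).right (Insertion.root l') (eps _) v))).2 =
        markLeft _ α u (fun _ => v) := by
      rw [(toTwisted d).map_left, toTwisted_root]
      rfl
    rw [hp]
    by_cases hz : ∃ z, α.inner z = ι.slot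
    -- Grafted above `ε`: the composite of `v` and `r` is in the kernel and has zero normal form, so
    -- the value is exactly `(u ∘ v) ∘ r`, where `u ∘ v` is the component marked at the graft point.
    · obtain ⟨q, γ, δ, h⟩ := Insertion.exists_sequential_right α ι hz
      obtain ⟨z, hz⟩ := hz
      rw [Bimodule.seq_left_right _ h, Bimodule.seq_right_right _ δ.root_isSequential,
        epsDefect_left, epsDefect_root, hcomp_hat, ← hz, markLeft_inner, (freeOperad K X).comp_seq h,
        π.map_comp, hr, map_zero, map_zero, sub_zero, sub_self]
      exact zero_mem _
    -- Grafted elsewhere: there is no mark at the graft point, and the value is the composite of `u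
    -- ∘ r` with `v` minus its normal form, both in the kernel.
    · obtain ⟨q, γ, δ, h⟩ := Insertion.exists_parallel α ι (fun z e => hz ⟨z, e⟩)
      rw [Bimodule.par_left_right _ h, markLeft_of_notMem _ _ _ (fun z e => hz ⟨z, e⟩),
        LinearMap.map_zero₂, map_zero, sub_zero]
      exact epsDefect_left_mem hσ ν δ (by rw [π.map_comp, hr, map_zero]) _
  | zero =>
    have e : ((toTwisted d).map k 0).2 ι.slot = 0 :=
      congrArg (fun z => z.2 ι.slot) (map_zero ((toTwisted d).map k))
    rw [e, LinearMap.map_zero₂, LinearMap.map_zero₂, map_zero, map_zero, sub_zero]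
    exact zero_mem _
  | add x y _ _ hx hy =>
    have e : ((toTwisted d).map k (x + y)).2 ι.slot =
        ((toTwisted d).map k x).2 ι.slot + ((toTwisted d).map k y).2 ι.slot :=
      congrArg (fun z => z.2 ι.slot) (map_add ((toTwisted d).map k) x y)
    rw [e, LinearMap.map_add₂, LinearMap.map_add₂, map_add, map_add, add_sub_add_comm]
    exact add_mem hx hy
  | smul c x _ hx =>
    have e : ((toTwisted d).map k (c • x)).2 ι.slot = c • ((toTwisted d).map k x).2 ι.slot :=
      congrArg (fun z => z.2 ι.slot) (map_smul ((toTwisted d).map k) c x)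
    rw [e, LinearMap.map_smul₂, LinearMap.map_smul₂, map_smul, map_smul, ← smul_sub]
    exact Submodule.smul_mem _ c hx

/-! ### The universal derivation and the square of the kernel. -/

/-- The identity morphism of an operad. -/
def Operad.Hom.id (Q : Operad K) : Q.Hom Q := ⟨fun _ => LinearMap.id, rfl, fun _ _ _ => rfl⟩

/-- The universal derivation of a free operad. -/
noncomputable def univDerivation (K : Type u) [Field K] (X : ℕ → Type u) :
    Derivation (Bimodule.free (freeOperad K X) X) where
  map := (freeDerivation (Operad.Hom.id _) (Bimodule.free (freeOperad K X) X)
    (fun _ x => Bimodule.free.of _ x)).map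
  map_comp := (freeDerivation (Operad.Hom.id _) (Bimodule.free (freeOperad K X) X)
    (fun _ x => Bimodule.free.of _ x)).map_comp

theorem univDerivation_of {n : ℕ} (x : X n) :
    (univDerivation K X).map n (freeOperad.of K x) = Bimodule.free.of _ x :=
  freeDerivation_of _ _ _ x

/-- The morphism which sends the generators to their commutators with `ε`. -/
noncomputable def commHom (K : Type u) [Field K] (X : ℕ → Type u) :
    (Bimodule.free (freeOperad K X) X).Hom (Bimodule.free (freeOperad K X) (UnitSet.{u})) :=
  Bimodule.freeLift _ (fun _ x => commutator _ (freeOperad.of K x))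

/-- Both sides are derivations of a free operad, and they agree on generators. -/
theorem commHom_univDerivation {n : ℕ} (u : (freeOperad K X).Op n) :
    (commHom K X).map n ((univDerivation K X).map n u) = commutator _ u := by
  rw [← commutatorDerivation_map]
  refine LinearMap.congr_fun (Derivation.ext_free (d := (univDerivation K X).push (commHom K X))
    (e := commutatorDerivation _) (fun m x => ?_) n) u
  rw [commutatorDerivation_map]
  exact (congrArg _ (univDerivation_of x)).trans (Bimodule.freeLift_of _ _ x)

/-- Commutators of generators have no marks, and therefore neither has anything obtained from them
by the actions. This removes the leading term in `epsDefect_right_mem`. -/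
theorem toTwisted_commHom {n : ℕ} (m : (Bimodule.free (freeOperad K X) X).Car n) :
    ((toTwisted (univDerivation K X)).map n ((commHom K X).map n m)).2 = 0 := by
  have h : (toTwisted (univDerivation K X)).comp (commHom K X) =
      twistedInl (univDerivation K X) := Bimodule.free_hom_ext fun k x => by
    change (toTwisted (univDerivation K X)).map k ((commHom K X).map k _) = _
    rw [commHom, Bimodule.freeLift_of, toTwisted_commutator, univDerivation_of]
    rfl
  exact congrArg Prod.snd (Bimodule.Hom.congr_map h m)

/-- An element of the kernel of `π` killed by the derivation `[ ]` is in the square of the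
kernel. -/
theorem mem_kernelSq (hs : ∀ m, Function.Surjective (π.map m)) {n : ℕ}
    {r : (freeOperad K X).Op n} (hr : π.map n r = 0)
    (hd : der π (Bimodule.free P X) (fun _ x => Bimodule.free.of P x) n r = 0) :
    r ∈ kernelSq π n := by
  choose σ hσ using π.exists_section hs
  set ν : Fin (n + 1) ↪o ℕ := Fin.valOrderEmb (n + 1) with hν
  have h1 : (Bimodule.freeLift ((Bimodule.free P X).restrict π)
      (fun _ x => Bimodule.free.of P x)).map n ((univDerivation K X).map n r) = 0 := by
    refine Eq.trans ?_ hd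
    refine LinearMap.congr_fun (Derivation.ext_free (d := (univDerivation K X).push
      (Bimodule.freeLift ((Bimodule.free P X).restrict π) (fun _ x => Bimodule.free.of P x)))
      (e := freeDerivation π (Bimodule.free P X) (fun _ x => Bimodule.free.of P x))
      (fun m x => ?_) n) r
    rw [freeDerivation_of]
    exact (congrArg _ (univDerivation_of x)).trans (Bimodule.freeLift_of _ _ x)
  have h2 := Bimodule.gen_kernelAction_le π _ n (Bimodule.mem_gen_of_free_map_eq_zero π hs h1)
  -- Both kinds of kernel actions on the free bimodule end in the square: left actions compose with
  -- a value that lies in the kernel, and right actions leave only the marked component, which is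
  -- zero here.
  have h3 : ∀ m ∈ Submodule.span K {z | (Bimodule.free (freeOperad K X) X).KernelAction π n z},
      epsDefect π σ ν ((commHom K X).map n m) ∈ (kernelSq π n).map (hat ν) := by
    intro m hm
    induction hm using Submodule.span_induction with
    | mem m h =>
      rcases h with ⟨k, l, ι, r, a, hr, rfl⟩ | ⟨k, l, ι, a, r, hr, rfl⟩
      · rw [(commHom K X).map_left]
        exact epsDefect_left_mem hσ ν ι hr _
      · rw [(commHom K X).map_right]
        have h := epsDefect_right_mem hσ (univDerivation K X) ν ι ((commHom K X).map k a) hr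
        rw [toTwisted_commHom] at h
        rwa [Pi.zero_apply, LinearMap.map_zero₂, map_zero, sub_zero] at h
    | zero => rw [map_zero, map_zero]; exact zero_mem _
    | add x y _ _ hx hy => rw [map_add, map_add]; exact add_mem hx hy
    | smul c x _ hx => rw [map_smul, map_smul]; exact Submodule.smul_mem _ c hx
  have h4 := h3 _ h2
  -- On the universal derivation of `r`, the map is evaluated a second time through the commutator.
  -- The term `(ε | r)` gives `r` itself, since its normal form is zero, and each `r ∘ᵢ ε` gives an
  -- element of the square.
  rw [commHom_univDerivation, commutator, map_sub, map_sum, epsDefect_root, hr, map_zero,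
    sub_zero] at h4
  have h5 := add_mem h4 (Submodule.sum_mem _ fun i (_ : i ∈ Finset.univ) =>
    epsDefect_left_mem hσ ν (Insertion.leaf i) hr (eps _))
  rw [sub_add_cancel] at h5
  obtain ⟨r', hr', e⟩ := h5
  rwa [← hat_injective ν e]

end

end

end Shuffle

namespace Shuffle

variable {K : Type u} [Field K]

/-! ### Boundaries and brackets -/

namespace Bimodule

variable {F : Operad K}

/-- The zero morphism. -/
def Hom.zero (A B : Bimodule F) : A.Hom B where
  map := fun _ => 0
  map_left := fun ι v _ => (map_zero (B.left ι v)).symm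
  map_right := fun ι _ v => (LinearMap.map_zero₂ (B.right ι) v).symm

/-- The difference of two morphisms. -/
def Hom.sub {A B : Bimodule F} (f g : A.Hom B) : A.Hom B where
  map := fun n => f.map n - g.map n
  map_left := fun {k l n} ι v a => by
    rw [LinearMap.sub_apply, LinearMap.sub_apply, f.map_left, g.map_left, map_sub]
  map_right := fun {k l n} ι a v => by
    rw [LinearMap.sub_apply, LinearMap.sub_apply, f.map_right, g.map_right, LinearMap.map_sub₂]

theorem gen_mono {A : Bimodule F} {R R' : ∀ n, A.Car n → Prop} (h : ∀ n a, R n a → R' n a)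
    (n : ℕ) : A.gen R n ≤ A.gen R' n := fun _ ha =>
  quotMk_eq_zero.1 (gen_le_ker (A.quotMk R')
    (fun n a hR => quotMk_eq_zero.2 (Gen.of (h n a hR))) n ha)

theorem free_isFreeOn (Y : ℕ → Type u) : (free F Y).IsFreeOn (fun _ y => free.of F y) :=
  fun B ψ => ⟨freeLift B ψ, fun _ y => freeLift_of B ψ y,
    fun _ hf => free_hom_ext fun n y => (hf n y).trans (freeLift_of B ψ y).symm⟩

end Bimodule

/-! ### Descent of derivations and the lifting criterion for exactness. -/

section

variable {F P : Operad K} {π : F.Hom P}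

/-- A derivation that vanishes on the kernel of a surjection of operads descends to its target. -/
theorem Derivation.exists_descent (hs : ∀ n, Function.Surjective (π.map n)) {M : Bimodule P}
    (d : Derivation (M.restrict π)) (hd : ∀ n u, π.map n u = 0 → d.map n u = 0) :
    ∃ d' : Derivation M, ∀ n u, d'.map n (π.map n u) = d.map n u := by
  choose σ hσ using π.exists_section hs
  have key : ∀ n u u', π.map n u = π.map n u' → d.map n u = d.map n u' := fun n u u' h =>
    sub_eq_zero.1 ((map_sub (d.map n) u u').symm.trans
      (hd n _ (by rw [map_sub, h, sub_self])))
  refine ⟨⟨fun n => (d.map n).comp (σ n), fun {k l n} ι a b => ?_⟩,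
    fun n u => key n _ _ (hσ n _)⟩
  refine (key n _ (F.comp ι (σ k a) (σ l b)) ?_).trans ((d.map_comp ι _ _).trans ?_)
  · rw [hσ, π.map_comp, hσ, hσ]
  · change M.right ι _ (π.map l (σ l b)) + M.left ι (π.map k (σ k a)) _ = _
    rw [hσ, hσ]
    rfl

namespace CellExt

variable {n : ℕ} {S : Cells F n} (E : CellExt S)

/-- The morphism from `P⟨X⟩` which sends a generator `α` to `f (s α) - f (t α)`. -/
noncomputable def boundaryOf {M : Bimodule P} (f : S.C.Hom (M.restrict π)) :
    (Bimodule.free P E.X).Hom M :=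
  Bimodule.freeLift M (fun m x => f.map m (E.src m x) - f.map m (E.tgt m x))

/-- Both sides are morphisms out of the cells, so generators and identities suffice. The boundary of
a chain can be computed on any cell that represents it. -/
theorem boundaryOf_bracket
    (hπ : ∀ m a, π.map m (E.freeCells.src₀.map m a) = π.map m (E.freeCells.tgt₀.map m a))
    {M : Bimodule P} (f : S.C.Hom (M.restrict π)) {m : ℕ} (a : E.freeCells.C.Car m) :
    (E.boundaryOf f).map m ((E.bracket π hπ).map m a) =
      f.map m (E.src'.map m a) - f.map m (E.tgt'.map m a) := by
  have h : ((E.boundaryOf f).restrict π).comp (E.bracket π hπ) =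
      (f.comp E.src').sub (f.comp E.tgt') := by
    refine E.hom_ext (fun m x => ?_) (fun m c => ?_)
    · change (E.boundaryOf f).map m ((E.bracket π hπ).map m (E.ofGen x)) =
        f.map m (E.src'.map m (E.ofGen x)) - f.map m (E.tgt'.map m (E.ofGen x))
      rw [E.bracket_ofGen, E.src_ofGen, E.tgt_ofGen]
      exact Bimodule.freeLift_of _ _ x
    · change (E.boundaryOf f).map m ((E.bracket π hπ).map m (E.idc.map m c)) =
        f.map m (E.src'.map m (E.idc.map m c)) - f.map m (E.tgt'.map m (E.idc.map m c))
      rw [E.bracket_idc, E.src_idc, E.tgt_idc, sub_self]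
      exact map_zero ((E.boundaryOf f).map m)
  exact Bimodule.Hom.congr_map h a

/-- If every cycle lifts to a cell with equal source and target, then an acyclic cellular extension
makes the complex exact. -/
theorem exact_of_acyclic (hs : ∀ m, Function.Surjective (π.map m))
    (hπ : ∀ m a, π.map m (E.freeCells.src₀.map m a) = π.map m (E.freeCells.tgt₀.map m a))
    {S' : Cells F (n + 1)} (hS' : S' = E.freeCells) (E' : CellExt S') (hE' : E'.Acyclic)
    (hπ' : ∀ m a, π.map m (E'.freeCells.src₀.map m a) = π.map m (E'.freeCells.tgt₀.map m a))
    {N : Bimodule P} (δ : (Bimodule.free P E.X).Hom N)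
    (hlift : ∀ m f, δ.map m ((E.bracket π hπ).map m f) = 0 →
      ∃ f', (E.bracket π hπ).map m f' = (E.bracket π hπ).map m f ∧
        E.src'.map m f' = E.tgt'.map m f')
    (hzero : ∀ m f, E.src'.map m f = 0 → E.tgt'.map m f = 0 →
      δ.map m ((E.bracket π hπ).map m f) = 0) (m : ℕ) :
    Function.Exact ((E'.boundaryOf ((E.bracket π hπ).comp (Cells.homOfEq hS'))).map m)
      (δ.map m) := by
  subst hS'
  change Function.Exact ((E'.boundaryOf (E.bracket π hπ)).map m) _
  intro a
  constructor
  · intro ha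
    obtain ⟨f, rfl⟩ := E.bracket_surjective π hπ hs m a
    obtain ⟨f', hf', hst⟩ := hlift m f ha
    -- The cell `f'` is parallel to the identity on its source. As the bracket of an identity is
    -- zero, a cell between the two has boundary `[f']`.
    obtain ⟨A, hA, hA'⟩ := hE' m f' (E.idc.map m (E.src'.map m f')) (fun _ => by
      change E.src'.map m _ = E.src'.map m _ ∧ E.tgt'.map m _ = E.tgt'.map m _
      rw [E.src_idc, E.tgt_idc]
      exact ⟨rfl, hst.symm⟩)
    refine ⟨(E'.bracket π hπ').map m A, ?_⟩
    rw [E'.boundaryOf_bracket, hA, hA', E.bracket_idc, hf']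
    exact sub_zero _
  · rintro ⟨b, rfl⟩
    obtain ⟨B, rfl⟩ := E'.bracket_surjective π hπ' hs m b
    have hp := E'.parallel_cells m B (Nat.succ_ne_zero n)
    -- Source and target of `B` are parallel, so their difference has zero source and target, and
    -- its bracket is a cycle by assumption.
    have h := hzero m (E'.src'.map m B - E'.tgt'.map m B)
      ((map_sub (E.src'.map m) _ _).trans (sub_eq_zero.2 hp.1))
      ((map_sub (E.tgt'.map m) _ _).trans (sub_eq_zero.2 hp.2))
    rw [E'.boundaryOf_bracket]
    refine Eq.trans (congrArg (δ.map m) ?_) h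
    exact (map_sub ((E.bracket π hπ).map m) _ _).symm

end CellExt

end

/-- A cell whose source, target and bracket vanish is zero. -/
theorem CellExt.eq_zero_of_bracket_eq_zero {Y : ℕ → Type u} {P : Operad K}
    {π : (freeOperad K Y).Hom P} (hs : ∀ m, Function.Surjective (π.map m)) {n : ℕ}
    {S : Cells (freeOperad K Y) n} (E : CellExt S)
    (hS : n ≠ 0 → ∀ m r, π.map m r = 0 → ∃ b, r = S.src₀.map m b - S.tgt₀.map m b)
    (hE : ∀ m r, π.map m r = 0 →
      ∃ b, r = E.freeCells.src₀.map m b - E.freeCells.tgt₀.map m b)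
    (hπ : ∀ m a, π.map m (E.freeCells.src₀.map m a) = π.map m (E.freeCells.tgt₀.map m a)) {m : ℕ}
    {e : E.freeCells.C.Car m} (hsrc : E.src'.map m e = 0) (htgt : E.tgt'.map m e = 0)
    (he : (E.bracket π hπ).map m e = 0) : e = 0 := by
  cases n with
  | zero =>
    obtain ⟨c, z, hz, h⟩ := E.exists_idc_add_of_bracket_eq_zero π hπ hs hE he
    -- In dimension zero `c` is its own `0`-cell, so the identity on `c` is an iterated identity of
    -- a `0`-cell.
    refine Cells.eq_zero_of_idn_add E.freeCells π hs hE hπ (u := S.src₀.map m c) hz ?_ ?_ ?_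
    · rw [h, E.idn_eq, S.idn_src₀ rfl]
    · exact (congrArg (S.src₀.map m) hsrc).trans (map_zero _)
    · exact (congrArg (S.tgt₀.map m) htgt).trans (map_zero _)
  | succ n =>
    obtain ⟨c, rfl⟩ := E.exists_idc_of_bracket_eq_zero π hπ hs (hS (Nat.succ_ne_zero n)) he
    rw [E.src_idc] at hsrc
    rw [hsrc, map_zero]

/-! ### Exactness of the complex of a polygraph -/

namespace Polygraph

variable (X : Polygraph K)

theorem proj_surjective (m : ℕ) : Function.Surjective (X.proj.map m) :=
  Submodule.Quotient.mk_surjective _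

/-- Every element of the ideal of relations is the difference between the `0`-dimensional source and
target of a cell of any positive dimension. -/
theorem exists_eq_src₀_sub_tgt₀ (n m : ℕ) (r : (freeOperad K X.X₀).Op m)
    (hr : X.proj.map m r = 0) :
    ∃ b, r = (X.cells (n + 1)).src₀.map m b - (X.cells (n + 1)).tgt₀.map m b := by
  induction n with
  | zero =>
    have h : r ∈ (Bimodule.self (freeOperad K X.X₀)).gen X.Difference m :=
      (Submodule.Quotient.mk_eq_zero _).1 hr
    exact Bimodule.gen_range ((X.cells 1).src₀.sub (X.cells 1).tgt₀) h
  | succ n ih =>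
    obtain ⟨b, rfl⟩ := ih
    rw [X.cells_succ (n + 1)]
    refine ⟨(X.ext (n + 1)).idc.map m b, ?_⟩
    rw [(X.ext (n + 1)).src₀_idc, (X.ext (n + 1)).tgt₀_idc]

theorem exists_eq_freeCells_src₀_sub_tgt₀ (n m : ℕ) (r : (freeOperad K X.X₀).Op m)
    (hr : X.proj.map m r = 0) :
    ∃ b, r = (X.ext n).freeCells.src₀.map m b - (X.ext n).freeCells.tgt₀.map m b := by
  have h := X.exists_eq_src₀_sub_tgt₀ n m r hr
  rwa [X.cells_succ n] at h

/-- Both sides are derivations of the free operad with values in a bimodule over `P`, equal on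
generators by the definition of `δ₋₁`. -/
theorem boundary_zero_bracketZero {m : ℕ} (u : (freeOperad K X.X₀).Op m) :
    (X.boundary 0).map m (X.bracketZero m u) = commutator X.operad (X.proj.map m u) := by
  rw [← commutatorDerivation_map]
  refine LinearMap.congr_fun (Derivation.ext_free
    (d := (freeDerivation X.proj (Bimodule.free X.operad X.X₀)
      (fun _ x => Bimodule.free.of X.operad x)).push ((X.boundary 0).restrict X.proj))
    (e := (commutatorDerivation X.operad).pull X.proj) (fun m x => ?_) m) u
  refine (congrArg ((X.boundary 0).map m) (freeDerivation_of X.proj _ _ x)).trans ?_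
  refine (Bimodule.freeLift_of _ _ x).trans ?_
  exact (commutatorDerivation_map _).symm

/-- The bracket of `0`-cells is only a derivation, but its difference on source and target is a
morphism of bimodules by `derivationDiff`, so it can be compared on generators and identities. -/
theorem boundary_one_bracket {m : ℕ} (a : (X.ext 0).freeCells.C.Car m) :
    (X.boundary 1).map m (((X.ext 0).bracket X.proj (X.proj_src_tgt 0)).map m a) =
      X.bracketZero m ((X.ext 0).freeCells.src₀.map m a) -
        X.bracketZero m ((X.ext 0).freeCells.tgt₀.map m a) := by
  have h : ((X.boundary 1).restrict X.proj).comp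
        ((X.ext 0).bracket X.proj (X.proj_src_tgt 0)) =
      derivationDiff (X.ext 0).freeCells X.proj (X.proj_src_tgt 0)
        (freeDerivation X.proj (Bimodule.free X.operad X.X₀)
          (fun _ x => Bimodule.free.of X.operad x)) := by
    refine (X.ext 0).hom_ext (fun m x => ?_) (fun m c => ?_)
    · change (X.boundary 1).map m (((X.ext 0).bracket X.proj (X.proj_src_tgt 0)).map m ((X.ext 0).ofGen x)) =
        X.bracketZero m ((X.cells 0).src₀.map m ((X.ext 0).src'.map m ((X.ext 0).ofGen x))) -
        X.bracketZero m ((X.cells 0).tgt₀.map m ((X.ext 0).tgt'.map m ((X.ext 0).ofGen x)))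
      rw [(X.ext 0).bracket_ofGen, (X.ext 0).src_ofGen, (X.ext 0).tgt_ofGen,
        ← Cells.src₀_eq_tgt₀]
      exact Bimodule.freeLift_of _ _ x
    · change (X.boundary 1).map m (((X.ext 0).bracket X.proj (X.proj_src_tgt 0)).map m ((X.ext 0).idc.map m c)) =
        X.bracketZero m ((X.ext 0).freeCells.src₀.map m ((X.ext 0).idc.map m c)) -
        X.bracketZero m ((X.ext 0).freeCells.tgt₀.map m ((X.ext 0).idc.map m c))
      rw [(X.ext 0).bracket_idc, (X.ext 0).src₀_idc, (X.ext 0).tgt₀_idc, Cells.src₀_eq_tgt₀,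
        sub_self]
      exact map_zero ((X.boundary 1).map m)
  exact Bimodule.Hom.congr_map h a

/-! ### Exactness in each degree. -/

theorem exact_augmentation (m : ℕ) :
    Function.Exact ((X.boundary 0).map m) ((augmentation X.operad).map m) := by
  intro a
  constructor
  · intro ha
    -- The commutator of every element of `P`, not just of a generator, is a boundary: lift the
    -- element to `F` and take the boundary of its bracket.
    have h := Bimodule.gen_mono (R' := fun m z => ∃ y, z = (X.boundary 0).map m y)
      (fun m z h => by
        obtain ⟨p, rfl⟩ := h
        obtain ⟨u, rfl⟩ := X.proj_surjective m p
        exact ⟨_, (X.boundary_zero_bracketZero u).symm⟩) m (Bimodule.quotMk_eq_zero.1 ha)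
    obtain ⟨y, rfl⟩ := Bimodule.gen_range _ h
    exact ⟨y, rfl⟩
  · rintro ⟨y, rfl⟩
    have h : (augmentation X.operad).comp (X.boundary 0) = Bimodule.Hom.zero _ _ :=
      Bimodule.free_hom_ext fun m x => by
        change (augmentation X.operad).map m ((X.boundary 0).map m _) = 0
        refine Bimodule.quotMk_eq_zero.2 ?_
        exact Bimodule.Gen.of ⟨_, Bimodule.freeLift_of _ _ x⟩
    exact Bimodule.Hom.congr_map h y

theorem exact_boundary_zero (m : ℕ) :
    Function.Exact ((X.boundary 1).map m) ((X.boundary 0).map m) := by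
  intro a
  constructor
  · intro ha
    set R : ∀ m, (Bimodule.free X.operad X.X₀).Car m → Prop :=
      fun m z => ∃ y, z = (X.boundary 1).map m y with hR
    -- Each element of the kernel of `F → P` is a difference `s₀ b - t₀ b`, and its bracket is the
    -- boundary of `[b]`. So the bracket modulo boundaries is a derivation of `P`.
    obtain ⟨d, hd⟩ := Derivation.exists_descent X.proj_surjective
      ((freeDerivation X.proj (Bimodule.free X.operad X.X₀)
        (fun _ x => Bimodule.free.of X.operad x)).push
        (((Bimodule.free X.operad X.X₀).quotMk R).restrict X.proj)) (fun m r hr => by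
        obtain ⟨b, rfl⟩ := X.exists_eq_freeCells_src₀_sub_tgt₀ 0 m r hr
        refine Bimodule.quotMk_eq_zero.2 (Bimodule.Gen.of
          ⟨((X.ext 0).bracket X.proj (X.proj_src_tgt 0)).map m b, ?_⟩)
        exact (map_sub (X.bracketZero m) _ _).trans (X.boundary_one_bracket b).symm)
    -- The twisted bimodule detects what `δ₋₁` retains: the commutator of a generator goes to its
    -- class modulo boundaries. A chain killed by `δ₋₁` hence has zero class.
    have h : (toTwisted d).comp (X.boundary 0) =
        (twistedInl d).comp ((Bimodule.free X.operad X.X₀).quotMk R) :=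
      Bimodule.free_hom_ext fun m x => by
        refine (congrArg ((toTwisted d).map m) (Bimodule.freeLift_of _ _ x)).trans ?_
        refine (toTwisted_commutator d _).trans (Prod.ext ?_ rfl)
        refine (hd m _).trans ?_
        exact congrArg (((Bimodule.free X.operad X.X₀).quotMk R).map m)
          (freeDerivation_of X.proj _ _ x)
    have h' := Bimodule.Hom.congr_map h a
    have h0 : ((Bimodule.free X.operad X.X₀).quotMk R).map m a = 0 := by
      refine (congrArg Prod.fst h').symm.trans ?_
      refine congrArg Prod.fst ((congrArg ((toTwisted d).map m) ha).trans (map_zero _))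
    obtain ⟨y, hy⟩ := Bimodule.gen_range _ (Bimodule.quotMk_eq_zero.1 h0)
    exact ⟨y, hy.symm⟩
  · rintro ⟨y, rfl⟩
    obtain ⟨b, rfl⟩ := (X.ext 0).bracket_surjective X.proj (X.proj_src_tgt 0) X.proj_surjective m y
    rw [X.boundary_one_bracket]
    refine (map_sub ((X.boundary 0).map m) _ _).trans ?_
    rw [X.boundary_zero_bracketZero, X.boundary_zero_bracketZero, X.proj_src_tgt]
    exact sub_self _

/-- Every element of the square of the kernel is the difference between the source and the target of
a `1`-cell whose bracket is zero. -/
theorem exists_bracket_eq_zero {m : ℕ} {r : (freeOperad K X.X₀).Op m}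
    (hr : r ∈ kernelSq X.proj m) :
    ∃ y, ((X.ext 0).bracket X.proj (X.proj_src_tgt 0)).map m y = 0 ∧
      (X.ext 0).freeCells.src₀.map m y - (X.ext 0).freeCells.tgt₀.map m y = r := by
  induction hr using Submodule.span_induction with
  | mem r h =>
    obtain ⟨k, l, ι, r, r', hr, hr', rfl⟩ := h
    obtain ⟨b, rfl⟩ := X.exists_eq_freeCells_src₀_sub_tgt₀ 0 l r' hr'
    -- The bracket of `r ∘ b` is the class of `r` acting on `[b]`, which is zero, while its boundary
    -- is `r ∘ (s₀ b - t₀ b)`.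
    refine ⟨(X.ext 0).freeCells.C.left ι r b, ?_, ?_⟩
    · refine (((X.ext 0).bracket X.proj (X.proj_src_tgt 0)).map_left ι r b).trans ?_
      refine (congrArg (fun u => (Bimodule.free X.operad (X.ext 0).X).left ι u
        (((X.ext 0).bracket X.proj (X.proj_src_tgt 0)).map l b)) hr).trans ?_
      exact LinearMap.map_zero₂ _ _
    · rw [Bimodule.Hom.map_left, Bimodule.Hom.map_left]
      exact (map_sub ((freeOperad K X.X₀).comp ι r) _ _).symm
  | zero => exact ⟨0, map_zero _, by rw [map_zero, map_zero, sub_zero]⟩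
  | add r r' _ _ h h' =>
    obtain ⟨y, hy, rfl⟩ := h
    obtain ⟨y', hy', rfl⟩ := h'
    refine ⟨y + y', ?_, ?_⟩
    · rw [map_add, hy, hy', add_zero]
    · rw [map_add, map_add, add_sub_add_comm]
  | smul c r _ h =>
    obtain ⟨y, hy, rfl⟩ := h
    refine ⟨c • y, ?_, ?_⟩
    · rw [map_smul, hy, smul_zero]
    · rw [map_smul, map_smul, smul_sub]

theorem exact_boundary_one (hX : X.Acyclic) (m : ℕ) :
    Function.Exact ((X.boundary 2).map m) ((X.boundary 1).map m) := by
  refine (X.ext 0).exact_of_acyclic X.proj_surjective (X.proj_src_tgt 0) (X.cells_succ 0)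
    (X.ext 1) (hX 1 le_rfl) (X.proj_src_tgt 1) (X.boundary 1) (fun m f hf => ?_)
    (fun m f hf hf' => ?_) m
  · replace hf := (X.boundary_one_bracket f).symm.trans hf
    have hmem : (X.ext 0).freeCells.src₀.map m f - (X.ext 0).freeCells.tgt₀.map m f ∈
        kernelSq X.proj m :=
      mem_kernelSq X.proj_surjective
        (by rw [map_sub, X.proj_src_tgt, sub_self])
        ((map_sub (X.bracketZero m) _ _).trans hf)
    obtain ⟨y, hy, hfy⟩ := X.exists_bracket_eq_zero hmem
    -- Subtracting `y` leaves the bracket alone and cancels the difference between source and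
    -- target, which `mem_kernelSq` places in the square of the kernel.
    refine ⟨f - y, ?_, ?_⟩
    · rw [map_sub, hy, sub_zero]
    · have h : (X.cells 0).src₀.map m ((X.ext 0).src'.map m (f - y)) =
          (X.cells 0).src₀.map m ((X.ext 0).tgt'.map m (f - y)) := by
        rw [Cells.src₀_eq_tgt₀ _ ((X.ext 0).tgt'.map m (f - y))]
        change (X.ext 0).freeCells.src₀.map m (f - y) = (X.ext 0).freeCells.tgt₀.map m (f - y)
        rw [map_sub, map_sub, sub_eq_sub_iff_sub_eq_sub, hfy]
      rw [← (X.cells 0).idn_src₀ rfl m ((X.ext 0).src'.map m (f - y)), h,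
        (X.cells 0).idn_src₀ rfl]
  · refine (X.boundary_one_bracket f).trans ?_
    change X.bracketZero m ((X.cells 0).src₀.map m ((X.ext 0).src'.map m f)) -
      X.bracketZero m ((X.cells 0).tgt₀.map m ((X.ext 0).tgt'.map m f)) = 0
    rw [hf, hf', map_zero, map_zero, map_zero, map_zero, sub_self]

theorem eq_zero_of_bracketSucc_eq_zero {n m : ℕ} {e : (X.cells (n + 1)).C.Car m}
    (hsrc : (X.cells (n + 1)).src.map m e = 0) (htgt : (X.cells (n + 1)).tgt.map m e = 0)
    (he : (X.bracketSucc n).map m e = 0) : e = 0 := by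
  -- The cells are replaced by a variable so that the equality with the free cells can be
  -- substituted.
  have key : ∀ (S : Cells (freeOperad K X.X₀) (n + 1)) (h : S = (X.ext n).freeCells)
      (e : S.C.Car m), S.src.map m e = 0 → S.tgt.map m e = 0 →
      (((X.ext n).bracket X.proj (X.proj_src_tgt n)).comp (Cells.homOfEq h)).map m e = 0 →
      e = 0 := by
    rintro S rfl e hsrc htgt he
    refine (X.ext n).eq_zero_of_bracket_eq_zero X.proj_surjective (fun hn => ?_)
      (X.exists_eq_freeCells_src₀_sub_tgt₀ n) (X.proj_src_tgt n) hsrc htgt he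
    obtain ⟨n, rfl⟩ := Nat.exists_eq_succ_of_ne_zero hn
    exact X.exists_eq_src₀_sub_tgt₀ n
  exact key _ (X.cells_succ n) e hsrc htgt he

/-- Any lift `f` of a cycle works: the source and target of `f` are parallel and have equal
brackets, so their difference has zero source, target and bracket, and is zero. -/
theorem exact_boundary_add_two (hX : X.Acyclic) (n m : ℕ) :
    Function.Exact ((X.boundary (n + 3)).map m) ((X.boundary (n + 2)).map m) := by
  refine (X.ext (n + 1)).exact_of_acyclic X.proj_surjective (X.proj_src_tgt (n + 1))
    (X.cells_succ (n + 1)) (X.ext (n + 2)) (hX (n + 2) (Nat.le_add_left 1 (n + 1)))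
    (X.proj_src_tgt (n + 2)) ((X.ext (n + 1)).boundaryOf (X.bracketSucc n)) (fun m f hf => ?_)
    (fun m f hf hf' => ?_) m
  · rw [(X.ext (n + 1)).boundaryOf_bracket] at hf
    have hp := (X.ext (n + 1)).parallel_cells m f (Nat.succ_ne_zero n)
    refine ⟨f, rfl, sub_eq_zero.1 (X.eq_zero_of_bracketSucc_eq_zero ?_ ?_ ?_)⟩
    · rw [map_sub, hp.1, sub_self]
    · rw [map_sub, hp.2, sub_self]
    · exact (map_sub ((X.bracketSucc n).map m) _ _).trans hf
  · refine ((X.ext (n + 1)).boundaryOf_bracket (X.proj_src_tgt (n + 1)) _ f).trans ?_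
    rw [hf, hf', map_zero]
    exact sub_self _

end Polygraph

end Shuffle

theorem propositionP {K : Type u} [Field K] [CharZero K] (X : Shuffle.Polygraph K)
    (hX : X.Acyclic) :
    Shuffle.IsFreeResolution X.chain X.boundary (Shuffle.augmentation X.operad)
      (fun n m (x : X.gens' n m) => Shuffle.Bimodule.free.of X.operad x) where
  free := fun _ => Shuffle.Bimodule.free_isFreeOn _
  exact
    | 0 => X.exact_boundary_zero
    | 1 => X.exact_boundary_one hX
    | n + 2 => X.exact_boundary_add_two hX n
  exact_zero := X.exact_augmentation
  surjective := Shuffle.Bimodule.quotMk_surjective _ _
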